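/- Let $\mathscr{E}$ be the set of elliptic curves $E: y^2=x^3+Ax+B$ with $A,B\in\mathbb{Z}$, $4A^3+27B^2\neq 0$, such that no prime $p$ satisfies both $p^4\mid A$ and $p^6\mid B$ (one curve in each isomorphism class of elliptic curves over $\mathbb{Q}$). Let $\operatorname{height} E=\max(|4A^3|,|27B^2|)$ and $\mathscr{E}_{\le H}=\{E\in\mathscr{E}:\operatorname{height}E\le H\}$. For functions $\eta(H)$ and $X(H)\ge 0$ of $H$, consider the following random model. For each $E\in\mathscr{E}$, of height $H$, independently of the other curves: choose an integer $n\ge 0$ at random, from a distribution depending on $H$ that gives probability $1/2$ to each parity and that is supported on integers $n=(1+o(1))\,\eta(H)$ as $H\to\infty$ (for example, uniformly from $\{\lceil\eta(H)\rceil,\lceil\eta(H)\rceil+1\}$); then choose $A_E$ uniformly at random among the alternating matrices in $\operatorname{M}_n(\mathbb{Z})$ all of whose entries have absolute value at most $X(H)$; and define the pseudo-rank of $E$ as $\operatorname{rk}'_E=\operatorname{rk}_{\mathbb{Z}}(\ker A_E)$. Assume that $X(H)^{\eta(H)}=H^{1/12+o(1)}$ as $H\to\infty$, and that $\eta(H)\to\infty$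 sufficiently slowly; that is, there is a function $g$ with $g(H)\to\infty$ as $H\to\infty$ such that the following is true for all $\eta$, $X$ and all choices of the distributions of $n$ as above for which $\eta(H)\to\infty$, $\eta(H)\le g(H)$ for all sufficiently large $H$, and $X(H)^{\eta(H)}=H^{1/12+o(1)}$. With probability $1$, all of the following hold as $H\to\infty$: \begin{align*} \#\{E\in\mathscr{E}_{\le H}:\operatorname{rk}'_E=0\}&=H^{20/24+o(1)},\\ \#\{E\in\mathscr{E}_{\le H}:\operatorname{rk}'_E=1\}&=H^{20/24+o(1)},\\ \#\{E\in\mathscr{E}_{\le H}:\operatorname{rk}'_E\ge r\}&=H^{(21-r)/24+o(1)}\quad\text{for each } 2\le r\le 20,\\ \#\{E\in\mathscr{E}_{\le H}:\operatorname{rk}'_E\ge 21\}&\le H^{o(1)}, \end{align*} and $\{E\in\mathscr{E}:\operatorname{rk}'_E>21\}$ is finite. -/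

import Mathlib

open Filter Topology MeasureTheory ProbabilityTheory
open scoped NNReal ENNReal

/-- The set `ℰ` of elliptic curves `y² = x³ + A x + B` over `ℚ` with integers `A`, `B` such that
`4A³ + 27B² ≠ 0` and no prime `p` satisfies `p⁴ ∣ A` and `p⁶ ∣ B`. Every elliptic curve over `ℚ`
is isomorphic to exactly one of these, so a curve is recorded by its pair `(A, B)`. -/
@[ext]
structure EllCurve where
  A : ℤ
  B : ℤ
  smooth : 4 * A ^ 3 + 27 * B ^ 2 ≠ 0
  minimal : ∀ p : ℕ, p.Prime → ¬ ((p : ℤ) ^ 4 ∣ A ∧ (p : ℤ) ^ 6 ∣ B)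

/-- The elliptic curve `y² = x³ + A x + B` itself. -/
def EllCurve.toWeierstrassCurve (E : EllCurve) : WeierstrassCurve ℚ :=
  ⟨0, 0, 0, (E.A : ℚ), (E.B : ℚ)⟩

/-- The height `max(|4A³|, |27B²|)`. -/
def EllCurve.height (E : EllCurve) : ℤ := max |4 * E.A ^ 3| |27 * E.B ^ 2|

/-- Integer square matrices of unspecified size. -/
def SqMatrix : Type := Σ n : ℕ, Matrix (Fin n) (Fin n) ℤ

/-- `SqMatrix` is countable; all of its subsets are measurable. -/
instance : MeasurableSpace SqMatrix := ⊤

/-- The rank of the `ℤ`-module `ker A`, for `A : ℤⁿ → ℤⁿ`. -/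
noncomputable def SqMatrix.kerRank (M : SqMatrix) : ℕ :=
  Module.finrank ℤ (LinearMap.ker (Matrix.mulVecLin M.2))

/-- Alternating `n × n` integer matrices with all entries of absolute value at most `X`.
(Over `ℤ`, `Aᵀ = -A` forces the diagonal to vanish.) -/
def altBox (n : ℕ) (X : ℝ≥0) : Set (Matrix (Fin n) (Fin n) ℤ) :=
  {A | A.transpose = -A ∧ ∀ i j, |(A i j : ℝ)| ≤ X}

theorem altBox_finite (n : ℕ) (X : ℝ≥0) : (altBox n X).Finite := by
  have h : (Set.univ.pi fun _ : Fin n => Set.univ.pi fun _ : Fin n =>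
      Set.Icc (-⌊(X : ℝ)⌋) ⌊(X : ℝ)⌋).Finite :=
    Set.Finite.pi fun _ => Set.Finite.pi fun _ => Set.finite_Icc _ _
  refine h.subset fun A hA i _ j _ => ?_
  obtain ⟨h1, h2⟩ := abs_le.mp (hA.2 i j)
  refine ⟨?_, Int.le_floor.mpr h2⟩
  have : -A i j ≤ ⌊(X : ℝ)⌋ := Int.le_floor.mpr (by push_cast; linarith)
  linarith

theorem altBox_nonempty (n : ℕ) (X : ℝ≥0) : (altBox n X).Nonempty :=
  ⟨0, by simp [altBox]⟩

/-- The uniform distribution on `altBox n X`. -/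
noncomputable def unifAlt (n : ℕ) (X : ℝ≥0) : PMF (Matrix (Fin n) (Fin n) ℤ) :=
  PMF.uniformOfFinset (altBox_finite n X).toFinset
    ((altBox_finite n X).toFinset_nonempty.mpr (altBox_nonempty n X))

/-- The law of the random matrix of the model: choose the size `n` with law `ν`, then an
`n × n` alternating integer matrix with entries bounded by `X` uniformly at random. -/
noncomputable def modelLaw (ν : PMF ℕ) (X : ℝ≥0) : PMF SqMatrix :=
  ν.bind fun n => (unifAlt n X).map fun A => (⟨n, A⟩ : SqMatrix)

/-- `n` is "an integer of size about `η(H)` of random parity": for every `H` the law `ν H` gives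
probability `1/2` to the even integers, and `n = (1 + o(1)) η(H)` uniformly on its support. -/
def IsSizeLaw (η : ℝ → ℝ) (ν : ℝ → PMF ℕ) : Prop :=
  (∀ H : ℝ, (ν H).toMeasure {n : ℕ | Even n} = 1 / 2) ∧
  ∀ ε : ℝ, 0 < ε → ∀ᶠ H in atTop, ∀ n ∈ (ν H).support, |(n : ℝ) - η H| ≤ ε * η H

/-- `f(H) = H^{a + o(1)}` as `H → ∞`. -/
def IsPowO1 (f : ℝ → ℝ) (a : ℝ) : Prop :=
  ∃ ε : ℝ → ℝ, Tendsto ε atTop (𝓝 0) ∧ ∀ᶠ H in atTop, f H = H ^ (a + ε H)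

/-- `f(H) ≤ H^{a + o(1)}` as `H → ∞`. -/
def LePowO1 (f : ℝ → ℝ) (a : ℝ) : Prop :=
  ∃ ε : ℝ → ℝ, Tendsto ε atTop (𝓝 0) ∧ ∀ᶠ H in atTop, f H ≤ H ^ (a + ε H)

/-- The random matrices `M E`, for `E ∈ ℰ`, form an instance of the model with parameters
`X` and `ν`: they are independent, and `M E` has the law of the model at `H = height E`. -/
structure IsRankModel (X : ℝ → ℝ≥0) (ν : ℝ → PMF ℕ) {Ω : Type*} [MeasurableSpace Ω]
    (μ : Measure Ω) (M : EllCurve → Ω → SqMatrix) : Prop where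
  indep : iIndepFun M μ
  law : ∀ E, HasLaw (M E) (modelLaw (ν E.height) (X E.height)).toMeasure μ

/-- The number of `E ∈ ℰ` of height at most `H` whose pseudo-rank `rk E` satisfies `P`. -/
noncomputable def countRank (rk : EllCurve → ℕ) (P : ℕ → Prop) (H : ℝ) : ℝ :=
  (Set.ncard {E : EllCurve | (E.height : ℝ) ≤ H ∧ P (rk E)} : ℝ)

/-! The heart is a count of matrices of fixed size `n`. The box of alternating matrices with entries
up to `X` has order `X ^ (n(n-1)/2)` elements, and those of even rank `m`, `2 ≤ m < n`, number `X ^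
(nm/2)` up to a bounded power of `X`. So corank at least `r` of the right parity has probability `X
^ (-n(r-1)/2 + O(1))`. Since `n` is close to `η` and `X ^ η = H ^ (1/12 + o(1))`, this is `H ^
(-(r-1)/24 + o(1))`, the factor `X ^ O(1)` being `H ^ o(1)` because `η → ∞`. Constants depending on
`n` are harmless once `X` exceeds a threshold depending on `n`; slow growth of `η` ensures that
(`exists_slow_function`).

Upper bound (`ncard_rank_eq_le`): write `A = Wᵀ J W`, with `W` a reduced basis of the saturated row
lattice. Reduction gives `|J i j| |W i| |W j| ≪ X`. Counting pairs `(W, J)` with rows of dyadic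
sizes `2 ^ k i` is too generous, since a lattice has many bases of the same shape; dividing by the
number of admissible unitriangular changes of basis (`card_factored_le`) yields the right exponent.
Nonsingularity of `J` enters through a permutation `σ` with `k i + k (σ i) ≤ κ`, where `2 ^ κ` is of
order `X` (`exponent_le`).

Lower bound (`exists_ncard_rank_ge`): start with corank 1 in size `m + 1`, which is typical by the
upper bound, and enlarge by one row and column at a time without raising the rank. The new row may
be any short vector orthogonal to the kernel, and there are at least order `X ^ (m/2)` of these
(`ncard_kerPerp_ge`, `rank_border_of_mem_kerPerp`).

On the arithmetic side there are `H ^ (20/24 + o(1))` curves up to height `H`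
(`summable_height_rpow`, `exists_le_ncard_height_le`), so the expected number with pseudo-rank at
least `r` is `H ^ ((21-r)/24 + o(1))` for `1 ≤ r ≤ 20`. Almost sure upper bounds follow from
finiteness of a weighted expectation, lower bounds from Chebyshev and Borel–Cantelli along `H = 2 ^
j`, and finiteness beyond 21 from Borel–Cantelli. -/

/-! ### Lattice norms and reduced generating systems -/

/-- An integrally homogeneous norm on an abelian group all of whose balls are finite. -/
structure IsLatticeNorm {L : Type*} [AddCommGroup L] (N : L → ℝ) : Prop where
  add_le : ∀ x y, N (x + y) ≤ N x + N y
  smul : ∀ (k : ℤ) x, N (k • x) = |(k : ℝ)| * N x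
  eq_zero : ∀ x, N x = 0 → x = 0
  finite_ball : ∀ R : ℝ, {x | N x ≤ R}.Finite

namespace IsLatticeNorm

variable {L : Type*} [AddCommGroup L] {N : L → ℝ}

lemma map_zero (h : IsLatticeNorm N) : N 0 = 0 := by
  simpa using h.smul 0 0

lemma neg (h : IsLatticeNorm N) (x : L) : N (-x) = N x := by
  simpa using h.smul (-1) x

lemma nonneg (h : IsLatticeNorm N) (x : L) : 0 ≤ N x := by
  have h1 := h.add_le x (-x)
  rw [h.neg, add_neg_cancel, h.map_zero] at h1
  linarith

lemma pos (h : IsLatticeNorm N) {x : L} (hx : x ≠ 0) : 0 < N x :=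
  lt_of_le_of_ne (h.nonneg x) fun e => hx (h.eq_zero x e.symm)

lemma isTorsionFree (h : IsLatticeNorm N) : Module.IsTorsionFree ℤ L := by
  refine Module.IsTorsionFree.of_smul_eq_zero fun k x hkx => ?_
  by_contra! hne
  have h1 := h.smul k x
  rw [hkx, h.map_zero] at h1
  have h2 := h.pos hne.2
  have h3 : (0 : ℝ) < |(k : ℝ)| := by simpa using hne.1
  have := mul_pos h3 h2
  linarith

lemma exists_shortest (h : IsLatticeNorm N) [Nontrivial L] :
    ∃ w : L, w ≠ 0 ∧ ∀ x, x ≠ 0 → N w ≤ N x := by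
  obtain ⟨a, ha⟩ := exists_ne (0 : L)
  have hf : ({x | N x ≤ N a} ∩ {x | x ≠ 0}).Finite := (h.finite_ball (N a)).inter_of_left _
  obtain ⟨w, hw, hmin⟩ := Set.exists_min_image _ N hf ⟨a, le_refl (N a), ha⟩
  refine ⟨w, hw.2, fun x hx => ?_⟩
  by_cases hxa : N x ≤ N a
  · exact hmin x ⟨hxa, hx⟩
  · exact hw.1.trans (not_le.mp hxa).le

lemma sum_le (h : IsLatticeNorm N) {ι : Type*} (s : Finset ι) (f : ι → L) :
    N (∑ i ∈ s, f i) ≤ ∑ i ∈ s, N (f i) := by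
  classical
  induction s using Finset.induction_on with
  | empty => simp [h.map_zero]
  | insert a s ha ih =>
    rw [Finset.sum_insert ha, Finset.sum_insert ha]
    exact (h.add_le _ _).trans (by linarith)

end IsLatticeNorm

/-- The values whose infimum is the norm of the class of `x` modulo the line through `w`. -/
def quotNormSet {L : Type*} [AddCommGroup L] (N : L → ℝ) (w x : L) : Set ℝ :=
  {s | ∃ k t : ℤ, 0 < k ∧ s = N (k • x + t • w) / k}

/-- The distance from `x` to the line through `w`. -/
noncomputable def lineDist {L : Type*} [AddCommGroup L] (N : L → ℝ) (w x : L) : ℝ :=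
  sInf (quotNormSet N w x)

namespace IsLatticeNorm

variable {L : Type*} [AddCommGroup L] {N : L → ℝ}

lemma lineDist_le (h : IsLatticeNorm N) (w x : L) (k t : ℤ) (hk : 0 < k) :
    lineDist N w x ≤ N (k • x + t • w) / k := by
  refine csInf_le ⟨0, ?_⟩ ⟨k, t, hk, rfl⟩
  rintro _ ⟨k, t, hk, rfl⟩
  have : (0 : ℝ) < k := by exact_mod_cast hk
  exact div_nonneg (h.nonneg _) this.le

lemma le_lineDist (w x : L) (r : ℝ)
    (H : ∀ k t : ℤ, 0 < k → r * k ≤ N (k • x + t • w)) : r ≤ lineDist N w x := by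
  refine le_csInf ⟨_, 1, 0, one_pos, rfl⟩ ?_
  rintro _ ⟨k, t, hk, rfl⟩
  have : (0 : ℝ) < k := by exact_mod_cast hk
  rw [le_div_iff₀ this]
  exact H k t hk

lemma exists_of_lineDist_lt {w x : L} {R : ℝ} (hR : lineDist N w x < R) :
    ∃ k t : ℤ, 0 < k ∧ N (k • x + t • w) < R * k := by
  have hne : (quotNormSet N w x).Nonempty := ⟨_, 1, 0, one_pos, rfl⟩
  obtain ⟨_, ⟨k, t, hk, rfl⟩, hlt⟩ := exists_lt_of_csInf_lt hne hR
  have : (0 : ℝ) < k := by exact_mod_cast hk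
  exact ⟨k, t, hk, (div_lt_iff₀ this).mp hlt⟩

lemma lineDist_nonneg (h : IsLatticeNorm N) (w x : L) : 0 ≤ lineDist N w x :=
  le_lineDist w x 0 fun k t _ => by simpa using h.nonneg _

lemma lineDist_le_self (h : IsLatticeNorm N) (w x : L) : lineDist N w x ≤ N x := by
  simpa using h.lineDist_le w x 1 0 one_pos

lemma lineDist_add_smul (w x : L) (s : ℤ) : lineDist N w (x + s • w) = lineDist N w x := by
  unfold lineDist
  congr 1
  ext r
  constructor
  · rintro ⟨k, t, hk, rfl⟩
    exact ⟨k, k * s + t, hk, by congr 2; module⟩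
  · rintro ⟨k, t, hk, rfl⟩
    exact ⟨k, t - k * s, hk, by congr 2; module⟩

lemma lineDist_add_le (h : IsLatticeNorm N) (w x y : L) :
    lineDist N w (x + y) ≤ lineDist N w x + lineDist N w y := by
  refine le_of_forall_pos_le_add fun ε hε => ?_
  obtain ⟨k, t, hk, h1⟩ := exists_of_lineDist_lt (N := N) (w := w) (x := x)
    (lt_add_of_pos_right _ (half_pos hε))
  obtain ⟨l, s, hl, h2⟩ := exists_of_lineDist_lt (N := N) (w := w) (x := y)
    (lt_add_of_pos_right _ (half_pos hε))
  have hk' : (0 : ℝ) < k := by exact_mod_cast hk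
  have hl' : (0 : ℝ) < l := by exact_mod_cast hl
  refine (h.lineDist_le w (x + y) (k * l) (l * t + k * s) (mul_pos hk hl)).trans ?_
  have e : (k * l) • (x + y) + (l * t + k * s) • w = l • (k • x + t • w) + k • (l • y + s • w) := by
    module
  push_cast
  rw [div_le_iff₀ (mul_pos hk' hl'), e]
  refine (h.add_le _ _).trans ?_
  rw [h.smul, h.smul, abs_of_pos hk', abs_of_pos hl']
  nlinarith

lemma lineDist_smul (h : IsLatticeNorm N) (w x : L) (j : ℤ) :
    lineDist N w (j • x) = |(j : ℝ)| * lineDist N w x := by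
  rcases eq_or_ne j 0 with rfl | hj
  · simp only [zero_smul, Int.cast_zero, abs_zero, zero_mul]
    exact le_antisymm ((h.lineDist_le_self w 0).trans h.map_zero.le) (h.lineDist_nonneg w 0)
  have hj' : (0 : ℝ) < |(j : ℝ)| := by simpa using hj
  apply le_antisymm
  · rw [mul_comm, ← div_le_iff₀ hj']
    refine le_lineDist w x _ fun k t hk => ?_
    have hk' : (0 : ℝ) < k := by exact_mod_cast hk
    have h1 := h.lineDist_le w (j • x) k (j * t) hk
    have e : k • j • x + (j * t) • w = j • (k • x + t • w) := by module
    rw [e, h.smul, le_div_iff₀ hk'] at h1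
    rw [div_mul_eq_mul_div, div_le_iff₀ hj']
    linarith
  · refine le_lineDist w _ _ fun k t hk => ?_
    have hk' : (0 : ℝ) < k := by exact_mod_cast hk
    rcases lt_or_gt_of_ne hj with hn | hp
    · have h1 := h.lineDist_le w x (-(k * j)) (-t) (by nlinarith)
      have e : (-(k * j)) • x + (-t) • w = -(k • j • x + t • w) := by module
      have hjr : (j : ℝ) < 0 := by exact_mod_cast hn
      rw [e, h.neg, le_div_iff₀ (by push_cast; nlinarith)] at h1
      rw [abs_of_neg hjr]
      push_cast at h1
      linarith
    · have h1 := h.lineDist_le w x (k * j) t (by positivity)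
      have e : (k * j) • x + t • w = k • j • x + t • w := by module
      have hjr : (0 : ℝ) < j := by exact_mod_cast hp
      rw [e, le_div_iff₀ (by push_cast; positivity)] at h1
      rw [abs_of_pos hjr]
      push_cast at h1
      linarith

/-- A near-optimal rational multiple `t / k` of `w` is rounded to an integer, which moves the point
by at most half of `w`. -/
lemma exists_lift (h : IsLatticeNorm N) {w x : L} {R : ℝ} (hR : lineDist N w x < R) :
    ∃ s : ℤ, N (x + s • w) ≤ R + N w / 2 := by
  obtain ⟨k, t, hk, h1⟩ := exists_of_lineDist_lt hR
  have hk' : (0 : ℝ) < k := by exact_mod_cast hk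
  refine ⟨round ((t : ℝ) / k), ?_⟩
  set s := round ((t : ℝ) / k)
  have h2 : |(t : ℝ) / k - s| ≤ 1 / 2 := abs_sub_round _
  have h3 : |((k * s - t : ℤ) : ℝ)| ≤ k / 2 := by
    have : ((k * s - t : ℤ) : ℝ) = -(k * ((t : ℝ) / k - s)) := by
      push_cast; field_simp; ring
    rw [this, abs_neg, abs_mul, abs_of_pos hk']
    nlinarith
  have e : k • (x + s • w) = (k • x + t • w) + (k * s - t) • w := by module
  have h4 := h.add_le (k • x + t • w) ((k * s - t) • w)
  rw [← e, h.smul, h.smul, abs_of_pos hk'] at h4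
  have h5 := mul_le_mul_of_nonneg_right h3 (h.nonneg w)
  have : k * N (x + s • w) ≤ k * (R + N w / 2) := by nlinarith
  exact le_of_mul_le_mul_left this hk'

end IsLatticeNorm

/-- The norm induced on the quotient by a line. -/
noncomputable def quotNorm {L : Type*} [AddCommGroup L] (N : L → ℝ) (w : L) :
    (L ⧸ Submodule.span ℤ {w}) → ℝ := fun q => lineDist N w q.out

namespace IsLatticeNorm

variable {L : Type*} [AddCommGroup L] {N : L → ℝ}

lemma quotNorm_mk (w x : L) :
    quotNorm N w (Submodule.Quotient.mk x) = lineDist N w x := by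
  have h1 : (Submodule.Quotient.mk (Quotient.out
      (Submodule.Quotient.mk x : L ⧸ Submodule.span ℤ {w})) : L ⧸ Submodule.span ℤ {w}) =
      Submodule.Quotient.mk x := Quotient.out_eq _
  rw [Submodule.Quotient.eq, Submodule.mem_span_singleton] at h1
  obtain ⟨s, hs⟩ := h1
  have h2 : Quotient.out (Submodule.Quotient.mk x : L ⧸ Submodule.span ℤ {w}) = x + s • w := by
    rw [hs]; abel
  rw [quotNorm, h2, lineDist_add_smul]

/-- Minimality of `w` is what makes the quotient norm definite: a class at distance zero from the
line has a lift shorter than `w`, which must vanish. In particular the quotient is torsion-free, so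
induction on the rank can proceed. -/
lemma quot (h : IsLatticeNorm N) {w : L} (hw0 : w ≠ 0) (hw : ∀ x, x ≠ 0 → N w ≤ N x) :
    IsLatticeNorm (quotNorm N w) where
  add_le x y := by
    obtain ⟨x, rfl⟩ := Submodule.Quotient.mk_surjective _ x
    obtain ⟨y, rfl⟩ := Submodule.Quotient.mk_surjective _ y
    rw [← Submodule.Quotient.mk_add, quotNorm_mk, quotNorm_mk, quotNorm_mk]
    exact h.lineDist_add_le w x y
  smul k x := by
    obtain ⟨x, rfl⟩ := Submodule.Quotient.mk_surjective _ x
    rw [← Submodule.Quotient.mk_smul, quotNorm_mk, quotNorm_mk, h.lineDist_smul]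
  eq_zero x hx := by
    obtain ⟨x, rfl⟩ := Submodule.Quotient.mk_surjective _ x
    rw [quotNorm_mk] at hx
    have hpos := h.pos hw0
    obtain ⟨s, hs⟩ := h.exists_lift (w := w) (x := x) (R := N w / 4) (by rw [hx]; positivity)
    have : x + s • w = 0 := by
      by_contra hne
      linarith [hw _ hne]
    rw [Submodule.Quotient.mk_eq_zero, Submodule.mem_span_singleton]
    exact ⟨-s, by rw [neg_smul]; exact (eq_neg_of_add_eq_zero_left this).symm⟩
  finite_ball R := by
    refine ((h.finite_ball (R + 1 + N w / 2)).image Submodule.Quotient.mk).subset fun q hq => ?_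
    obtain ⟨x, rfl⟩ := Submodule.Quotient.mk_surjective _ q
    have hq' : lineDist N w x ≤ R := by rw [← quotNorm_mk]; exact hq
    obtain ⟨s, hs⟩ := h.exists_lift (w := w) (x := x) (R := R + 1) (by linarith)
    refine ⟨x + s • w, hs, ?_⟩
    rw [Submodule.Quotient.eq, Submodule.mem_span_singleton]
    exact ⟨s, by abel⟩

end IsLatticeNorm

open IsLatticeNorm in
/-- Lattices have reduced generating systems: the size of each term of the expansion of a vector
is bounded by a constant multiple of the norm of the vector. -/
theorem exists_reduced_generators (m : ℕ) : ∃ C : ℝ, 1 ≤ C ∧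
    ∀ (L : Type) [AddCommGroup L] [Module.Finite ℤ L] (N : L → ℝ), IsLatticeNorm N →
      Module.finrank ℤ L = m →
      ∃ w : Fin m → L, ∀ x, ∃ c : Fin m → ℤ, x = ∑ i, c i • w i ∧
        ∀ i, |(c i : ℝ)| * N (w i) ≤ C * N x := by
  induction m with
  | zero =>
    refine ⟨1, le_rfl, fun L _ _ N h hL => ⟨Fin.elim0, fun x => ⟨Fin.elim0, ?_, fun i => i.elim0⟩⟩⟩
    have := h.isTorsionFree
    have hs : Subsingleton L := Module.finrank_zero_iff.mp hL
    exact Subsingleton.elim _ _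
  | succ m ih =>
    obtain ⟨C, hC, ih⟩ := ih
    -- `3 * C` bounds each term lifted from the quotient; `1 + m * (3 * C)` bounds the remaining
    -- multiple of `w` by the triangle inequality.
    refine ⟨1 + m * (3 * C) + 3 * C, by nlinarith [(Nat.cast_nonneg m : (0 : ℝ) ≤ m)],
      fun L _ _ N h hL => ?_⟩
    have htf := h.isTorsionFree
    have hnt : Nontrivial L := Module.nontrivial_of_finrank_pos (R := ℤ) (by omega)
    obtain ⟨w, hw0, hw⟩ := h.exists_shortest
    have hwpos := h.pos hw0
    have h' := h.quot hw0 hw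
    have hspan : Module.finrank ℤ (Submodule.span ℤ {w}) = 1 := by
      have hli : LinearIndependent ℤ ![w] := by
        rw [linearIndependent_unique_iff]
        simpa using hw0
      have := finrank_span_eq_card hli
      rwa [Matrix.range_cons, Matrix.range_empty, Set.union_empty, Fintype.card_fin] at this
    have hq : Module.finrank ℤ (L ⧸ Submodule.span ℤ {w}) = m := by
      have := Submodule.finrank_quotient_add_finrank (R := ℤ) (Submodule.span ℤ {w})
      omega
    obtain ⟨v, hv⟩ := ih _ _ h' hq
    have hlift : ∀ i, ∃ b : L, (Submodule.Quotient.mk b : L ⧸ Submodule.span ℤ {w}) = v i ∧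
        N b ≤ 3 * quotNorm N w (v i) := by
      intro i
      obtain ⟨x, hx⟩ := Submodule.Quotient.mk_surjective _ (v i)
      rw [← hx, quotNorm_mk]
      by_cases hx0 : lineDist N w x = 0
      · refine ⟨0, ?_, by rw [h.map_zero, hx0]; simp⟩
        rw [Submodule.Quotient.mk_zero]
        exact (h'.eq_zero _ (by rw [quotNorm_mk, hx0])).symm
      have hpos : 0 < lineDist N w x := lt_of_le_of_ne (h.lineDist_nonneg w x) (Ne.symm hx0)
      -- A nonzero class has no lift shorter than `w`, while rounding gives lifts of norm at most
      -- its distance plus `N w / 2`, up to `ε`. Hence the term `N w / 2` in a lift is itself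
      -- controlled by the distance, which gives the factor 3.
      have hge : N w / 2 ≤ lineDist N w x := by
        refine le_of_forall_pos_lt_add fun ε hε => ?_
        obtain ⟨s, hs⟩ := h.exists_lift (w := w) (x := x) (R := lineDist N w x + ε / 2) (by linarith)
        have : x + s • w ≠ 0 := by
          intro e
          apply hx0
          rw [← lineDist_add_smul w x s, e]
          exact le_antisymm ((h.lineDist_le_self w 0).trans h.map_zero.le) (h.lineDist_nonneg w 0)
        linarith [hw _ this]
      obtain ⟨s, hs⟩ := h.exists_lift (w := w) (x := x) (R := 2 * lineDist N w x) (by linarith)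
      refine ⟨x + s • w, ?_, by linarith⟩
      rw [Submodule.Quotient.eq, Submodule.mem_span_singleton]
      exact ⟨s, by abel⟩
    choose b hb hbN using hlift
    refine ⟨Fin.cons w b, fun x => ?_⟩
    obtain ⟨c, hc, hcN⟩ := hv (Submodule.Quotient.mk x)
    have hmem : (Submodule.Quotient.mk x : L ⧸ Submodule.span ℤ {w}) =
        Submodule.Quotient.mk (∑ i, c i • b i) := by
      rw [hc, ← Submodule.mkQ_apply, map_sum]
      simp [hb]
    rw [Submodule.Quotient.eq, Submodule.mem_span_singleton] at hmem
    obtain ⟨t, ht⟩ := hmem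
    have hx : x = t • w + ∑ i, c i • b i := by rw [ht]; abel
    have hterm : ∀ i, |(c i : ℝ)| * N (b i) ≤ 3 * C * N x := by
      intro i
      calc |(c i : ℝ)| * N (b i) ≤ |(c i : ℝ)| * (3 * quotNorm N w (v i)) :=
            mul_le_mul_of_nonneg_left (hbN i) (abs_nonneg _)
        _ = 3 * (|(c i : ℝ)| * quotNorm N w (v i)) := by ring
        _ ≤ 3 * (C * quotNorm N w (Submodule.Quotient.mk x)) := by linarith [hcN i]
        _ ≤ 3 * C * N x := by
            rw [quotNorm_mk]
            nlinarith [h.lineDist_le_self w x]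
    refine ⟨Fin.cons t c, ?_, fun i => ?_⟩
    · rw [Fin.sum_univ_succ]
      simpa using hx
    · have hNx := h.nonneg x
      refine Fin.cases ?_ (fun i => ?_) i
      · simp only [Fin.cons_zero]
        have e : t • w = x + -(∑ i, c i • b i) := by rw [ht]; abel
        have h1 : N (t • w) ≤ N x + ∑ i, N (c i • b i) := by
          rw [e]
          refine (h.add_le _ _).trans ?_
          rw [h.neg]
          linarith [h.sum_le Finset.univ (fun i => c i • b i)]
        have h2 : ∑ i, N (c i • b i) ≤ ∑ _i : Fin m, 3 * C * N x :=
          Finset.sum_le_sum fun i _ => by rw [h.smul]; exact hterm i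
        simp only [Finset.sum_const, Finset.card_univ, Fintype.card_fin, nsmul_eq_mul] at h2
        rw [h.smul] at h1
        nlinarith
      · simp only [Fin.cons_succ]
        have h3 := hterm i
        have : (0 : ℝ) ≤ m * (3 * C) * N x := by positivity
        nlinarith

/-! ### The factorization of alternating matrices through the saturated row lattice -/

/-- The largest absolute value of an entry of an integer vector. -/
def supAbs {n : ℕ} (v : Fin n → ℤ) : ℕ := Finset.univ.sup fun i => (v i).natAbs

lemma natAbs_le_supAbs {n : ℕ} (v : Fin n → ℤ) (i : Fin n) : (v i).natAbs ≤ supAbs v :=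
  Finset.le_sup (f := fun i => (v i).natAbs) (Finset.mem_univ i)

lemma abs_le_supAbs {n : ℕ} (v : Fin n → ℤ) (i : Fin n) : |(v i : ℝ)| ≤ supAbs v := by
  have h := natAbs_le_supAbs v i
  rw [← Int.cast_abs, Int.abs_eq_natAbs]
  exact_mod_cast h

lemma supAbs_le {n : ℕ} (v : Fin n → ℤ) {R : ℝ} (hR : 0 ≤ R) (h : ∀ i, |(v i : ℝ)| ≤ R) :
    (supAbs v : ℝ) ≤ R := by
  refine (Nat.cast_le.mpr (Finset.sup_le fun i _ => ?_)).trans (Nat.floor_le hR)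
  refine Nat.le_floor ?_
  have := h i
  rwa [← Int.cast_abs, Int.abs_eq_natAbs] at this

lemma supAbs_pos {n : ℕ} {v : Fin n → ℤ} (h : v ≠ 0) : 0 < supAbs v := by
  obtain ⟨i, hi⟩ := Function.ne_iff.mp h
  exact lt_of_lt_of_le (Int.natAbs_pos.mpr hi) (natAbs_le_supAbs v i)

lemma isLatticeNorm_supAbs {n : ℕ} (S : Submodule ℤ (Fin n → ℤ)) :
    IsLatticeNorm fun x : S => (supAbs (x : Fin n → ℤ) : ℝ) where
  add_le x y := by
    refine supAbs_le _ (by positivity) fun i => ?_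
    simp only [Submodule.coe_add, Pi.add_apply, Int.cast_add]
    exact (abs_add_le _ _).trans (add_le_add (abs_le_supAbs _ i) (abs_le_supAbs _ i))
  smul k x := by
    apply le_antisymm
    · refine supAbs_le _ (by positivity) fun i => ?_
      simp only [Submodule.coe_smul, Pi.smul_apply, smul_eq_mul, Int.cast_mul, abs_mul]
      exact mul_le_mul_of_nonneg_left (abs_le_supAbs _ i) (abs_nonneg _)
    · rcases eq_or_ne k 0 with rfl | hk
      · simp
      have hk' : (0 : ℝ) < |(k : ℝ)| := by simpa using hk
      rw [mul_comm, ← le_div_iff₀ hk']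
      refine supAbs_le _ (by positivity) fun i => ?_
      rw [le_div_iff₀ hk']
      have := abs_le_supAbs (k • (x : Fin n → ℤ)) i
      simp only [Pi.smul_apply, smul_eq_mul, Int.cast_mul, abs_mul] at this
      simp only [Submodule.coe_smul]
      linarith
  eq_zero x hx := by
    by_contra hne
    have := supAbs_pos (v := (x : Fin n → ℤ)) (by simpa using hne)
    have h0 : supAbs (x : Fin n → ℤ) = 0 := by exact_mod_cast hx
    omega
  finite_ball R := by
    have hfin : (Set.univ.pi fun _ : Fin n => Set.Icc (-⌊R⌋) ⌊R⌋).Finite :=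
      Set.Finite.pi fun _ => Set.finite_Icc _ _
    refine Set.Finite.of_finite_image (hfin.subset ?_) Subtype.val_injective.injOn
    rintro _ ⟨x, hx, rfl⟩ i -
    have h1 := abs_le.mp ((abs_le_supAbs (x : Fin n → ℤ) i).trans hx)
    refine ⟨?_, Int.le_floor.mpr h1.2⟩
    have : -(x : Fin n → ℤ) i ≤ ⌊R⌋ := Int.le_floor.mpr (by push_cast; linarith)
    linarith

/-- The integer vectors orthogonal to the kernel of `A`. -/
def kerPerp {n : ℕ} (A : Matrix (Fin n) (Fin n) ℤ) : Submodule ℤ (Fin n → ℤ) where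
  carrier := {x | ∀ y, A.mulVec y = 0 → x ⬝ᵥ y = 0}
  add_mem' hx hy z hz := by rw [add_dotProduct, hx z hz, hy z hz, add_zero]
  zero_mem' z _ := zero_dotProduct z
  smul_mem' c x hx z hz := by rw [smul_dotProduct, hx z hz, smul_zero]

/-- The rank of the kernel of a square integer matrix. -/
noncomputable def corank {n : ℕ} (A : Matrix (Fin n) (Fin n) ℤ) : ℕ :=
  Module.finrank ℤ (LinearMap.ker A.mulVecLin)

lemma rank_add_corank {n : ℕ} (A : Matrix (Fin n) (Fin n) ℤ) :
    A.rank + corank A = n := by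
  have h := Submodule.finrank_quotient_add_finrank (R := ℤ) (LinearMap.ker A.mulVecLin)
  rw [Module.finrank_fin_fun, LinearEquiv.finrank_eq A.mulVecLin.quotKerEquivRange] at h
  exact h

/-- A vector lying both in the kernel and orthogonal to it is orthogonal to itself, hence zero; so
`A` is injective on `kerPerp A`. -/
lemma finrank_kerPerp_le {n : ℕ} (A : Matrix (Fin n) (Fin n) ℤ) :
    Module.finrank ℤ (kerPerp A) ≤ A.rank := by
  have hinj : Function.Injective (A.mulVecLin.rangeRestrict.comp (kerPerp A).subtype) := by
    rw [← LinearMap.ker_eq_bot, LinearMap.ker_eq_bot']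
    intro x hx
    have hx' : A.mulVec (x : Fin n → ℤ) = 0 := by
      have := congrArg Subtype.val hx
      simpa using this
    have h0 := x.2 _ hx'
    rw [dotProduct_self_eq_zero] at h0
    exact Subtype.ext h0
  exact LinearMap.finrank_le_finrank_of_injective hinj

lemma injective_of_surjective_of_finrank {m : ℕ} {L : Type*} [AddCommGroup L]
    [Module.Finite ℤ L] [Module.Free ℤ L] (hm : Module.finrank ℤ L = m)
    (f : (Fin m → ℤ) →ₗ[ℤ] L) (hf : Function.Surjective f) : Function.Injective f := by
  let e : L ≃ₗ[ℤ] (Fin m → ℤ) := LinearEquiv.ofFinrankEq _ _ (by rw [hm, Module.finrank_fin_fun])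
  have h := OrzechProperty.injective_of_surjective_endomorphism (e.toLinearMap.comp f)
    (e.surjective.comp hf)
  exact Function.Injective.of_comp h

/-- The rows of `W` are linearly independent. -/
def RowsIndep {m n : ℕ} (W : Matrix (Fin m) (Fin n) ℤ) : Prop :=
  ∀ z : Fin m → ℤ, Matrix.vecMul z W = 0 → z = 0

lemma RowsIndep.mul_right_cancel {l m n : ℕ} {W : Matrix (Fin m) (Fin n) ℤ} (h : RowsIndep W)
    {M M' : Matrix (Fin l) (Fin m) ℤ} (e : M * W = M' * W) : M = M' := by
  ext i j
  have h0 : Matrix.vecMul ((M - M') i) W = 0 := by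
    have e' : (M - M') * W = 0 := by rw [Matrix.sub_mul, e, sub_self]
    exact congrFun e' i
  have := congrFun (h _ h0) j
  simpa [sub_eq_zero] using this

lemma RowsIndep.mul_left_cancel {l m n : ℕ} {W : Matrix (Fin m) (Fin n) ℤ} (h : RowsIndep W)
    {M M' : Matrix (Fin m) (Fin l) ℤ} (e : W.transpose * M = W.transpose * M') : M = M' := by
  have := congrArg Matrix.transpose e
  rw [Matrix.transpose_mul, Matrix.transpose_mul, Matrix.transpose_transpose] at this
  exact Matrix.transpose_injective (h.mul_right_cancel this)

lemma det_ne_zero_of_le_rank {m : ℕ} {J : Matrix (Fin m) (Fin m) ℤ} (h : m ≤ J.rank) :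
    J.det ≠ 0 := by
  intro h0
  obtain ⟨v, hv, hJv⟩ := Matrix.exists_mulVec_eq_zero_iff.mpr h0
  have hrk := rank_add_corank J
  have hk : Module.finrank ℤ (LinearMap.ker J.mulVecLin) = 0 := by
    have : corank J = 0 := by omega
    exact this
  rw [Module.finrank_zero_iff] at hk
  have := Subsingleton.elim (⟨v, by simpa using hJv⟩ : LinearMap.ker J.mulVecLin) 0
  exact hv (congrArg Subtype.val this)

/-- An alternating matrix `A` is `Wᵀ J W` where the rows of `W` form a reduced basis of the
saturated row lattice and `J` is alternating and nonsingular. -/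
theorem exists_reduced_factorization (n : ℕ) : ∃ C : ℝ, 1 ≤ C ∧
    ∀ A : Matrix (Fin n) (Fin n) ℤ, A.transpose = -A → ∃ m : ℕ,
      m + corank A = n ∧
      ∃ (W : Matrix (Fin m) (Fin n) ℤ) (J : Matrix (Fin m) (Fin m) ℤ),
        A = W.transpose * J * W ∧ J.transpose = -J ∧ J.det ≠ 0 ∧ RowsIndep W ∧
        (∀ x ∈ kerPerp A, ∃ c, x = Matrix.vecMul c W) ∧
        ∀ X : ℝ, 0 ≤ X → (∀ i j, |(A i j : ℝ)| ≤ X) →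
          ∀ i j, |(J i j : ℝ)| * supAbs (W i) * supAbs (W j) ≤ C * X := by
  choose C hC hred using exists_reduced_generators
  have hsq : ∀ m, 1 ≤ C m ^ 2 := fun m => one_le_pow₀ (hC m)
  -- The rank is not known in advance, so the constants for all `m ≤ n` are added; the square arises
  -- because reduction is applied once to the rows of `A` and once to the columns of `B`.
  refine ⟨∑ m ∈ Finset.range (n + 1), C m ^ 2, ?_, fun A hA => ?_⟩
  · exact (hsq 0).trans (Finset.single_le_sum (f := fun m => C m ^ 2) (fun m _ => sq_nonneg _)
      (Finset.mem_range.mpr (Nat.succ_pos n)))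
  obtain ⟨m, hm⟩ : ∃ m, Module.finrank ℤ (kerPerp A) = m := ⟨_, rfl⟩
  obtain ⟨w, hw⟩ := hred m _ _ (isLatticeNorm_supAbs (kerPerp A)) hm
  set W : Matrix (Fin m) (Fin n) ℤ := fun i => (w i : Fin n → ℤ) with hWdef
  have hspan : ∀ x ∈ kerPerp A, ∃ c : Fin m → ℤ, x = Matrix.vecMul c W ∧
      ∀ i, |(c i : ℝ)| * supAbs (W i) ≤ C m * supAbs x := by
    intro x hx
    obtain ⟨c, hc, hcN⟩ := hw ⟨x, hx⟩
    refine ⟨c, ?_, hcN⟩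
    have := congrArg Subtype.val hc
    simp only [Submodule.coe_sum, Submodule.coe_smul] at this
    rw [this, Matrix.vecMul_eq_sum]
  -- The `m` vectors generate a free module of rank `m`, so they form a basis.
  have hind : RowsIndep W := by
    have hinj := injective_of_surjective_of_finrank hm (Fintype.linearCombination ℤ w) (by
      intro x
      obtain ⟨c, hc, -⟩ := hw x
      exact ⟨c, by rw [hc, Fintype.linearCombination_apply]⟩)
    intro z hz
    apply hinj
    rw [map_zero, Fintype.linearCombination_apply]
    apply Subtype.ext
    simp only [Submodule.coe_sum, Submodule.coe_smul, Submodule.coe_zero]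
    rw [← hz, Matrix.vecMul_eq_sum]
  have hrow : ∀ k, A k ∈ kerPerp A := fun k y hy => congrFun hy k
  obtain ⟨B, hB, hBN⟩ : ∃ B : Matrix (Fin n) (Fin m) ℤ, (∀ k, A k = Matrix.vecMul (B k) W) ∧
      ∀ k i, |(B k i : ℝ)| * supAbs (W i) ≤ C m * supAbs (A k) := by
    choose B hB hBN using fun k => hspan (A k) (hrow k)
    exact ⟨B, hB, hBN⟩
  have hAB : A = B * W := by
    ext k j
    rw [hB k]
    rfl
  -- Alternation makes the left and right kernels of `A` agree: `A y = 0` gives `(y B) W = y A = 0`,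
  -- and the rows of `W` are independent.
  have hcol : ∀ i, (fun k => B k i) ∈ kerPerp A := by
    intro i y hy
    have h1 : Matrix.vecMul (Matrix.vecMul y B) W = 0 := by
      rw [Matrix.vecMul_vecMul, ← hAB, ← Matrix.mulVec_transpose, hA, Matrix.neg_mulVec, hy,
        neg_zero]
    have h2 := congrFun (hind _ h1) i
    rw [dotProduct_comm]
    exact h2
  choose J' hJ hJN using fun i => hspan _ (hcol i)
  set J : Matrix (Fin m) (Fin m) ℤ := Matrix.of fun j i => J' i j with hJdef
  have hBJ : B = W.transpose * J := by
    ext k i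
    have := congrFun (hJ i) k
    rw [this, Matrix.mul_apply]
    simp only [Matrix.vecMul, dotProduct, Matrix.transpose_apply, hJdef, Matrix.of_apply]
    exact Finset.sum_congr rfl fun _ _ => mul_comm _ _
  have hAW : A = W.transpose * J * W := by rw [← hBJ]; exact hAB
  have hrk : A.rank = m := by
    apply le_antisymm
    · calc A.rank = (B * W).rank := by rw [← hAB]
        _ ≤ B.rank := Matrix.rank_mul_le_left _ _
        _ ≤ m := Matrix.rank_le_width _
    · rw [← hm]; exact finrank_kerPerp_le A
  have hker := rank_add_corank A
  rw [hrk] at hker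
  refine ⟨m, hker, W, J, hAW, ?_, ?_, hind, fun x hx => ?_, fun X hX0 hX i j => ?_⟩
  · have h1 : W.transpose * J.transpose * W = W.transpose * (-J) * W := by
      have := hA
      rw [hAW] at this
      simp only [Matrix.transpose_mul, Matrix.transpose_transpose] at this
      rw [Matrix.mul_neg, Matrix.neg_mul, ← this, Matrix.mul_assoc]
    exact hind.mul_left_cancel (hind.mul_right_cancel h1)
  · apply det_ne_zero_of_le_rank
    calc m = A.rank := hrk.symm
      _ = (W.transpose * J * W).rank := by rw [← hAW]
      _ ≤ (W.transpose * J).rank := Matrix.rank_mul_le_left _ _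
      _ ≤ J.rank := Matrix.rank_mul_le_right _ _
  · obtain ⟨c, hc, -⟩ := hspan x hx
    exact ⟨c, hc⟩
  · have hCm : (1 : ℝ) ≤ C m := hC m
    have h1 := hJN j i
    have h2 : (supAbs (fun k => B k j) : ℝ) * supAbs (W j) ≤ C m * X := by
      rcases Nat.eq_zero_or_pos (supAbs (W j)) with h0 | hpos
      · rw [h0]; simp; positivity
      have hpos' : (0 : ℝ) < supAbs (W j) := by exact_mod_cast hpos
      rw [← le_div_iff₀ hpos']
      refine supAbs_le _ (by positivity) fun k => ?_
      rw [le_div_iff₀ hpos']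
      refine (hBN k j).trans (mul_le_mul_of_nonneg_left ?_ (by linarith))
      exact supAbs_le _ hX0 (hX k)
    have h3 : |(J i j : ℝ)| * supAbs (W i) * supAbs (W j) ≤ C m ^ 2 * X := by
      calc |(J i j : ℝ)| * supAbs (W i) * supAbs (W j)
          ≤ (C m * supAbs (fun k => B k j)) * supAbs (W j) :=
            mul_le_mul_of_nonneg_right h1 (by positivity)
        _ = C m * (supAbs (fun k => B k j) * supAbs (W j)) := by ring
        _ ≤ C m * (C m * X) := mul_le_mul_of_nonneg_left h2 (by linarith)
        _ = C m ^ 2 * X := by ring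
    refine h3.trans (mul_le_mul_of_nonneg_right ?_ hX0)
    exact Finset.single_le_sum (f := fun m => C m ^ 2) (fun m _ => sq_nonneg _)
      (Finset.mem_range.mpr (by omega))

/-- The corank of an alternating matrix has the parity of its size. -/
theorem even_add_corank {n : ℕ} {A : Matrix (Fin n) (Fin n) ℤ} (hA : A.transpose = -A) :
    Even (n + corank A) := by
  obtain ⟨C, -, h⟩ := exists_reduced_factorization n
  obtain ⟨m, hm, W, J, -, hJ, hdet, -⟩ := h A hA
  -- A nonsingular alternating matrix has even size, so the rank `m` is even.
  have h1 : J.det = (-1) ^ m * J.det := by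
    conv_lhs => rw [← Matrix.det_transpose, hJ, Matrix.det_neg, Fintype.card_fin]
  have hme : Even m := by
    by_contra hodd
    rw [Nat.not_even_iff_odd] at hodd
    rw [hodd.neg_one_pow] at h1
    apply hdet
    linarith
  obtain ⟨a, ha⟩ := hme
  exact ⟨a + corank A, by omega⟩

/-! ### The upper bound for the number of matrices of given rank -/

/-- Pairs of increasing indices. -/
abbrev IncPair (m : ℕ) : Type := {p : Fin m × Fin m // p.1 < p.2}

lemma sum_sum_eq_sum_incPair {M : Type*} [AddCommMonoid M] {m : ℕ} (f : Fin m → Fin m → M) :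
    ∑ i, ∑ j, f i j =
      ∑ p : IncPair m, (f p.1.1 p.1.2 + f p.1.2 p.1.1) + ∑ i, f i i := by
  have h1 : ∑ i, ∑ j, f i j = ∑ p : Fin m × Fin m, f p.1 p.2 := by
    rw [Fintype.sum_prod_type]
  have h2 : ∀ p : Fin m × Fin m, f p.1 p.2 = (if p.1 < p.2 then f p.1 p.2 else 0) +
      (if p.2 < p.1 then f p.1 p.2 else 0) + (if p.1 = p.2 then f p.1 p.2 else 0) := by
    intro p
    rcases lt_trichotomy p.1 p.2 with h | h | h
    · simp [h, h.ne, h.not_gt]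
    · simp [h]
    · simp [h, h.ne', h.not_gt]
  have h3 : ∀ f : Fin m → Fin m → M, ∑ p : Fin m × Fin m, (if p.1 < p.2 then f p.1 p.2 else 0) =
      ∑ p : IncPair m, f p.1.1 p.1.2 := by
    intro f
    rw [← Finset.sum_filter]
    exact Finset.sum_subtype _ (by simp) (fun p : Fin m × Fin m => f p.1 p.2)
  have h4 : ∑ p : Fin m × Fin m, (if p.2 < p.1 then f p.1 p.2 else 0) =
      ∑ p : IncPair m, f p.1.2 p.1.1 := by
    rw [← h3 fun i j => f j i]
    exact ((Equiv.prodComm (Fin m) (Fin m)).sum_comp _).symm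
  have h5 : ∑ p : Fin m × Fin m, (if p.1 = p.2 then f p.1 p.2 else 0) = ∑ i, f i i := by
    rw [Fintype.sum_prod_type]
    simp
  rw [h1, Finset.sum_congr rfl fun p _ => h2 p, Finset.sum_add_distrib, Finset.sum_add_distrib,
    h3 f, h4, h5, Finset.sum_add_distrib]

/-- The deficits are paid crosswise: `a + b ≤ κ` gives `a + c - κ ≤ c - b ≤ |b - c|` and `b + c - κ
≤ c - a ≤ |a - c|`. -/
lemma max_add_max_le_of_add_nonneg {κ a b c : ℤ} (h : a + b ≤ κ) :
    (max 0 (κ - a - c) - |a - c|) + (max 0 (κ - b - c) - |b - c|) ≤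
      (κ - a - c) + (κ - b - c) := by
  rcases abs_cases (a - c) with ⟨h1, h1'⟩ | ⟨h1, h1'⟩ <;>
  rcases abs_cases (b - c) with ⟨h2, h2'⟩ | ⟨h2, h2'⟩ <;>
  rcases max_cases 0 (κ - a - c) with ⟨h3, h3'⟩ | ⟨h3, h3'⟩ <;>
  rcases max_cases 0 (κ - b - c) with ⟨h4, h4'⟩ | ⟨h4, h4'⟩ <;> omega

/-- The exponent inequality behind the upper bound for the number of alternating matrices. -/
lemma exponent_le {m n κ : ℕ} (hmn : m ≤ n) (k : Fin m → ℕ) (hk : Monotone k)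
    (σ : Equiv.Perm (Fin m)) (hσ : ∀ i, k i + k (σ i) ≤ κ) :
    2 * (n * ∑ i, k i + ∑ p : IncPair m, (κ - k p.1.1 - k p.1.2)) ≤
      n * (m * κ) + 2 * ∑ p : IncPair m, (k p.1.2 - k p.1.1) := by
  -- `e i j` is the exponent gained from the entry `J i j` less the one lost to changes of basis.
  -- The goal becomes that its sum over increasing pairs, doubled, is at most `n * S`.
  set e : Fin m → Fin m → ℤ := fun i j => max 0 ((κ : ℤ) - k i - k j) - |(k i : ℤ) - k j| with he
  set S : ℤ := m * κ - 2 * ∑ i, (k i : ℤ) with hS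
  -- Summing `hσ` over `i` counts every `k i` twice.
  have hS0 : 0 ≤ S := by
    have h1 : ∑ i, ((k i : ℤ) + k (σ i)) ≤ ∑ _i : Fin m, (κ : ℤ) :=
      Finset.sum_le_sum fun i _ => by exact_mod_cast hσ i
    rw [Finset.sum_add_distrib, Equiv.sum_comp σ (fun i => (k i : ℤ))] at h1
    simp only [Finset.sum_const, Finset.card_univ, Fintype.card_fin, nsmul_eq_mul] at h1
    linarith
  have hall : ∑ i, ∑ j, e i j ≤ m * S := by
    have h1 : ∀ j, ∑ i, (e i j + e (σ i) j) ≤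
        ∑ i, (((κ : ℤ) - k i - k j) + ((κ : ℤ) - k (σ i) - k j)) := fun j =>
      Finset.sum_le_sum fun i _ => max_add_max_le_of_add_nonneg (by exact_mod_cast hσ i)
    have h2 : ∀ j, ∑ i, e i j ≤ ∑ i, ((κ : ℤ) - k i - k j) := by
      intro j
      have := h1 j
      rw [Finset.sum_add_distrib, Finset.sum_add_distrib,
        Equiv.sum_comp σ (fun i => e i j), Equiv.sum_comp σ (fun i => (κ : ℤ) - k i - k j)] at this
      linarith
    rw [Finset.sum_comm]
    refine (Finset.sum_le_sum fun j _ => h2 j).trans (le_of_eq ?_)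
    simp only [Finset.sum_sub_distrib, Finset.sum_const, Finset.card_univ, Fintype.card_fin,
      nsmul_eq_mul, hS, ← Finset.mul_sum]
    ring
  -- The diagonal contributes at least `S ≥ 0`, so removing it from the full sum keeps the bound `m
  -- * S`.
  have hdiag : S ≤ ∑ i, e i i := by
    have : ∑ i, ((κ : ℤ) - k i - k i) ≤ ∑ i, e i i := Finset.sum_le_sum fun i _ => by
      simp [he]
    refine le_trans (le_of_eq ?_) this
    simp only [Finset.sum_sub_distrib, Finset.sum_const, Finset.card_univ, Fintype.card_fin,
      nsmul_eq_mul, hS]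
    ring
  have hpair : ∑ p : IncPair m, (e p.1.1 p.1.2 + e p.1.2 p.1.1) =
      2 * ∑ p : IncPair m, (((κ - k p.1.1 - k p.1.2 : ℕ) : ℤ) - ((k p.1.2 - k p.1.1 : ℕ) : ℤ)) := by
    rw [Finset.mul_sum]
    refine Finset.sum_congr rfl fun p _ => ?_
    have hm := hk p.2.le
    simp only [he]
    rcases abs_cases ((k p.1.1 : ℤ) - k p.1.2) with ⟨h1, h1'⟩ | ⟨h1, h1'⟩ <;>
    rcases abs_cases ((k p.1.2 : ℤ) - k p.1.1) with ⟨h2, h2'⟩ | ⟨h2, h2'⟩ <;> omega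
  have hsum := sum_sum_eq_sum_incPair e
  rw [hpair, Finset.sum_sub_distrib] at hsum
  have hfin : 2 * (∑ p : IncPair m, ((κ - k p.1.1 - k p.1.2 : ℕ) : ℤ) -
      ∑ p : IncPair m, ((k p.1.2 - k p.1.1 : ℕ) : ℤ)) ≤ n * S := by
    have : (m : ℤ) * S ≤ n * S := mul_le_mul_of_nonneg_right (by exact_mod_cast hmn) hS0
    linarith
  rw [hS] at hfin
  zify
  nlinarith

/-- Every term of the Leibniz expansion satisfies the same weighted bound, and there are `m!` of
them. -/
lemma abs_det_mul_prod_le {R : Type*} [CommRing R] [LinearOrder R] [IsStrictOrderedRing R] {m : ℕ}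
    (M : Matrix (Fin m) (Fin m) R) (r c : Fin m → R) (hc : ∀ q, 0 ≤ c q)
    (h : ∀ p q, |M p q| * c q ≤ r p) :
    |M.det| * ∏ q, c q ≤ m.factorial * ∏ p, r p := by
  rw [Matrix.det_apply]
  have h1 : |∑ σ : Equiv.Perm (Fin m), Equiv.Perm.sign σ • ∏ i, M (σ i) i| ≤
      ∑ σ : Equiv.Perm (Fin m), ∏ i, |M (σ i) i| := by
    refine (Finset.abs_sum_le_sum_abs _ _).trans (Finset.sum_le_sum fun σ _ => ?_)
    rw [← Finset.abs_prod]
    rcases Int.units_eq_one_or (Equiv.Perm.sign σ) with hs | hs <;> simp [hs]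
  have h2 : ∀ σ : Equiv.Perm (Fin m), (∏ i, |M (σ i) i|) * ∏ q, c q ≤ ∏ p, r p := by
    intro σ
    rw [← Finset.prod_mul_distrib, ← Equiv.prod_comp σ r]
    exact Finset.prod_le_prod (fun i _ => mul_nonneg (abs_nonneg _) (hc i)) fun i _ => h _ _
  calc _ ≤ (∑ σ : Equiv.Perm (Fin m), ∏ i, |M (σ i) i|) * ∏ q, c q :=
        mul_le_mul_of_nonneg_right h1 (Finset.prod_nonneg fun q _ => hc q)
    _ = ∑ σ : Equiv.Perm (Fin m), (∏ i, |M (σ i) i|) * ∏ q, c q := by rw [Finset.sum_mul]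
    _ ≤ ∑ _σ : Equiv.Perm (Fin m), ∏ p, r p := Finset.sum_le_sum fun σ _ => h2 σ
    _ = _ := by
      rw [Finset.sum_const, Finset.card_univ, Fintype.card_perm, Fintype.card_fin, nsmul_eq_mul]

/-- Matrices whose `(p, q)` entry is at most `c p / c q` have adjugates of the same shape up to
`m!`. An adjugate entry is a determinant with row `b` replaced by a unit vector, for which the row
weight `c b` becomes `c a`. -/
lemma abs_adjugate_mul_le {m : ℕ} (T : Matrix (Fin m) (Fin m) ℤ) (c : Fin m → ℤ)
    (hc : ∀ q, 0 < c q) (h : ∀ p q, |T p q| * c q ≤ c p) (a b : Fin m) :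
    |T.adjugate a b| * c b ≤ m.factorial * c a := by
  rw [Matrix.adjugate_apply]
  have h1 := abs_det_mul_prod_le (T.updateRow b (Pi.single a 1)) (Function.update c b (c a)) c
    (fun q => (hc q).le) (by
      intro p q
      rcases eq_or_ne p b with rfl | hp
      · rw [Matrix.updateRow_self, Function.update_self]
        rcases eq_or_ne q a with rfl | hq
        · simp
        · simp [hq, (hc a).le]
      · rw [Matrix.updateRow_ne hp, Function.update_of_ne hp]
        exact h p q)
  have h2 : (∏ p, Function.update c b (c a) p) * c b = (∏ p, c p) * c a := by
    rw [Finset.prod_update_of_mem (Finset.mem_univ b),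
      ← Finset.mul_prod_erase Finset.univ c (Finset.mem_univ b), Finset.sdiff_singleton_eq_erase]
    ring
  have hpos : 0 < ∏ p, c p := Finset.prod_pos fun p _ => hc p
  refine le_of_mul_le_mul_right ?_ hpos
  have h3 := mul_le_mul_of_nonneg_right h1 (hc b).le
  calc _ = |(T.updateRow b (Pi.single a 1)).det| * (∏ q, c q) * c b := by ring
    _ ≤ _ := h3
    _ = m.factorial * ((∏ p, Function.update c b (c a) p) * c b) := by ring
    _ = _ := by rw [h2]; ring

/-- The lower unitriangular matrix with given entries below the diagonal. -/
def unitri {m : ℕ} (t : IncPair m → ℤ) : Matrix (Fin m) (Fin m) ℤ :=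
  Matrix.of fun j i => if h : i < j then t ⟨(i, j), h⟩ else if i = j then 1 else 0

lemma unitri_apply_of_lt {m : ℕ} (t : IncPair m → ℤ) (p : IncPair m) :
    unitri t p.1.2 p.1.1 = t p := by
  simp [unitri, p.2]

lemma unitri_injective {m : ℕ} : Function.Injective (unitri (m := m)) := fun t t' h =>
  funext fun p => by rw [← unitri_apply_of_lt t, h, unitri_apply_of_lt]

lemma det_unitri {m : ℕ} (t : IncPair m → ℤ) : (unitri t).det = 1 := by
  rw [Matrix.det_of_isLowerTriangular]
  · simp [unitri]
  · intro i j hij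
    have hij' : i < j := by simpa using hij
    simp [unitri, hij'.not_gt, hij'.ne']

/-- These are the changes of basis adding to a longer row multiples of shorter ones, with
coefficients small enough to preserve the sizes of all rows up to a constant. -/
lemma abs_unitri_mul_le {m : ℕ} (k : Fin m → ℕ) (hk : Monotone k) (t : IncPair m → ℤ)
    (ht : ∀ p : IncPair m, 0 ≤ t p ∧ t p < 2 ^ (k p.1.2 - k p.1.1)) (j i : Fin m) :
    |unitri t j i| * 2 ^ k i ≤ 2 ^ k j := by
  rcases lt_trichotomy i j with h | h | h
  · have e : unitri t j i = t ⟨(i, j), h⟩ := unitri_apply_of_lt t ⟨(i, j), h⟩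
    obtain ⟨h0, h1⟩ := ht ⟨(i, j), h⟩
    rw [e, abs_of_nonneg h0]
    calc _ ≤ (2 : ℤ) ^ (k j - k i) * 2 ^ k i := mul_le_mul_of_nonneg_right h1.le (by positivity)
      _ = 2 ^ k j := by rw [← pow_add, Nat.sub_add_cancel (hk h.le)]
  · subst h
    simp [unitri]
  · simp [unitri, h.not_gt, h.ne']

lemma transpose_congr_eq_neg {l m : ℕ} {J : Matrix (Fin l) (Fin l) ℤ} (hJ : J.transpose = -J)
    (V : Matrix (Fin l) (Fin m) ℤ) :
    (V.transpose * J * V).transpose = -(V.transpose * J * V) := by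
  simp only [Matrix.transpose_mul, Matrix.transpose_transpose, hJ]
  rw [Matrix.neg_mul, Matrix.mul_neg, Matrix.mul_assoc]

lemma eq_of_alternating_of_incPair {m : ℕ} {J J' : Matrix (Fin m) (Fin m) ℤ}
    (hJ : J.transpose = -J) (hJ' : J'.transpose = -J')
    (h : ∀ p : IncPair m, J p.1.1 p.1.2 = J' p.1.1 p.1.2) : J = J' := by
  have a1 : ∀ i j, J j i = -J i j := fun i j => congrFun (congrFun hJ i) j
  have a2 : ∀ i j, J' j i = -J' i j := fun i j => congrFun (congrFun hJ' i) j
  ext i j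
  rcases lt_trichotomy i j with hl | hl | hl
  · exact h ⟨(i, j), hl⟩
  · subst hl
    have := a1 i i
    have := a2 i i
    omega
  · rw [a1 j i, a2 j i, h ⟨(j, i), hl⟩]

lemma card_Icc_neg_le (b : ℕ) : (Finset.Icc (-(b : ℤ)) b).card = 2 * b + 1 := by
  rw [Int.card_Icc]; omega

/-- The number of alternating matrices `Wᵀ J W` with prescribed sizes of the rows of `W` and of
the entries of `J`. -/
lemma card_factored_le (n m : ℕ) : ∃ C : ℕ, 0 < C ∧ ∀ (k : Fin m → ℕ) (κ : ℕ), Monotone k →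
    ∀ S : Finset (Matrix (Fin n) (Fin n) ℤ),
    (∀ A ∈ S, ∃ (W : Matrix (Fin m) (Fin n) ℤ) (J : Matrix (Fin m) (Fin m) ℤ),
      A = W.transpose * J * W ∧ J.transpose = -J ∧ RowsIndep W ∧
      (∀ i j, |W i j| ≤ 2 ^ (k i + 1)) ∧ ∀ i j, |J i j| * 2 ^ (k i + k j) ≤ 2 ^ κ) →
    S.card * 2 ^ (∑ p : IncPair m, (k p.1.2 - k p.1.1)) ≤
      C * 2 ^ (n * ∑ i, k i + ∑ p : IncPair m, (κ - k p.1.1 - k p.1.2)) := by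
  classical
  -- An entry of the transformed `J` is a sum of `m ^ 2` products, each containing two adjugate
  -- entries that cost `m!` apiece.
  set c : ℕ := m ^ 2 * m.factorial ^ 2 with hcdef
  refine ⟨(4 * m + 1) ^ (m * n) * (2 * c + 1) ^ Fintype.card (IncPair m), by positivity,
    fun k κ hk S hS => ?_⟩
  -- One factorization is fixed for each `A`; pairing it with all admissible unitriangular matrices
  -- `T` produces distinct pairs `(T W, J')`.
  choose! W J hA hJ hind hWb hJb using hS
  let D : Finset (Matrix (Fin n) (Fin n) ℤ × (IncPair m → ℤ)) :=
    S ×ˢ Fintype.piFinset fun p : IncPair m => Finset.Ico (0 : ℤ) (2 ^ (k p.1.2 - k p.1.1))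
  let T : Finset ((Fin m → Fin n → ℤ) × (IncPair m → ℤ)) :=
    (Fintype.piFinset fun i : Fin m => Fintype.piFinset fun _ : Fin n =>
      Finset.Icc (-((m * 2 ^ (k i + 1) : ℕ) : ℤ)) ((m * 2 ^ (k i + 1) : ℕ) : ℤ)) ×ˢ
    Fintype.piFinset fun p : IncPair m =>
      Finset.Icc (-((c * 2 ^ (κ - k p.1.1 - k p.1.2) : ℕ) : ℤ))
        ((c * 2 ^ (κ - k p.1.1 - k p.1.2) : ℕ) : ℤ)
  let J' : Matrix (Fin n) (Fin n) ℤ × (IncPair m → ℤ) → Matrix (Fin m) (Fin m) ℤ := fun x =>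
    (unitri x.2).adjugate.transpose * J x.1 * (unitri x.2).adjugate
  let f : Matrix (Fin n) (Fin n) ℤ × (IncPair m → ℤ) → (Fin m → Fin n → ℤ) × (IncPair m → ℤ) :=
    fun x => (unitri x.2 * W x.1, fun p => J' x p.1.1 p.1.2)
  have hDt : ∀ x ∈ D, ∀ p : IncPair m, 0 ≤ x.2 p ∧ x.2 p < 2 ^ (k p.1.2 - k p.1.1) := by
    intro x hx p
    have := (Finset.mem_product.mp hx).2
    rw [Fintype.mem_piFinset] at this
    exact Finset.mem_Ico.mp (this p)
  have hDS : ∀ x ∈ D, x.1 ∈ S := fun x hx => (Finset.mem_product.mp hx).1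
  have hmaps : ∀ x ∈ D, f x ∈ T := by
    intro x hx
    have hT := abs_unitri_mul_le k hk x.2 (hDt x hx)
    have hV := abs_adjugate_mul_le (unitri x.2) (fun i => 2 ^ k i) (fun i => by positivity) hT
    refine Finset.mem_product.mpr ⟨?_, ?_⟩
    · rw [Fintype.mem_piFinset]
      intro j
      rw [Fintype.mem_piFinset]
      intro a
      rw [Finset.mem_Icc, ← abs_le]
      change |(unitri x.2 * W x.1) j a| ≤ _
      rw [Matrix.mul_apply]
      refine (Finset.abs_sum_le_sum_abs _ _).trans ?_
      have : ∀ i ∈ Finset.univ, |unitri x.2 j i * W x.1 i a| ≤ (2 : ℤ) ^ (k j + 1) := by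
        intro i _
        rw [abs_mul]
        calc _ ≤ |unitri x.2 j i| * 2 ^ (k i + 1) :=
              mul_le_mul_of_nonneg_left (hWb _ (hDS x hx) i a) (abs_nonneg _)
          _ = |unitri x.2 j i| * 2 ^ k i * 2 := by ring
          _ ≤ 2 ^ k j * 2 := mul_le_mul_of_nonneg_right (hT j i) (by norm_num)
          _ = _ := by ring
      refine (Finset.sum_le_sum this).trans ?_
      simp
    · rw [Fintype.mem_piFinset]
      intro p
      rw [Finset.mem_Icc, ← abs_le]
      change |J' x p.1.1 p.1.2| ≤ _
      set a := p.1.1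
      set b := p.1.2
      have hb : |J' x a b| * 2 ^ (k a + k b) ≤ c * 2 ^ κ := by
        have e : J' x a b = ∑ q, ∑ r, (unitri x.2).adjugate r a * J x.1 r q *
            (unitri x.2).adjugate q b := by
          simp only [J', Matrix.mul_apply, Matrix.transpose_apply, Finset.sum_mul]
        rw [e]
        have hterm : ∀ q r, |(unitri x.2).adjugate r a * J x.1 r q *
            (unitri x.2).adjugate q b| * 2 ^ (k a + k b) ≤ (m.factorial : ℤ) ^ 2 * 2 ^ κ := by
          intro q r
          rw [abs_mul, abs_mul]
          have h1 := hV r a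
          have h2 := hV q b
          have h3 := hJb _ (hDS x hx) r q
          calc _ = (|(unitri x.2).adjugate r a| * 2 ^ k a) *
                (|(unitri x.2).adjugate q b| * 2 ^ k b) * |J x.1 r q| := by
                rw [pow_add]; ring
            _ ≤ (m.factorial * 2 ^ k r) * (m.factorial * 2 ^ k q) * |J x.1 r q| := by
                refine mul_le_mul_of_nonneg_right ?_ (abs_nonneg _)
                exact mul_le_mul h1 h2 (by positivity) (by positivity)
            _ = (m.factorial : ℤ) ^ 2 * (|J x.1 r q| * 2 ^ (k r + k q)) := by
                rw [pow_add]; ring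
            _ ≤ _ := mul_le_mul_of_nonneg_left h3 (by positivity)
        calc _ ≤ (∑ q, ∑ r, |(unitri x.2).adjugate r a * J x.1 r q *
                (unitri x.2).adjugate q b|) * 2 ^ (k a + k b) := by
              refine mul_le_mul_of_nonneg_right ?_ (by positivity)
              exact (Finset.abs_sum_le_sum_abs _ _).trans
                (Finset.sum_le_sum fun q _ => Finset.abs_sum_le_sum_abs _ _)
          _ = ∑ q, ∑ r, |(unitri x.2).adjugate r a * J x.1 r q *
                (unitri x.2).adjugate q b| * 2 ^ (k a + k b) := by
              simp only [Finset.sum_mul]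
          _ ≤ ∑ _q : Fin m, ∑ _r : Fin m, (m.factorial : ℤ) ^ 2 * 2 ^ κ :=
              Finset.sum_le_sum fun q _ => Finset.sum_le_sum fun r _ => hterm q r
          _ = _ := by
              simp only [Finset.sum_const, Finset.card_univ, Fintype.card_fin, nsmul_eq_mul, hcdef]
              push_cast
              ring
      -- The subtraction is truncated; if `κ < k a + k b`, the inequality only has slack.
      have hle : (2 : ℤ) ^ κ ≤ 2 ^ (κ - k a - k b) * 2 ^ (k a + k b) := by
        rw [← pow_add]
        exact pow_le_pow_right₀ (by norm_num) (by omega)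
      have hpos : (0 : ℤ) < 2 ^ (k a + k b) := by positivity
      refine le_of_mul_le_mul_right (hb.trans ?_) hpos
      push_cast
      rw [mul_assoc]
      exact mul_le_mul_of_nonneg_left hle (by positivity)
  have hrec : ∀ x ∈ D, x.1 = (unitri x.2 * W x.1).transpose * J' x * (unitri x.2 * W x.1) := by
    intro x hx
    have h1 : (unitri x.2).adjugate * unitri x.2 = 1 := by
      rw [Matrix.adjugate_mul, det_unitri, one_smul]
    have h2 : (unitri x.2).transpose * (unitri x.2).adjugate.transpose = 1 := by
      rw [← Matrix.transpose_mul, h1, Matrix.transpose_one]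
    calc x.1 = (W x.1).transpose * J x.1 * W x.1 := hA _ (hDS x hx)
      _ = (W x.1).transpose * ((unitri x.2).transpose * (unitri x.2).adjugate.transpose) * J x.1 *
          ((unitri x.2).adjugate * unitri x.2) * W x.1 := by rw [h1, h2]; simp
      _ = _ := by
          simp only [J', Matrix.transpose_mul, Matrix.mul_assoc]
  -- The image determines the product, hence `A`; this fixes the chosen `W`, and independence of its
  -- rows then recovers the unitriangular matrix.
  have hinj : Set.InjOn f D := by
    intro x hx y hy hxy
    have h1 : unitri x.2 * W x.1 = unitri y.2 * W y.1 := congrArg Prod.fst hxy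
    have h2 : J' x = J' y := by
      refine eq_of_alternating_of_incPair ?_ ?_ fun p => congrFun (congrArg Prod.snd hxy) p
      · exact transpose_congr_eq_neg (hJ _ (hDS x hx)) _
      · exact transpose_congr_eq_neg (hJ _ (hDS y hy)) _
    have h3 : x.1 = y.1 := by rw [hrec x hx, h1, h2, ← hrec y hy]
    rw [← h3] at h1
    have h4 := unitri_injective ((hind _ (hDS x hx)).mul_right_cancel h1)
    exact Prod.ext h3 h4
  have hcard := Finset.card_le_card_of_injOn f hmaps hinj
  have hD : D.card = S.card * 2 ^ (∑ p : IncPair m, (k p.1.2 - k p.1.1)) := by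
    rw [Finset.card_product, Fintype.card_piFinset, ← Finset.prod_pow_eq_pow_sum]
    congr 1
    refine Finset.prod_congr rfl fun p _ => ?_
    rw [Int.card_Ico, sub_zero]
    have : ((2 : ℤ) ^ (k p.1.2 - k p.1.1)) = ((2 ^ (k p.1.2 - k p.1.1) : ℕ) : ℤ) := by push_cast; rfl
    rw [this, Int.toNat_natCast]
  have hT : T.card ≤ (4 * m + 1) ^ (m * n) * (2 * c + 1) ^ Fintype.card (IncPair m) *
      2 ^ (n * ∑ i, k i + ∑ p : IncPair m, (κ - k p.1.1 - k p.1.2)) := by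
    rw [Finset.card_product, Fintype.card_piFinset, Fintype.card_piFinset]
    simp only [Fintype.card_piFinset, card_Icc_neg_le]
    have h1 : ∏ i : Fin m, ∏ _j : Fin n, (2 * (m * 2 ^ (k i + 1)) + 1) ≤
        (4 * m + 1) ^ (m * n) * 2 ^ (n * ∑ i, k i) := by
      have h0 : ∀ i ∈ (Finset.univ : Finset (Fin m)), ∏ _j : Fin n, (2 * (m * 2 ^ (k i + 1)) + 1) ≤
          (4 * m + 1) ^ n * 2 ^ (n * k i) := by
        intro i _
        rw [Finset.prod_const, Finset.card_univ, Fintype.card_fin, mul_comm n, pow_mul, ← mul_pow]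
        refine Nat.pow_le_pow_left ?_ n
        have : 1 ≤ 2 ^ k i := Nat.one_le_two_pow
        rw [pow_succ]
        nlinarith
      refine (Finset.prod_le_prod' h0).trans (le_of_eq ?_)
      rw [Finset.prod_mul_distrib, Finset.prod_const, Finset.card_univ, Fintype.card_fin,
        Finset.prod_pow_eq_pow_sum, ← Finset.mul_sum, ← pow_mul, mul_comm n m]
    have h2 : ∏ p : IncPair m, (2 * (c * 2 ^ (κ - k p.1.1 - k p.1.2)) + 1) ≤
        (2 * c + 1) ^ Fintype.card (IncPair m) *
          2 ^ (∑ p : IncPair m, (κ - k p.1.1 - k p.1.2)) := by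
      have h0 : ∀ p ∈ (Finset.univ : Finset (IncPair m)),
          2 * (c * 2 ^ (κ - k p.1.1 - k p.1.2)) + 1 ≤
          (2 * c + 1) * 2 ^ (κ - k p.1.1 - k p.1.2) := by
        intro p _
        have : 1 ≤ 2 ^ (κ - k p.1.1 - k p.1.2) := Nat.one_le_two_pow
        nlinarith
      refine (Finset.prod_le_prod' h0).trans (le_of_eq ?_)
      rw [Finset.prod_mul_distrib, Finset.prod_const, Finset.card_univ,
        Finset.prod_pow_eq_pow_sum]
    refine (Nat.mul_le_mul h1 h2).trans (le_of_eq ?_)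
    rw [pow_add]
    ring
  rw [hD] at hcard
  exact hcard.trans hT

lemma RowsIndep.row_ne_zero {m n : ℕ} {W : Matrix (Fin m) (Fin n) ℤ} (h : RowsIndep W)
    (i : Fin m) : W i ≠ 0 := by
  intro h0
  have := h (Pi.single i 1) (by rw [Matrix.single_one_vecMul]; exact h0)
  simpa using congrFun this i

/-- Some Leibniz term is nonzero. For integer entries this gives `1 ≤ |J (σ i) i|`, which limits the
lengths of rows `i` and `σ i` jointly. -/
lemma exists_perm_of_det_ne_zero {m : ℕ} {J : Matrix (Fin m) (Fin m) ℤ} (h : J.det ≠ 0) :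
    ∃ σ : Equiv.Perm (Fin m), ∀ i, J (σ i) i ≠ 0 := by
  by_contra! hcon
  apply h
  rw [Matrix.det_apply]
  refine Finset.sum_eq_zero fun σ _ => ?_
  obtain ⟨i, hi⟩ := hcon σ
  rw [Finset.prod_eq_zero (f := fun i => J (σ i) i) (Finset.mem_univ i) hi, smul_zero]

/-- Dyadic form of the reduced factorization, with rows sorted by size. -/
lemma exists_sorted_factorization (n : ℕ) : ∃ C : ℝ, 1 ≤ C ∧
    ∀ (A : Matrix (Fin n) (Fin n) ℤ) (X : ℝ≥0) (κ m : ℕ), A ∈ altBox n X → C * X ≤ 2 ^ κ →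
      m + corank A = n → ∃ k : Fin m → ℕ, Monotone k ∧
        (∃ σ : Equiv.Perm (Fin m), ∀ i, k i + k (σ i) ≤ κ) ∧
        ∃ (W : Matrix (Fin m) (Fin n) ℤ) (J : Matrix (Fin m) (Fin m) ℤ),
          A = W.transpose * J * W ∧ J.transpose = -J ∧ RowsIndep W ∧
          (∀ i j, |W i j| ≤ 2 ^ (k i + 1)) ∧ ∀ i j, |J i j| * 2 ^ (k i + k j) ≤ 2 ^ κ := by
  obtain ⟨C, hC, h⟩ := exists_reduced_factorization n
  refine ⟨C, hC, fun A X κ m hA hκ hm => ?_⟩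
  obtain ⟨m', hm', W, J, hAW, hJ, hdet, hind, -, hb⟩ := h A hA.1
  obtain rfl : m' = m := by omega
  have hb' := hb X X.2 hA.2
  set k : Fin m' → ℕ := fun i => Nat.log 2 (supAbs (W i)) with hk
  have hWb : ∀ i j, |W i j| ≤ 2 ^ (k i + 1) := by
    intro i j
    have h1 := natAbs_le_supAbs (W i) j
    have h2 := Nat.lt_pow_succ_log_self (b := 2) (by norm_num) (supAbs (W i))
    rw [Int.abs_eq_natAbs]
    exact_mod_cast h1.trans h2.le
  have hJb : ∀ i j, |J i j| * 2 ^ (k i + k j) ≤ 2 ^ κ := by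
    intro i j
    have h1 : ∀ i, 2 ^ k i ≤ supAbs (W i) := fun i =>
      Nat.pow_log_le_self 2 (supAbs_pos (hind.row_ne_zero i)).ne'
    have h2 : (2 : ℝ) ^ (k i + k j) ≤ supAbs (W i) * supAbs (W j) := by
      rw [pow_add]
      exact_mod_cast Nat.mul_le_mul (h1 i) (h1 j)
    have h3 : |(J i j : ℝ)| * 2 ^ (k i + k j) ≤ 2 ^ κ := by
      calc _ ≤ |(J i j : ℝ)| * (supAbs (W i) * supAbs (W j)) :=
            mul_le_mul_of_nonneg_left h2 (abs_nonneg _)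
        _ = |(J i j : ℝ)| * supAbs (W i) * supAbs (W j) := by ring
        _ ≤ C * X := hb' i j
        _ ≤ 2 ^ κ := hκ
    exact_mod_cast h3
  obtain ⟨σ, hσ⟩ := exists_perm_of_det_ne_zero hdet
  have hσk : ∀ i, k i + k (σ i) ≤ κ := by
    intro i
    have h1 := hJb (σ i) i
    have h2 : (1 : ℤ) ≤ |J (σ i) i| := Int.one_le_abs (hσ i)
    have h3 : (2 : ℤ) ^ (k (σ i) + k i) ≤ 2 ^ κ := by
      refine le_trans ?_ h1
      have : (0 : ℤ) < 2 ^ (k (σ i) + k i) := by positivity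
      nlinarith
    have h4 := (pow_le_pow_iff_right₀ (by norm_num : (1 : ℤ) < 2)).mp h3
    omega
  -- Sorting makes the row sizes monotone, so that unitriangular changes of basis always add shorter
  -- rows to longer ones; `σ` is conjugated accordingly.
  set τ : Equiv.Perm (Fin m') := Tuple.sort k with hτ
  refine ⟨k ∘ τ, Tuple.monotone_sort k, ⟨τ⁻¹ * σ * τ, fun i => ?_⟩, W.submatrix τ id, J.submatrix τ τ, ?_, ?_, ?_, fun i j => hWb _ _,
    fun i j => hJb _ _⟩
  · simpa using hσk (τ i)
  · rw [hAW, Matrix.transpose_submatrix, Matrix.submatrix_mul_equiv, Matrix.submatrix_mul_equiv,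
      Matrix.submatrix_id_id]
  · rw [Matrix.transpose_submatrix, hJ]
    rfl
  · intro z hz
    have h1 : Matrix.vecMul (z ∘ τ.symm) W = 0 := by
      rw [← hz]
      ext j
      simp only [Matrix.vecMul, dotProduct, Matrix.submatrix_apply, id, Function.comp]
      rw [← Equiv.sum_comp τ]
      simp
    have h2 := hind _ h1
    ext i
    simpa using congrFun h2 (τ i)

/-- The number of dyadic size profiles is polynomial in `κ`. Absorbing it costs a factor of order `X
^ (1/2)`, the source of the `+ 1` in the exponents below. -/
lemma exists_pow_le_mul_sqrt_two_pow (n : ℕ) :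
    ∃ C : ℝ, 0 < C ∧ ∀ j : ℕ, ((j : ℝ) + 1) ^ n ≤ C * (2 ^ j : ℝ) ^ (1 / 2 : ℝ) := by
  set s : ℝ := (2 : ℝ) ^ (1 / 2 : ℝ) with hs
  have hs1 : 1 < s := Real.one_lt_rpow (by norm_num) (by norm_num)
  have hs0 : 0 < s := by linarith
  have ht : Tendsto (fun j : ℕ => ((j : ℝ) + 1) ^ n * s⁻¹ ^ (j + 1)) atTop (𝓝 0) := by
    have h0 := tendsto_pow_const_mul_const_pow_of_abs_lt_one n (r := s⁻¹)
      (by rw [abs_of_pos (by positivity)]; exact inv_lt_one_of_one_lt₀ hs1)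
    have := h0.comp (tendsto_add_atTop_nat 1)
    refine this.congr fun j => ?_
    simp
  obtain ⟨C, hC⟩ := ht.bddAbove_range
  have hC' : ∀ j : ℕ, ((j : ℝ) + 1) ^ n * s⁻¹ ^ (j + 1) ≤ C := fun j => hC ⟨j, rfl⟩
  have hCpos : 0 < C := lt_of_lt_of_le (by positivity) (hC' 0)
  refine ⟨C * s, by positivity, fun j => ?_⟩
  have e : (2 ^ j : ℝ) ^ (1 / 2 : ℝ) = s ^ j := by
    rw [hs, ← Real.rpow_natCast, ← Real.rpow_natCast, ← Real.rpow_mul (by norm_num),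
      ← Real.rpow_mul (by norm_num), mul_comm]
  rw [e]
  have h1 := hC' j
  rw [inv_pow, ← div_eq_mul_inv, div_le_iff₀ (by positivity)] at h1
  calc _ ≤ _ := h1
    _ = _ := by rw [pow_succ]; ring

/-- The upper bound for the number of alternating matrices of given rank in a box. -/
theorem ncard_rank_eq_le (n m : ℕ) (hmn : m ≤ n) : ∃ C : ℝ, 0 < C ∧ ∀ X : ℝ≥0, 1 ≤ X →
    (({A ∈ altBox n X | m + corank A = n}.ncard : ℕ) : ℝ) ≤
      C * (X : ℝ) ^ (((n * m : ℕ) + 1 : ℝ) / 2) := by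
  classical
  obtain ⟨C₀, hC₀, hfac⟩ := exists_sorted_factorization n
  obtain ⟨C₁, hC₁, hcard⟩ := card_factored_le n m
  obtain ⟨C₂, hC₂, hpow⟩ := exists_pow_le_mul_sqrt_two_pow m
  refine ⟨C₂ * C₁ * (2 * C₀) ^ (((n * m : ℕ) + 1 : ℝ) / 2), by positivity, fun X hX => ?_⟩
  have hX' : (1 : ℝ) ≤ X := by exact_mod_cast hX
  -- `2 ^ κ` is the first power of 2 above `C₀ * X`, hence at most `2 * C₀ * X`.
  obtain ⟨κ₀, hκ1, hκ2⟩ := exists_nat_pow_near (x := C₀ * X) (y := (2 : ℝ)) (by nlinarith)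
    (by norm_num)
  set κ := κ₀ + 1 with hκ
  have hκle : (2 : ℝ) ^ κ ≤ 2 * C₀ * X := by rw [hκ, pow_succ]; linarith
  set F : Finset (Matrix (Fin n) (Fin n) ℤ) :=
    ((altBox_finite n X).subset (Set.sep_subset _ fun A => m + corank A = n)).toFinset with hF
  have hFmem : ∀ A, A ∈ F ↔ A ∈ altBox n X ∧ m + corank A = n := fun A => by
    rw [hF, Set.Finite.mem_toFinset]; rfl
  have hncard : {A ∈ altBox n X | m + corank A = n}.ncard = F.card :=
    Set.ncard_eq_toFinset_card _ _
  rw [hncard]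
  let P : (Fin m → ℕ) → Matrix (Fin n) (Fin n) ℤ → Prop := fun k A => Monotone k ∧
        (∃ σ : Equiv.Perm (Fin m), ∀ i, k i + k (σ i) ≤ κ) ∧
        ∃ (W : Matrix (Fin m) (Fin n) ℤ) (J : Matrix (Fin m) (Fin m) ℤ),
          A = W.transpose * J * W ∧ J.transpose = -J ∧ RowsIndep W ∧
          (∀ i j, |W i j| ≤ 2 ^ (k i + 1)) ∧ ∀ i j, |J i j| * 2 ^ (k i + k j) ≤ 2 ^ κ
  have hk : ∀ A ∈ F, ∃ k : Fin m → ℕ, P k A := by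
    intro A hA
    obtain ⟨h1, h2⟩ := (hFmem A).mp hA
    exact hfac A X κ m h1 hκ2.le h2
  choose! k hkP using hk
  have hmaps : ∀ A ∈ F, k A ∈ Fintype.piFinset fun _ : Fin m => Finset.range (κ + 1) := by
    intro A hA
    rw [Fintype.mem_piFinset]
    intro i
    obtain ⟨-, ⟨σ, hσ⟩, -⟩ := hkP A hA
    have := hσ i
    rw [Finset.mem_range]
    omega
  have hfib : ∀ q, ((F.filter fun A => k A = q).card : ℝ) ≤ C₁ * ((2 : ℝ) ^ κ) ^ ((n * m : ℕ) / 2 : ℝ) := by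
    intro q
    set S := F.filter fun A => k A = q with hS
    have hSP : ∀ A ∈ S, P q A := fun A hA => by
      obtain ⟨h1, h2⟩ := Finset.mem_filter.mp hA
      rw [← h2]; exact hkP A h1
    rcases S.eq_empty_or_nonempty with he | ⟨A₀, hA₀⟩
    · rw [he]; simp; positivity
    obtain ⟨hmono, ⟨σ, hσ⟩, -⟩ := hSP A₀ hA₀
    have h1 := hcard q κ hmono S fun A hA => (hSP A hA).2.2
    have h2 := exponent_le hmn q hmono σ hσ
    set a := ∑ p : IncPair m, (q p.1.2 - q p.1.1)
    set b := n * ∑ i, q i + ∑ p : IncPair m, (κ - q p.1.1 - q p.1.2)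
    -- Squaring keeps the exponent `n * m * κ / 2` integral, so the computation stays in `ℕ`.
    have h3 : (S.card * 2 ^ a) ^ 2 ≤ (C₁ * 2 ^ b) ^ 2 := Nat.pow_le_pow_left h1 2
    have h4 : S.card ^ 2 * 2 ^ (2 * a) ≤ (C₁ ^ 2 * 2 ^ (n * (m * κ))) * 2 ^ (2 * a) := by
      calc S.card ^ 2 * 2 ^ (2 * a) = (S.card * 2 ^ a) ^ 2 := by
            rw [mul_pow, ← pow_mul, mul_comm a]
        _ ≤ (C₁ * 2 ^ b) ^ 2 := h3
        _ = C₁ ^ 2 * 2 ^ (2 * b) := by rw [mul_pow, ← pow_mul, mul_comm b]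
        _ ≤ C₁ ^ 2 * 2 ^ (n * (m * κ) + 2 * a) :=
            Nat.mul_le_mul_left _ (Nat.pow_le_pow_right (by norm_num) h2)
        _ = _ := by rw [pow_add, mul_assoc]
    have h5 : S.card ^ 2 ≤ C₁ ^ 2 * 2 ^ (n * (m * κ)) :=
      Nat.le_of_mul_le_mul_right h4 (by positivity)
    have h6 : ((S.card : ℝ)) ^ 2 ≤ (C₁ * ((2 : ℝ) ^ κ) ^ ((n * m : ℕ) / 2 : ℝ)) ^ 2 := by
      rw [mul_pow, ← Real.rpow_natCast (_ ^ _) 2, ← Real.rpow_mul (by positivity)]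
      rw [show ((n * m : ℕ) / 2 : ℝ) * (2 : ℕ) = ((n * m : ℕ) : ℝ) by push_cast; ring,
        Real.rpow_natCast, ← pow_mul, show κ * (n * m) = n * (m * κ) by ring]
      exact_mod_cast h5
    exact le_of_sq_le_sq h6 (by positivity)
  have hsum : (F.card : ℝ) ≤ ((κ : ℝ) + 1) ^ m * (C₁ * ((2 : ℝ) ^ κ) ^ ((n * m : ℕ) / 2 : ℝ)) := by
    rw [Finset.card_eq_sum_card_fiberwise hmaps]
    push_cast
    refine (Finset.sum_le_sum fun q _ => hfib q).trans (le_of_eq ?_)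
    rw [Finset.sum_const, Fintype.card_piFinset]
    simp
  refine hsum.trans ?_
  have hpos : (0 : ℝ) < 2 ^ κ := by positivity
  calc _ ≤ (C₂ * (2 ^ κ : ℝ) ^ (1 / 2 : ℝ)) * (C₁ * ((2 : ℝ) ^ κ) ^ ((n * m : ℕ) / 2 : ℝ)) :=
        mul_le_mul_of_nonneg_right (hpow κ) (by positivity)
    _ = C₂ * C₁ * ((2 : ℝ) ^ κ) ^ (((n * m : ℕ) + 1 : ℝ) / 2) := by
        rw [add_div, Real.rpow_add hpos]; ring
    _ ≤ C₂ * C₁ * (2 * C₀ * X) ^ (((n * m : ℕ) + 1 : ℝ) / 2) := by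
        refine mul_le_mul_of_nonneg_left ?_ (by positivity)
        exact Real.rpow_le_rpow hpos.le hκle (by positivity)
    _ = _ := by rw [Real.mul_rpow (by positivity) (by positivity)]; ring

/-- The upper bound for the number of alternating matrices of corank at least `r` in a box. -/
theorem ncard_le_corank_le (n : ℕ) : ∃ C : ℝ, 0 < C ∧ ∀ X : ℝ≥0, 1 ≤ X → ∀ r : ℕ,
    (({A ∈ altBox n X | r ≤ corank A}.ncard : ℕ) : ℝ) ≤
      C * (X : ℝ) ^ (((n : ℝ) * (n - r) + 1) / 2) := by
  classical
  have h : ∀ m, ∃ C : ℝ, 0 < C ∧ (m ≤ n → ∀ X : ℝ≥0, 1 ≤ X →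
    (({A ∈ altBox n X | m + corank A = n}.ncard : ℕ) : ℝ) ≤
      C * (X : ℝ) ^ (((n * m : ℕ) + 1 : ℝ) / 2)) := by
    intro m
    by_cases hm : m ≤ n
    · obtain ⟨C, hC, h⟩ := ncard_rank_eq_le n m hm
      exact ⟨C, hC, fun _ => h⟩
    · exact ⟨1, one_pos, fun h => absurd h hm⟩
  choose C hC hbound using h
  refine ⟨∑ m ∈ Finset.range (n + 1), C m, Finset.sum_pos (fun m _ => hC m) (by simp),
    fun X hX r => ?_⟩
  have hX' : (1 : ℝ) ≤ X := by exact_mod_cast hX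
  have hfin : ∀ m, {A ∈ altBox n X | m + corank A = n}.Finite := fun m =>
    (altBox_finite n X).subset (Set.sep_subset _ _)
  set s := (Finset.range (n + 1)).filter fun m => m + r ≤ n with hs
  have hsub : {A ∈ altBox n X | r ≤ corank A} ⊆
      ⋃ m ∈ s, {A ∈ altBox n X | m + corank A = n} := by
    rintro A ⟨hA, hr⟩
    have := rank_add_corank A
    simp only [Set.mem_iUnion]
    refine ⟨A.rank, ?_, hA, this⟩
    rw [hs, Finset.mem_filter, Finset.mem_range]
    omega
  have h1 : {A ∈ altBox n X | r ≤ corank A}.ncard ≤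
      ∑ m ∈ s, {A ∈ altBox n X | m + corank A = n}.ncard :=
    (Set.ncard_le_ncard hsub (Set.Finite.biUnion s.finite_toSet fun m _ => hfin m)).trans
      (Finset.set_ncard_biUnion_le _ _)
  have h2 : ∀ m ∈ s, (({A ∈ altBox n X | m + corank A = n}.ncard : ℕ) : ℝ) ≤
      C m * (X : ℝ) ^ (((n : ℝ) * (n - r) + 1) / 2) := by
    intro m hm
    rw [hs, Finset.mem_filter] at hm
    refine (hbound m (by omega) X hX).trans (mul_le_mul_of_nonneg_left ?_ (hC m).le)
    refine Real.rpow_le_rpow_of_exponent_le hX' ?_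
    have h3 : (m : ℝ) + r ≤ n := by exact_mod_cast hm.2
    push_cast
    have : (n : ℝ) * m ≤ n * (n - r) := mul_le_mul_of_nonneg_left (by linarith) (by positivity)
    linarith
  calc _ ≤ ((∑ m ∈ s, {A ∈ altBox n X | m + corank A = n}.ncard : ℕ) : ℝ) := by exact_mod_cast h1
    _ ≤ ∑ m ∈ s, C m * (X : ℝ) ^ (((n : ℝ) * (n - r) + 1) / 2) := by
        push_cast
        exact Finset.sum_le_sum h2
    _ = (∑ m ∈ s, C m) * (X : ℝ) ^ (((n : ℝ) * (n - r) + 1) / 2) := by rw [Finset.sum_mul]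
    _ ≤ _ := by
        refine mul_le_mul_of_nonneg_right ?_ (by positivity)
        exact Finset.sum_le_sum_of_subset_of_nonneg (Finset.filter_subset _ _)
          fun m _ _ => (hC m).le

/-! ### The lower bound: short vectors and bordered matrices -/

lemma det_mul_eq_sum_submatrix {m n : ℕ} (W : Matrix (Fin m) (Fin n) ℤ)
    (M : Matrix (Fin n) (Fin m) ℤ) :
    (W * M).det = ∑ p : Fin m → Fin n, (W.submatrix id p).det * ∏ i, M (p i) i := by
  simp only [Matrix.det_apply', Matrix.mul_apply, Finset.prod_univ_sum, Finset.mul_sum,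
    Fintype.piFinset_univ, Finset.sum_mul, Matrix.submatrix_apply, id]
  rw [Finset.sum_comm]
  refine Finset.sum_congr rfl fun p _ => Finset.sum_congr rfl fun σ _ => ?_
  rw [Finset.prod_mul_distrib]
  ring

/-- If all maximal minors vanished, the Gram matrix `W Wᵀ` would be singular by Cauchy–Binet, and a
null vector `z` would satisfy `|z W|² = 0`. -/
lemma RowsIndep.exists_submatrix_det_ne_zero {m n : ℕ} {W : Matrix (Fin m) (Fin n) ℤ}
    (h : RowsIndep W) : ∃ I : Fin m → Fin n, (W.submatrix id I).det ≠ 0 := by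
  by_contra! hcon
  have h0 : (W * W.transpose).det = 0 := by
    rw [det_mul_eq_sum_submatrix]
    exact Finset.sum_eq_zero fun p _ => by rw [hcon p, zero_mul]
  obtain ⟨z, hz, hz0⟩ := Matrix.exists_vecMul_eq_zero_iff.mpr h0
  apply hz
  apply h
  rw [← dotProduct_self_eq_zero]
  rw [← Matrix.vecMul_vecMul] at hz0
  calc Matrix.vecMul z W ⬝ᵥ Matrix.vecMul z W
      = Matrix.vecMul (Matrix.vecMul z W) W.transpose ⬝ᵥ z := by
        rw [Matrix.vecMul_transpose, dotProduct_comm (Matrix.mulVec _ _), Matrix.dotProduct_mulVec]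
    _ = 0 := by rw [hz0, zero_dotProduct]

lemma updateCol_submatrix_eq {m n : ℕ} (W : Matrix (Fin m) (Fin n) ℤ) (I : Fin m → Fin n)
    (i : Fin m) (j : Fin n) :
    (W.submatrix id I).updateCol i (fun a => W a j) = W.submatrix id (Function.update I i j) := by
  ext a b
  rcases eq_or_ne b i with rfl | hb
  · simp
  · simp [hb]

/-- If the columns indexed by `I` span the largest volume, then the entries of a vector of the row
space are controlled by its entries at `I`. -/
lemma abs_vecMul_le_of_max {m n : ℕ} (W : Matrix (Fin m) (Fin n) ℤ) (I : Fin m → Fin n)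
    (h0 : (W.submatrix id I).det ≠ 0)
    (hmax : ∀ I', |(W.submatrix id I').det| ≤ |(W.submatrix id I).det|)
    (g : Fin m → ℤ) (q : ℤ) (hg : ∀ i, |Matrix.vecMul g W (I i)| ≤ q) (j : Fin n) :
    |Matrix.vecMul g W j| ≤ m * q := by
  set Q := W.submatrix id I with hQ
  have hcr := Matrix.mulVec_cramer Q (fun a => W a j)
  -- Cramer's rule expresses entry `j` through the entries at `I`; its coefficients are minors with
  -- one column replaced, none larger than `|det Q|`.
  have e : Q.det * Matrix.vecMul g W j = ∑ i, Matrix.vecMul g W (I i) *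
      (W.submatrix id (Function.update I i j)).det := by
    have h1 : g ⬝ᵥ Q.mulVec (Q.cramer fun a => W a j) = Q.det * Matrix.vecMul g W j := by
      rw [hcr]
      simp only [dotProduct, Matrix.vecMul, Pi.smul_apply, smul_eq_mul, Finset.mul_sum]
      exact Finset.sum_congr rfl fun _ _ => by ring
    rw [← h1, Matrix.dotProduct_mulVec, dotProduct]
    refine Finset.sum_congr rfl fun i _ => ?_
    rw [Matrix.cramer_apply, hQ, updateCol_submatrix_eq]
    rfl
  have h2 : |Q.det| * |Matrix.vecMul g W j| ≤ |Q.det| * (m * q) := by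
    rw [← abs_mul, e]
    refine (Finset.abs_sum_le_sum_abs _ _).trans ?_
    have : ∀ i ∈ Finset.univ, |Matrix.vecMul g W (I i) *
        (W.submatrix id (Function.update I i j)).det| ≤ q * |Q.det| := by
      intro i _
      rw [abs_mul]
      exact mul_le_mul (hg i) (hmax _) (abs_nonneg _) ((abs_nonneg _).trans (hg i))
    refine (Finset.sum_le_sum this).trans (le_of_eq ?_)
    simp only [Finset.sum_const, Finset.card_univ, Fintype.card_fin, nsmul_eq_mul]
    ring
  exact le_of_mul_le_mul_left h2 (abs_pos.mpr h0)

lemma card_quotient_range_vecMul {m : ℕ} (Q : Matrix (Fin m) (Fin m) ℤ) (h0 : Q.det ≠ 0) :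
    Nat.card ((Fin m → ℤ) ⧸ LinearMap.range Q.vecMulLinear) = Q.det.natAbs := by
  have hinj : Function.Injective Q.vecMulLinear := by
    rw [← LinearMap.ker_eq_bot, LinearMap.ker_eq_bot']
    intro z hz
    by_contra hne
    exact h0 (Matrix.exists_vecMul_eq_zero_iff.mp ⟨z, hne, hz⟩)
  have h := Submodule.natAbs_det_equiv (LinearMap.range Q.vecMulLinear)
    (LinearEquiv.ofInjective Q.vecMulLinear hinj)
  rw [← h]
  congr 1
  have e : ((LinearMap.range Q.vecMulLinear).subtype ∘ₗ
      AddMonoidHom.toIntLinearMap ((LinearEquiv.ofInjective Q.vecMulLinear hinj : _ ≃ₗ[ℤ] _) :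
        (Fin m → ℤ) →+ LinearMap.range Q.vecMulLinear)) = Matrix.toLin' Q.transpose := by
    refine LinearMap.ext fun x => ?_
    rw [Matrix.toLin'_apply, Matrix.mulVec_transpose]
    rfl
  rw [e, LinearMap.det_toLin', Matrix.det_transpose]

lemma mem_kerPerp_vecMul {m n : ℕ} {A : Matrix (Fin n) (Fin n) ℤ} {W : Matrix (Fin m) (Fin n) ℤ}
    {J : Matrix (Fin m) (Fin m) ℤ} (hA : A = W.transpose * J * W) (hdet : J.det ≠ 0)
    (hind : RowsIndep W) (g : Fin m → ℤ) : Matrix.vecMul g W ∈ kerPerp A := by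
  intro y hy
  have h1 : W.mulVec y = 0 := by
    by_contra hne
    apply hdet
    refine Matrix.exists_mulVec_eq_zero_iff.mp ⟨W.mulVec y, hne, ?_⟩
    apply hind
    rw [← Matrix.mulVec_transpose, Matrix.mulVec_mulVec, Matrix.mulVec_mulVec, ← hA, hy]
  rw [← Matrix.dotProduct_mulVec, h1, dotProduct_zero]

/-- There are many short integer vectors orthogonal to the kernel of an alternating matrix. -/
theorem ncard_kerPerp_ge (n m : ℕ) : ∃ c : ℝ, 0 < c ∧ ∀ (X : ℝ≥0), 1 ≤ X →
    ∀ A ∈ altBox n X, m + corank A = n → ∃ F : Finset (Fin n → ℤ),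
      (∀ w ∈ F, w ∈ kerPerp A ∧ ∀ i, |(w i : ℝ)| ≤ X) ∧ c * (X : ℝ) ^ ((m : ℝ) / 2) ≤ F.card := by
  classical
  obtain ⟨C, -, hfac⟩ := exists_reduced_factorization n
  refine ⟨((m + 1 : ℝ) ^ m)⁻¹ * ((m.factorial : ℝ) ^ (1 / 2 : ℝ))⁻¹, by positivity,
    fun X hX A hA hm => ?_⟩
  have hX' : (1 : ℝ) ≤ X := by exact_mod_cast hX
  obtain ⟨m', hm', W, J, hAW, hJ, hdet, hind, -, -⟩ := hfac A hA.1
  obtain rfl : m' = m := by omega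
  obtain ⟨I₀, hI₀⟩ := hind.exists_submatrix_det_ne_zero
  obtain ⟨I, -, hImax⟩ := Finset.exists_max_image Finset.univ
    (fun I : Fin m' → Fin n => |(W.submatrix id I).det|) ⟨I₀, Finset.mem_univ _⟩
  have hmax : ∀ I', |(W.submatrix id I').det| ≤ |(W.submatrix id I).det| :=
    fun I' => hImax I' (Finset.mem_univ _)
  set Q := W.submatrix id I with hQ
  have hQ0 : Q.det ≠ 0 := abs_pos.mp ((abs_pos.mpr hI₀).trans_le (hmax I₀))
  set δ := Q.det.natAbs with hδ
  have hδpos : 0 < δ := Int.natAbs_pos.mpr hQ0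
  have hδabs : ((δ : ℕ) : ℝ) = |(Q.det : ℝ)| := by
    rw [hδ, Nat.cast_natAbs, Int.cast_abs]
  -- The principal submatrix of `A` on `I` is `Qᵀ J Q`, so `δ²` divides its determinant, which is
  -- nonzero and at most `m! X ^ m`.
  have hδle : (δ : ℝ) ≤ (m'.factorial * (X : ℝ) ^ m') ^ (1 / 2 : ℝ) := by
    have h1 : (A.submatrix I I).det = Q.det * J.det * Q.det := by
      have : A.submatrix I I = Q.transpose * J * Q := by
        rw [hAW]; rfl
      rw [this, Matrix.det_mul, Matrix.det_mul, Matrix.det_transpose]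
    have h2 := abs_det_mul_prod_le ((A.submatrix I I).map (Int.castRingHom ℝ)) (fun _ => (X : ℝ))
      (fun _ => 1) (fun _ => zero_le_one) (fun p q => by simpa using hA.2 (I p) (I q))
    rw [← RingHom.mapMatrix_apply, ← RingHom.map_det, h1] at h2
    simp only [Finset.prod_const_one, mul_one, Finset.prod_const, Finset.card_univ,
      Fintype.card_fin, eq_intCast, Int.cast_mul, abs_mul] at h2
    have h3 : (1 : ℝ) ≤ |(J.det : ℝ)| := by
      rw [← Int.cast_abs]
      exact_mod_cast Int.one_le_abs hdet
    have h4 : (δ : ℝ) ^ 2 ≤ m'.factorial * (X : ℝ) ^ m' := by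
      rw [hδabs]
      refine le_trans ?_ h2
      have := mul_le_mul_of_nonneg_left h3 (sq_nonneg |(Q.det : ℝ)|)
      nlinarith
    rw [← Real.sqrt_eq_rpow]
    exact Real.le_sqrt_of_sq_le h4
  -- With entries at `I` bounded by `q`, all entries are at most `m * q ≤ X`.
  set q := ⌊(X : ℝ) / (m' + 1)⌋₊ with hq
  have hq1 : (X : ℝ) / (m' + 1) ≤ q + 1 := (Nat.lt_floor_add_one _).le
  have hq2 : (m' : ℝ) * q ≤ X := by
    have h1 : (q : ℝ) ≤ X / (m' + 1) := Nat.floor_le (by positivity)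
    rw [le_div_iff₀ (by positivity)] at h1
    have : (0 : ℝ) ≤ q := by positivity
    nlinarith
  let R := LinearMap.range Q.vecMulLinear
  have hcardR : Nat.card ((Fin m' → ℤ) ⧸ R) = δ := card_quotient_range_vecMul Q hQ0
  have : Finite ((Fin m' → ℤ) ⧸ R) := Nat.finite_of_card_ne_zero (by omega)
  have := Fintype.ofFinite ((Fin m' → ℤ) ⧸ R)
  let B : Finset (Fin m' → ℤ) := Fintype.piFinset fun _ => Finset.Icc (0 : ℤ) q
  have hBcard : B.card = (q + 1) ^ m' := by
    rw [Fintype.card_piFinset]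
    simp
  -- Pigeonhole: the box meets at most `δ` cosets of the row lattice of `Q`, so one coset contains
  -- at least `(q + 1) ^ m / δ` points. Their differences from a fixed one are restrictions to `I`
  -- of vectors in the row lattice of `W`.
  obtain ⟨y, -, hy⟩ := Finset.exists_le_card_fiber_of_nsmul_le_card_of_maps_to
    (s := B) (t := Finset.univ) (f := fun x => (Submodule.Quotient.mk x : (Fin m' → ℤ) ⧸ R))
    (b := ((q + 1 : ℝ) ^ m') / δ) (fun _ _ => Finset.mem_univ _) Finset.univ_nonempty (by
      rw [Finset.card_univ, ← Nat.card_eq_fintype_card, hcardR, hBcard, nsmul_eq_mul,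
        mul_div_cancel₀ _ (by positivity)]
      push_cast
      exact le_rfl)
  set S := B.filter fun x => (Submodule.Quotient.mk x : (Fin m' → ℤ) ⧸ R) = y with hS
  have hSpos : 0 < S.card := by
    have : (0 : ℝ) < S.card := lt_of_lt_of_le (by positivity) hy
    exact_mod_cast this
  obtain ⟨x₀, hx₀⟩ := Finset.card_pos.mp hSpos
  have hg : ∀ x ∈ S, ∃ g : Fin m' → ℤ, Matrix.vecMul g Q = x - x₀ := by
    intro x hx
    have h1 := (Finset.mem_filter.mp hx).2
    have h2 := (Finset.mem_filter.mp hx₀).2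
    rw [← h2, Submodule.Quotient.eq] at h1
    obtain ⟨g, hg⟩ := h1
    exact ⟨g, hg⟩
  choose! g hgx using hg
  have hgI : ∀ x ∈ S, ∀ i, Matrix.vecMul (g x) W (I i) = x i - x₀ i := fun x hx i =>
    congrFun (hgx x hx) i
  refine ⟨S.image fun x => Matrix.vecMul (g x) W, ?_, ?_⟩
  · intro w hw
    obtain ⟨x, hx, rfl⟩ := Finset.mem_image.mp hw
    refine ⟨mem_kerPerp_vecMul hAW hdet hind _, fun j => ?_⟩
    have h1 : |Matrix.vecMul (g x) W j| ≤ m' * (q : ℤ) := by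
      refine abs_vecMul_le_of_max W I hQ0 hmax (g x) q (fun i => ?_) j
      rw [hgI x hx i]
      have ha := Finset.mem_Icc.mp (Fintype.mem_piFinset.mp (Finset.mem_filter.mp hx).1 i)
      have hb := Finset.mem_Icc.mp (Fintype.mem_piFinset.mp (Finset.mem_filter.mp hx₀).1 i)
      rw [abs_le]
      constructor <;> linarith [ha.1, ha.2, hb.1, hb.2]
    refine le_trans ?_ hq2
    rw [← Int.cast_abs]
    exact_mod_cast h1
  · rw [Finset.card_image_of_injOn]
    · refine le_trans ?_ hy
      rw [le_div_iff₀ (by exact_mod_cast hδpos)]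
      calc _ ≤ ((m' + 1 : ℝ) ^ m')⁻¹ * ((m'.factorial : ℝ) ^ (1 / 2 : ℝ))⁻¹ *
            (X : ℝ) ^ ((m' : ℝ) / 2) * (m'.factorial * (X : ℝ) ^ m') ^ (1 / 2 : ℝ) :=
            mul_le_mul_of_nonneg_left hδle (by positivity)
        _ = (X / (m' + 1) : ℝ) ^ m' := by
            rw [Real.mul_rpow (by positivity) (by positivity), ← Real.rpow_natCast (X : ℝ) m',
              ← Real.rpow_mul (by positivity)]
            have e : ((X : ℝ) ^ ((m' : ℝ) / 2)) * (X : ℝ) ^ ((m' : ℝ) * (1 / 2)) = (X : ℝ) ^ m' := by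
              rw [← Real.rpow_add (by positivity), ← Real.rpow_natCast (X : ℝ) m']
              congr 1; ring
            have hf : ((m'.factorial : ℝ) ^ (1 / 2 : ℝ)) ≠ 0 := by positivity
            rw [div_pow, ← e]
            field_simp
        _ ≤ (q + 1 : ℝ) ^ m' := pow_le_pow_left₀ (by positivity) hq1 _
    · intro x hx x' hx' hxx
      ext i
      have h1 := hgI x hx i
      have h2 := hgI x' hx' i
      have h3 := congrFun hxx (I i)
      simp only at h3
      omega

/-- The alternating matrix obtained by adding a first row `w` and a first column `-w`. -/
def border {n : ℕ} (A : Matrix (Fin n) (Fin n) ℤ) (w : Fin n → ℤ) :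
    Matrix (Fin (n + 1)) (Fin (n + 1)) ℤ :=
  Matrix.of (Fin.cons (Fin.cons 0 w) fun i => Fin.cons (-w i) (A i))

section border

variable {n : ℕ} (A : Matrix (Fin n) (Fin n) ℤ) (w : Fin n → ℤ)

@[simp] lemma border_zero_zero : border A w 0 0 = 0 := rfl
@[simp] lemma border_zero_succ (j : Fin n) : border A w 0 j.succ = w j := rfl
@[simp] lemma border_succ_zero (i : Fin n) : border A w i.succ 0 = -w i := rfl
@[simp] lemma border_succ_succ (i j : Fin n) : border A w i.succ j.succ = A i j := rfl

variable {A w}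

lemma border_mem_altBox {X : ℝ≥0} (hA : A ∈ altBox n X) (hw : ∀ i, |(w i : ℝ)| ≤ X) :
    border A w ∈ altBox (n + 1) X := by
  constructor
  · ext i j
    refine Fin.cases (Fin.cases ?_ (fun j => ?_) j) (fun i => Fin.cases ?_ (fun j => ?_) j) i
    · simp
    · simp
    · simp
    · have := congrFun (congrFun hA.1 i) j
      simpa using this
  · intro i j
    refine Fin.cases (Fin.cases ?_ (fun j => ?_) j) (fun i => Fin.cases ?_ (fun j => ?_) j) i
    · simp
    · simpa using hw j
    · simpa using hw i
    · simpa using hA.2 i j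

lemma border_injective {A' : Matrix (Fin n) (Fin n) ℤ} {w' : Fin n → ℤ}
    (h : border A w = border A' w') : A = A' ∧ w = w' := by
  constructor
  · ext i j
    exact congrFun (congrFun h i.succ) j.succ
  · ext j
    exact congrFun (congrFun h 0) j.succ

/-- Over `ℚ` the bordered matrix still factors through `J`: if `w = c W`, append the column `c J⁻¹`
to `W`. The corner entry is then zero because `J` is alternating. Multiplying by `det J` keeps
everything integral. -/
lemma rank_border_of_mem_kerPerp (hA : A.transpose = -A) (hw : w ∈ kerPerp A) :
    (border A w).rank = A.rank := by
  apply le_antisymm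
  · obtain ⟨C, -, hfac⟩ := exists_reduced_factorization n
    obtain ⟨m, hm, W, J, hAW, hJ, hdet, hind, hspan, -⟩ := hfac A hA
    obtain ⟨c, hc⟩ := hspan w hw
    have hrk : A.rank = m := by
      have := rank_add_corank A
      omega
    set D := J.det with hD
    set y : Fin m → ℤ := Matrix.vecMul c J.adjugate with hy
    have hyJ : Matrix.vecMul y J = D • c := by
      rw [hy, Matrix.vecMul_vecMul, Matrix.adjugate_mul, Matrix.vecMul_smul, Matrix.vecMul_one]
    have hJa : ∀ i j, J j i = -J i j := fun i j => congrFun (congrFun hJ i) j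
    have hJy : ∀ i, J.mulVec y i = -(D * c i) := by
      intro i
      have := congrFun hyJ i
      simp only [Matrix.vecMul, dotProduct, Pi.smul_apply, smul_eq_mul] at this
      rw [← this, Matrix.mulVec, dotProduct, ← Finset.sum_neg_distrib]
      exact Finset.sum_congr rfl fun j _ => by rw [hJa i j]; ring
    have hyy : Matrix.vecMul y J ⬝ᵥ y = 0 := by
      have h1 : Matrix.vecMul y J ⬝ᵥ y = y ⬝ᵥ J.mulVec y := (Matrix.dotProduct_mulVec _ _ _).symm
      have h2 : y ⬝ᵥ J.mulVec y = -(Matrix.vecMul y J ⬝ᵥ y) := by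
        rw [hyJ]
        simp only [dotProduct, Pi.smul_apply, smul_eq_mul, hJy, ← Finset.sum_neg_distrib]
        exact Finset.sum_congr rfl fun _ _ => by ring
      omega
    let V : Matrix (Fin m) (Fin (n + 1)) ℤ := Matrix.of fun i => Fin.cons (y i) fun j => D * W i j
    have hVJ0 : ∀ i, (V.transpose * J) 0 i = D * c i := fun i => congrFun hyJ i
    have hVJs : ∀ j i, (V.transpose * J) (Fin.succ j) i = D * (W.transpose * J) j i := by
      intro j i
      simp only [Matrix.mul_apply, Matrix.transpose_apply, V, Matrix.of_apply, Fin.cons_succ,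
        Finset.mul_sum, mul_assoc]
    have key : (D ^ 2) • border A w = V.transpose * J * V := by
      ext i j
      rw [Matrix.smul_apply, smul_eq_mul, Matrix.mul_apply]
      refine Fin.cases (Fin.cases ?_ (fun j => ?_) j) (fun i => Fin.cases ?_ (fun j => ?_) j) i
      · rw [border_zero_zero, mul_zero]
        exact hyy.symm
      · simp only [hVJ0, border_zero_succ, hc, V, Matrix.of_apply, Fin.cons_succ, Matrix.vecMul,
          dotProduct, Finset.mul_sum]
        exact Finset.sum_congr rfl fun _ _ => by ring
      · have h1 : ∑ k, (W.transpose * J) i k * y k = -(D * w i) := by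
          have : (W.transpose * J).mulVec y i = W.transpose.mulVec (J.mulVec y) i := by
            rw [Matrix.mulVec_mulVec]
          have e : ∑ k, (W.transpose * J) i k * y k = (W.transpose * J).mulVec y i := rfl
          rw [e, this, hc]
          simp only [Matrix.mulVec, dotProduct, Matrix.vecMul] at hJy ⊢
          simp only [hJy, Finset.mul_sum, Matrix.transpose_apply, ← Finset.sum_neg_distrib]
          exact Finset.sum_congr rfl fun _ _ => by ring
        simp only [hVJs, border_succ_zero, V, Matrix.of_apply, Fin.cons_zero]
        simp only [mul_assoc, ← Finset.mul_sum]
        rw [h1]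
        ring
      · have h1 : A i j = ∑ k, (W.transpose * J) i k * W k j := by
          rw [← Matrix.mul_apply, ← hAW]
        simp only [hVJs, border_succ_succ, V, Matrix.of_apply, Fin.cons_succ]
        rw [h1, Finset.mul_sum]
        exact Finset.sum_congr rfl fun _ _ => by ring
    have h2 : ((D ^ 2) • border A w).rank = (border A w).rank :=
      Matrix.rank_smul_of_mem_nonZeroDivisors _ (mem_nonZeroDivisors_of_ne_zero (pow_ne_zero 2 hdet))
    rw [← h2, key, hrk]
    exact (Matrix.rank_mul_le_left _ _).trans
      ((Matrix.rank_mul_le_left _ _).trans (Matrix.rank_le_width _))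
  · have : A = (border A w).submatrix Fin.succ Fin.succ := rfl
    conv_lhs => rw [this]
    exact Matrix.rank_submatrix_le _ _ _

end border

/-- The number of matrices of rank `m` grows by a factor of order `X ^ (m / 2)` with the size. -/
theorem ncard_rank_succ_ge (n m : ℕ) : ∃ c : ℝ, 0 < c ∧ ∀ X : ℝ≥0, 1 ≤ X →
    c * (X : ℝ) ^ ((m : ℝ) / 2) * (({A ∈ altBox n X | m + corank A = n}.ncard : ℕ) : ℝ) ≤
      (({A ∈ altBox (n + 1) X | m + corank A = n + 1}.ncard : ℕ) : ℝ) := by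
  classical
  obtain ⟨c, hc, h⟩ := ncard_kerPerp_ge n m
  refine ⟨c, hc, fun X hX => ?_⟩
  set F : Finset (Matrix (Fin n) (Fin n) ℤ) :=
    ((altBox_finite n X).subset (Set.sep_subset _ fun A => m + corank A = n)).toFinset with hF
  have hFmem : ∀ A, A ∈ F ↔ A ∈ altBox n X ∧ m + corank A = n := fun A => by
    rw [hF, Set.Finite.mem_toFinset]; rfl
  have hFcard : {A ∈ altBox n X | m + corank A = n}.ncard = F.card :=
    Set.ncard_eq_toFinset_card _ _
  have h' : ∀ A ∈ F, ∃ G : Finset (Fin n → ℤ), (∀ w ∈ G, w ∈ kerPerp A ∧ ∀ i, |(w i : ℝ)| ≤ X) ∧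
      c * (X : ℝ) ^ ((m : ℝ) / 2) ≤ G.card := fun A hA =>
    h X hX A ((hFmem A).mp hA).1 ((hFmem A).mp hA).2
  choose! G hG hGcard using h'
  have hsub : ((F.sigma G).image fun x => border x.1 x.2 : Set (Matrix _ _ ℤ)) ⊆
      {A ∈ altBox (n + 1) X | m + corank A = n + 1} := by
    intro M hM
    obtain ⟨⟨A, w⟩, hx, rfl⟩ := Finset.mem_image.mp (Finset.mem_coe.mp hM)
    rw [Finset.mem_sigma] at hx
    obtain ⟨h1, h2⟩ := (hFmem A).mp hx.1
    obtain ⟨h3, h4⟩ := hG A hx.1 w hx.2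
    refine ⟨border_mem_altBox h1 h4, ?_⟩
    have h5 := rank_border_of_mem_kerPerp h1.1 h3
    have h6 := rank_add_corank A
    have h7 := rank_add_corank (border A w)
    simp only
    omega
  have hle := Set.ncard_le_ncard hsub ((altBox_finite (n + 1) X).subset (Set.sep_subset _ _))
  rw [Set.ncard_coe_finset, Finset.card_image_of_injOn, Finset.card_sigma] at hle
  · rw [hFcard]
    calc _ = ∑ A ∈ F, c * (X : ℝ) ^ ((m : ℝ) / 2) := by
          rw [Finset.sum_const, nsmul_eq_mul]; ring
      _ ≤ ∑ A ∈ F, ((G A).card : ℝ) := Finset.sum_le_sum fun A hA => hGcard A hA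
      _ ≤ _ := by exact_mod_cast hle
  · rintro ⟨A, w⟩ - ⟨A', w'⟩ - hxy
    obtain ⟨rfl, rfl⟩ := border_injective hxy
    rfl

/-! ### The distribution of the corank for a fixed size -/

lemma two_mul_card_incPair_add (n : ℕ) : 2 * Fintype.card (IncPair n) + n = n ^ 2 := by
  have h := sum_sum_eq_sum_incPair (m := n) fun _ _ => 1
  simp only [Finset.sum_const, Finset.card_univ, Fintype.card_fin, smul_eq_mul, mul_one] at h
  rw [sq, h]
  ring

lemma card_incPair (n : ℕ) : (Fintype.card (IncPair n) : ℝ) = (n : ℝ) * (n - 1) / 2 := by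
  have h : (2 * Fintype.card (IncPair n) + n : ℝ) = n ^ 2 := by
    exact_mod_cast two_mul_card_incPair_add n
  linarith

lemma abs_le_floor_iff {X : ℝ≥0} {a : ℤ} :
    |(a : ℝ)| ≤ X ↔ a ∈ Finset.Icc (-(⌊X⌋₊ : ℤ)) (⌊X⌋₊ : ℤ) := by
  rw [Finset.mem_Icc, ← abs_le, ← Int.cast_abs, Int.abs_eq_natAbs]
  have : ((a.natAbs : ℤ) : ℝ) ≤ (X : ℝ) ↔ a.natAbs ≤ ⌊X⌋₊ := by
    rw [Nat.le_floor_iff zero_le]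
    rw [Int.cast_natCast]
    exact_mod_cast Iff.rfl
  rw [this]
  exact_mod_cast Iff.rfl

/-- The size of the box of alternating matrices. -/
lemma ncard_altBox (n : ℕ) (X : ℝ≥0) :
    (altBox n X).ncard = (2 * ⌊X⌋₊ + 1) ^ Fintype.card (IncPair n) := by
  classical
  let B : Finset (IncPair n → ℤ) :=
    Fintype.piFinset fun _ => Finset.Icc (-(⌊X⌋₊ : ℤ)) (⌊X⌋₊ : ℤ)
  have hB : B.card = (2 * ⌊X⌋₊ + 1) ^ Fintype.card (IncPair n) := by
    rw [Fintype.card_piFinset]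
    simp only [card_Icc_neg_le, Finset.prod_const, Finset.card_univ]
  rw [← hB, ← Set.ncard_coe_finset B]
  refine Set.ncard_congr (fun A _ p => A p.1.1 p.1.2) ?_ ?_ ?_
  · intro A hA
    rw [Finset.mem_coe, Fintype.mem_piFinset]
    exact fun p => abs_le_floor_iff.mp (hA.2 _ _)
  · intro A A' hA hA' h
    exact eq_of_alternating_of_incPair hA.1 hA'.1 fun p => congrFun h p
  · intro t ht
    rw [Finset.mem_coe, Fintype.mem_piFinset] at ht
    let A : Matrix (Fin n) (Fin n) ℤ := Matrix.of fun i j =>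
      if h : i < j then t ⟨(i, j), h⟩ else if h : j < i then -t ⟨(j, i), h⟩ else 0
    refine ⟨A, ⟨?_, fun i j => ?_⟩, ?_⟩
    · ext i j
      rcases lt_trichotomy i j with h | h | h
      · simp [A, h, h.not_gt]
      · simp [A, h]
      · simp [A, h, h.not_gt]
    · rcases lt_trichotomy i j with h | h | h
      · simpa [A, h, h.not_gt] using abs_le_floor_iff.mpr (ht ⟨(i, j), h⟩)
      · simp [A, h]
      · simpa [A, h, h.not_gt] using abs_le_floor_iff.mpr (ht ⟨(j, i), h⟩)
    · funext p
      simp [A, p.2]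

lemma rpow_le_ncard_altBox (n : ℕ) (X : ℝ≥0) :
    (X : ℝ) ^ ((n : ℝ) * (n - 1) / 2) ≤ (altBox n X).ncard := by
  rw [ncard_altBox, ← card_incPair, Real.rpow_natCast]
  push_cast
  refine pow_le_pow_left₀ X.coe_nonneg ?_ _
  have h : (X : ℝ) ≤ ⌊X⌋₊ + 1 := by exact_mod_cast (Nat.lt_floor_add_one X).le
  have : (0 : ℝ) ≤ ⌊X⌋₊ := by positivity
  linarith

lemma ncard_altBox_le (n : ℕ) {X : ℝ≥0} (hX : 1 ≤ X) :
    ((altBox n X).ncard : ℝ) ≤ 3 ^ Fintype.card (IncPair n) * (X : ℝ) ^ ((n : ℝ) * (n - 1) / 2) := by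
  rw [ncard_altBox, ← card_incPair, Real.rpow_natCast, ← mul_pow]
  push_cast
  refine pow_le_pow_left₀ (by positivity) ?_ _
  have h : (⌊X⌋₊ : ℝ) ≤ X := by exact_mod_cast Nat.floor_le zero_le
  have : (1 : ℝ) ≤ X := by exact_mod_cast hX
  linarith

lemma ncard_altBox_pos (n : ℕ) (X : ℝ≥0) : 0 < (altBox n X).ncard := by
  rw [ncard_altBox]; positivity

/-- Large corank is unlikely. -/
theorem exists_upper_threshold (n : ℕ) : ∃ X₀ : ℝ, 1 ≤ X₀ ∧ ∀ X : ℝ≥0, X₀ ≤ X → ∀ r : ℕ,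
    (({A ∈ altBox n X | r ≤ corank A}.ncard : ℕ) : ℝ) ≤
      (X : ℝ) ^ (1 - (n : ℝ) * (r - 1) / 2) * (altBox n X).ncard := by
  obtain ⟨C, hC, h⟩ := ncard_le_corank_le n
  -- `C ^ 2 ≤ X` lets `X ^ (1/2)` absorb the constant.
  refine ⟨max 1 (C ^ 2), le_max_left _ _, fun X hX r => ?_⟩
  have hX1 : (1 : ℝ) ≤ X := (le_max_left _ _).trans hX
  have hX0 : (0 : ℝ) < X := by linarith
  have hCX : C ≤ (X : ℝ) ^ (1 / 2 : ℝ) := by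
    rw [← Real.sqrt_eq_rpow]
    exact Real.le_sqrt_of_sq_le ((le_max_right _ _).trans hX)
  calc _ ≤ C * (X : ℝ) ^ (((n : ℝ) * (n - r) + 1) / 2) := h X (by exact_mod_cast hX1) r
    _ ≤ (X : ℝ) ^ (1 / 2 : ℝ) * (X : ℝ) ^ (((n : ℝ) * (n - r) + 1) / 2) :=
        mul_le_mul_of_nonneg_right hCX (by positivity)
    _ = (X : ℝ) ^ (1 - (n : ℝ) * (r - 1) / 2) * (X : ℝ) ^ ((n : ℝ) * (n - 1) / 2) := by
        rw [← Real.rpow_add hX0, ← Real.rpow_add hX0]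
        congr 1
        ring
    _ ≤ _ := mul_le_mul_of_nonneg_left (rpow_le_ncard_altBox n X) (by positivity)

/-- If coranks at least `2` are rare, then the corank is usually the parity of the size. -/
lemma half_le_ncard_corank_eq {n e : ℕ} {X : ℝ≥0} (he : e ≤ 1) (hpar : Even (n + e))
    (h : (({A ∈ altBox n X | 2 ≤ corank A}.ncard : ℕ) : ℝ) ≤ 1 / 2 * (altBox n X).ncard) :
    1 / 2 * ((altBox n X).ncard : ℝ) ≤ (({A ∈ altBox n X | corank A = e}.ncard : ℕ) : ℝ) := by
  have hsub : altBox n X ⊆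
      {A ∈ altBox n X | 2 ≤ corank A} ∪ {A ∈ altBox n X | corank A = e} := by
    intro A hA
    by_cases h2 : 2 ≤ corank A
    · exact Or.inl ⟨hA, h2⟩
    · refine Or.inr ⟨hA, ?_⟩
      have := even_add_corank hA.1
      rw [Nat.even_iff] at this hpar
      omega
  have h1 := (Set.ncard_le_ncard hsub (((altBox_finite n X).subset (Set.sep_subset _ _)).union
    ((altBox_finite n X).subset (Set.sep_subset _ _)))).trans (Set.ncard_union_le _ _)
  have h2 : ((altBox n X).ncard : ℝ) ≤ ({A ∈ altBox n X | 2 ≤ corank A}.ncard : ℕ) +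
      ({A ∈ altBox n X | corank A = e}.ncard : ℕ) := by exact_mod_cast h1
  linarith

lemma exists_half_threshold {n e : ℕ} (hn : 3 ≤ n) (he : e ≤ 1) (hpar : Even (n + e)) :
    ∃ X₀ : ℝ, 1 ≤ X₀ ∧ ∀ X : ℝ≥0, X₀ ≤ X →
      1 / 2 * ((altBox n X).ncard : ℝ) ≤ (({A ∈ altBox n X | corank A = e}.ncard : ℕ) : ℝ) := by
  obtain ⟨X₀, hX₀, h⟩ := exists_upper_threshold n
  -- For `n ≥ 3` corank at least 2 has probability at most `X ^ (-1/2)`, which is at most `1/2` from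
  -- `X = 4` on.
  refine ⟨max X₀ 4, hX₀.trans (le_max_left _ _), fun X hX => ?_⟩
  refine half_le_ncard_corank_eq he hpar ((h X ((le_max_left _ _).trans hX) 2).trans ?_)
  refine mul_le_mul_of_nonneg_right ?_ (by positivity)
  have hX4 : (4 : ℝ) ≤ X := (le_max_right _ _).trans hX
  have hn' : (3 : ℝ) ≤ n := by exact_mod_cast hn
  calc (X : ℝ) ^ (1 - (n : ℝ) * ((2 : ℕ) - 1) / 2) ≤ (X : ℝ) ^ (-(1 / 2) : ℝ) := by
        refine Real.rpow_le_rpow_of_exponent_le (by linarith) ?_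
        push_cast
        linarith
    _ ≤ (4 : ℝ) ^ (-(1 / 2) : ℝ) :=
        Real.rpow_le_rpow_of_nonpos (by norm_num) hX4 (by norm_num)
    _ = 1 / 2 := by
        rw [Real.rpow_neg (by norm_num), ← Real.sqrt_eq_rpow, show (4 : ℝ) = 2 ^ 2 by norm_num,
          Real.sqrt_sq (by norm_num)]
        norm_num

/-- Each corank of the right parity occurs often. -/
lemma exists_ncard_rank_ge {m : ℕ} (hm : Even m) (hm2 : 2 ≤ m) (s : ℕ) :
    ∃ c X₀ : ℝ, 0 < c ∧ 1 ≤ X₀ ∧ ∀ X : ℝ≥0, X₀ ≤ X →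
      c * (X : ℝ) ^ ((m : ℝ) * (m + 1 + s) / 2) ≤
        (({A ∈ altBox (m + 1 + s) X | m + corank A = m + 1 + s}.ncard : ℕ) : ℝ) := by
  induction s with
  | zero =>
    -- The induction starts at odd size `m + 1`, where rank `m` is generic. Starting from
    -- nonsingular matrices of size `m` would lose a factor: there every vector may border the
    -- matrix, which the general growth factor `X ^ (m/2)` does not see.
    obtain ⟨X₀, hX₀, h⟩ := exists_half_threshold (n := m + 1) (e := 1) (by omega) le_rfl
      (by rw [Nat.even_iff] at hm ⊢; omega)
    refine ⟨1 / 2, X₀, by norm_num, hX₀, fun X hX => ?_⟩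
    have e : {A ∈ altBox (m + 1 + 0) X | m + corank A = m + 1 + 0} =
        {A ∈ altBox (m + 1) X | corank A = 1} := by
      ext A
      simp only [Set.mem_ofPred_eq, add_zero]
      refine and_congr_right fun _ => ⟨fun h => ?_, fun h => ?_⟩ <;> omega
    rw [e]
    refine le_trans ?_ (h X hX)
    have := rpow_le_ncard_altBox (m + 1) X
    push_cast at this ⊢
    rw [show (m : ℝ) * (m + 1 + 0) / 2 = (m + 1) * (m + 1 - 1) / 2 by ring]
    linarith
  | succ s ih =>
    obtain ⟨c, X₀, hc, hX₀, h⟩ := ih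
    obtain ⟨c', hc', h'⟩ := ncard_rank_succ_ge (m + 1 + s) m
    refine ⟨c' * c, X₀, by positivity, hX₀, fun X hX => ?_⟩
    have hX1 : (1 : ℝ) ≤ X := hX₀.trans hX
    have h1 := h' X (by exact_mod_cast hX1)
    refine le_trans ?_ h1
    calc _ = c' * (X : ℝ) ^ ((m : ℝ) / 2) * (c * (X : ℝ) ^ ((m : ℝ) * (m + 1 + s) / 2)) := by
          rw [show c' * (X : ℝ) ^ ((m : ℝ) / 2) * (c * (X : ℝ) ^ ((m : ℝ) * (m + 1 + s) / 2)) =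
            c' * c * ((X : ℝ) ^ ((m : ℝ) / 2) * (X : ℝ) ^ ((m : ℝ) * (m + 1 + s) / 2)) by ring,
            ← Real.rpow_add (by linarith)]
          congr 2
          push_cast
          ring
      _ ≤ _ := mul_le_mul_of_nonneg_left (h X hX) (by positivity)

/-- With `m = n - r` and `s = r - 1`, the exponent `m n / 2` falls short of `n(n-1)/2` by
`n(r-1)/2`; one further power of `X` absorbs all constants. -/
theorem exists_lower_threshold {n r : ℕ} (hr : 1 ≤ r) (hn : r + 2 ≤ n) (hpar : Even (n + r)) :
    ∃ X₀ : ℝ, 1 ≤ X₀ ∧ ∀ X : ℝ≥0, X₀ ≤ X →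
      (X : ℝ) ^ (-1 - (n : ℝ) * (r - 1) / 2) * (altBox n X).ncard ≤
        (({A ∈ altBox n X | r ≤ corank A}.ncard : ℕ) : ℝ) := by
  obtain ⟨m, rfl⟩ : ∃ m, n = m + r := ⟨n - r, by omega⟩
  obtain ⟨s, rfl⟩ : ∃ s, r = s + 1 := ⟨r - 1, by omega⟩
  have hm : Even m := by rw [Nat.even_iff] at hpar ⊢; omega
  obtain ⟨c, X₀, hc, hX₀, h⟩ := exists_ncard_rank_ge hm (by omega) s
  rw [show m + (s + 1) = m + 1 + s by ring]
  set n := m + 1 + s with hn'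
  set T := Fintype.card (IncPair n) with hT
  refine ⟨max X₀ (3 ^ T / c), hX₀.trans (le_max_left _ _), fun X hX => ?_⟩
  have hX1 : (1 : ℝ) ≤ X := hX₀.trans ((le_max_left _ _).trans hX)
  have hX0 : (0 : ℝ) < X := by linarith
  have hcX : 3 ^ T * (X : ℝ)⁻¹ ≤ c := by
    have := (le_max_right _ _).trans hX
    rw [div_le_iff₀ hc] at this
    rw [← div_eq_mul_inv, div_le_iff₀ hX0]
    linarith
  have hsub : {A ∈ altBox n X | m + corank A = n} ⊆ {A ∈ altBox n X | s + 1 ≤ corank A} := by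
    rintro A ⟨h1, h2⟩
    exact ⟨h1, by omega⟩
  have h1 := Set.ncard_le_ncard hsub ((altBox_finite n X).subset (Set.sep_subset _ _))
  calc _ ≤ (X : ℝ) ^ (-1 - (n : ℝ) * ((s + 1 : ℕ) - 1) / 2) *
        (3 ^ T * (X : ℝ) ^ ((n : ℝ) * (n - 1) / 2)) :=
        mul_le_mul_of_nonneg_left (ncard_altBox_le n (by exact_mod_cast hX1)) (by positivity)
    _ = 3 ^ T * (X : ℝ)⁻¹ * (X : ℝ) ^ ((m : ℝ) * (m + 1 + s) / 2) := by
        rw [← Real.rpow_neg_one (X : ℝ), mul_assoc (3 ^ T : ℝ), ← Real.rpow_add hX0,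
          mul_left_comm, ← Real.rpow_add hX0]
        congr 2
        rw [hn']
        push_cast
        ring
    _ ≤ c * (X : ℝ) ^ ((m : ℝ) * (m + 1 + s) / 2) :=
        mul_le_mul_of_nonneg_right hcX (by positivity)
    _ ≤ _ := h X ((le_max_left _ _).trans hX)
    _ ≤ _ := by exact_mod_cast h1

/-! ### The law of the pseudo-rank as the height grows -/

lemma modelLaw_toMeasure_apply (ν : PMF ℕ) (X : ℝ≥0) (P : ℕ → Prop) :
    (modelLaw ν X).toMeasure {M | P M.kerRank} =
      ∑' n, ν n * ((({A ∈ altBox n X | P (corank A)}.ncard : ℕ) : ℝ≥0∞) / (altBox n X).ncard) := by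
  classical
  have hs : MeasurableSet {M : SqMatrix | P M.kerRank} := trivial
  rw [PMF.toMeasure_apply_eq_toOuterMeasure_apply _ hs, modelLaw,
    PMF.toOuterMeasure_bind_apply]
  refine tsum_congr fun n => ?_
  refine congrArg _ ((PMF.toOuterMeasure_map_apply _ _ _).trans ?_)
  rw [unifAlt, PMF.toOuterMeasure_uniformOfFinset_apply]
  congr 1
  · rw [← Set.ncard_coe_finset]
    congr 2
    ext A
    simp only [Finset.coe_filter, Set.Finite.mem_toFinset]
    rfl
  · rw [← Set.ncard_eq_toFinset_card _ (altBox_finite n X)]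

lemma modelLaw_real_le {ν : PMF ℕ} {X : ℝ≥0} {P : ℕ → Prop} {b : ℝ} (hb : 0 ≤ b)
    (h : ∀ n ∈ ν.support, (({A ∈ altBox n X | P (corank A)}.ncard : ℕ) : ℝ) ≤
      b * (altBox n X).ncard) :
    (modelLaw ν X).toMeasure.real {M | P M.kerRank} ≤ b := by
  have h1 : (modelLaw ν X).toMeasure {M | P M.kerRank} ≤ ENNReal.ofReal b := by
    rw [modelLaw_toMeasure_apply]
    calc _ ≤ ∑' n, ν n * ENNReal.ofReal b := by
          refine ENNReal.tsum_le_tsum fun n => ?_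
          by_cases hn : n ∈ ν.support
          · refine mul_le_mul_right ?_ _
            have hpos := ncard_altBox_pos n X
            rw [ENNReal.div_le_iff (by exact_mod_cast hpos.ne') (ENNReal.natCast_ne_top _),
              ← ENNReal.ofReal_natCast, ← ENNReal.ofReal_natCast, ← ENNReal.ofReal_mul hb]
            exact ENNReal.ofReal_le_ofReal (h n hn)
          · rw [PMF.mem_support_iff, not_not] at hn
            simp [hn]
      _ = ENNReal.ofReal b := by rw [ENNReal.tsum_mul_right, ν.tsum_coe, one_mul]
  exact ENNReal.toReal_le_of_le_ofReal hb h1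

/-- Only sizes of one parity can have a given corank, so the lower bound is available on half of the
mass of `ν`. -/
lemma le_modelLaw_real {ν : PMF ℕ} {X : ℝ≥0} {P : ℕ → Prop} {b : ℝ} (hb : 0 ≤ b) {S : Set ℕ}
    (hS : ν.toMeasure S = 1 / 2)
    (h : ∀ n ∈ ν.support, n ∈ S → b * (altBox n X).ncard ≤
      (({A ∈ altBox n X | P (corank A)}.ncard : ℕ) : ℝ)) :
    b / 2 ≤ (modelLaw ν X).toMeasure.real {M | P M.kerRank} := by
  classical
  have h1 : ENNReal.ofReal (b / 2) ≤ (modelLaw ν X).toMeasure {M | P M.kerRank} := by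
    rw [modelLaw_toMeasure_apply]
    calc ENNReal.ofReal (b / 2) = (∑' n, S.indicator ν n) * ENNReal.ofReal b := by
          rw [← PMF.toMeasure_apply _ (MeasurableSet.of_discrete), hS,
            ENNReal.ofReal_div_of_pos (by norm_num), ENNReal.div_eq_inv_mul]
          simp
      _ = ∑' n, S.indicator ν n * ENNReal.ofReal b := ENNReal.tsum_mul_right.symm
      _ ≤ _ := by
          refine ENNReal.tsum_le_tsum fun n => ?_
          by_cases hn : n ∈ ν.support
          · by_cases hnS : n ∈ S
            · rw [Set.indicator_of_mem hnS]
              refine mul_le_mul_right ?_ _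
              have hpos := ncard_altBox_pos n X
              rw [ENNReal.le_div_iff_mul_le (Or.inl (by exact_mod_cast hpos.ne'))
                (Or.inl (ENNReal.natCast_ne_top _)),
                ← ENNReal.ofReal_natCast, ← ENNReal.ofReal_natCast, ← ENNReal.ofReal_mul hb]
              exact ENNReal.ofReal_le_ofReal (h n hn hnS)
            · rw [Set.indicator_of_notMem hnS]
              simp
          · rw [PMF.mem_support_iff, not_not] at hn
            have : S.indicator ν n = 0 := by
              by_cases hnS : n ∈ S <;> simp [hn, hnS]
            rw [this]
            simp
  exact (ENNReal.ofReal_le_iff_le_toReal (measure_ne_top _ _)).mp h1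

lemma toMeasure_odd {ν : PMF ℕ} (h : ν.toMeasure {n : ℕ | Even n} = 1 / 2) :
    ν.toMeasure {n : ℕ | Odd n} = 1 / 2 := by
  have e : {n : ℕ | Odd n} = {n : ℕ | Even n}ᶜ := by
    ext n
    exact Nat.not_even_iff_odd.symm
  rw [e, prob_compl_eq_one_sub MeasurableSet.of_discrete, h]
  simp

lemma toMeasure_even_add {ν : PMF ℕ} (h : ν.toMeasure {n : ℕ | Even n} = 1 / 2) (r : ℕ) :
    ν.toMeasure {n : ℕ | Even (n + r)} = 1 / 2 := by
  rcases Nat.even_or_odd r with hr | hr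
  · rw [← h]
    congr 1
    ext n
    simp [Nat.even_add, hr]
  · rw [← toMeasure_odd h]
    congr 1
    ext n
    simp [Nat.even_add, Nat.not_even_iff_odd.mpr hr]

/-- The bounds for the coranks of alternating matrices of size `n` in the box of size `X`. -/
structure CorankBounds (n : ℕ) (X : ℝ≥0) : Prop where
  upper : ∀ r : ℕ, (({A ∈ altBox n X | r ≤ corank A}.ncard : ℕ) : ℝ) ≤
    (X : ℝ) ^ (1 - (n : ℝ) * (r - 1) / 2) * (altBox n X).ncard
  lower : ∀ r : ℕ, 1 ≤ r → r + 2 ≤ n → Even (n + r) →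
    (X : ℝ) ^ (-1 - (n : ℝ) * (r - 1) / 2) * (altBox n X).ncard ≤
      (({A ∈ altBox n X | r ≤ corank A}.ncard : ℕ) : ℝ)
  half : ∀ e : ℕ, e ≤ 1 → 3 ≤ n → Even (n + e) →
    1 / 2 * ((altBox n X).ncard : ℝ) ≤ (({A ∈ altBox n X | corank A = e}.ncard : ℕ) : ℝ)

theorem exists_corankBounds (n : ℕ) : ∃ X₀ : ℝ, 1 ≤ X₀ ∧ ∀ X : ℝ≥0, X₀ ≤ X → CorankBounds n X := by
  obtain ⟨X₁, h₁, hu⟩ := exists_upper_threshold n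
  have hl : ∀ r : ℕ, ∃ Y : ℝ, 0 ≤ Y ∧ ∀ X : ℝ≥0, Y ≤ X → 1 ≤ r → r + 2 ≤ n → Even (n + r) →
      (X : ℝ) ^ (-1 - (n : ℝ) * (r - 1) / 2) * (altBox n X).ncard ≤
        (({A ∈ altBox n X | r ≤ corank A}.ncard : ℕ) : ℝ) := by
    intro r
    by_cases h : 1 ≤ r ∧ r + 2 ≤ n ∧ Even (n + r)
    · obtain ⟨Y, hY, hl⟩ := exists_lower_threshold h.1 h.2.1 h.2.2
      exact ⟨Y, by linarith, fun X hX _ _ _ => hl X hX⟩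
    · exact ⟨0, le_rfl, fun X _ h1 h2 h3 => absurd ⟨h1, h2, h3⟩ h⟩
  have hh : ∀ e : ℕ, ∃ Y : ℝ, 0 ≤ Y ∧ ∀ X : ℝ≥0, Y ≤ X → e ≤ 1 → 3 ≤ n → Even (n + e) →
      1 / 2 * ((altBox n X).ncard : ℝ) ≤ (({A ∈ altBox n X | corank A = e}.ncard : ℕ) : ℝ) := by
    intro e
    by_cases h : e ≤ 1 ∧ 3 ≤ n ∧ Even (n + e)
    · obtain ⟨Y, hY, hl⟩ := exists_half_threshold h.2.1 h.1 h.2.2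
      exact ⟨Y, by linarith, fun X hX _ _ _ => hl X hX⟩
    · exact ⟨0, le_rfl, fun X _ h1 h2 h3 => absurd ⟨h1, h2, h3⟩ h⟩
  choose Y hY0 hY using hl
  choose Z hZ0 hZ using hh
  have hYs : 0 ≤ ∑ r ∈ Finset.range (n + 1), Y r := Finset.sum_nonneg fun r _ => hY0 r
  -- Only `r ≤ n - 2` matters in the lower bounds, so finitely many thresholds need to be dominated.
  refine ⟨X₁ + (∑ r ∈ Finset.range (n + 1), Y r) + (Z 0 + Z 1),
    by linarith [hZ0 0, hZ0 1], fun X hX => ⟨?_, ?_, ?_⟩⟩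
  · exact hu X (by linarith [hZ0 0, hZ0 1])
  · intro r h1 h2 h3
    refine hY r X ?_ h1 h2 h3
    have : Y r ≤ ∑ r ∈ Finset.range (n + 1), Y r :=
      Finset.single_le_sum (f := Y) (fun r _ => hY0 r) (Finset.mem_range.mpr (by omega))
    linarith [hZ0 0, hZ0 1]
  · intro e he
    refine hZ e X ?_ he
    interval_cases e <;> linarith [hZ0 0, hZ0 1]

/-- There are functions tending to infinity so slowly that a given sequence of thresholds is
overtaken. -/
lemma exists_slow_function (X₀ : ℕ → ℝ) (hX₀ : ∀ n, 1 ≤ X₀ n) :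
    ∃ g : ℝ → ℝ, Tendsto g atTop atTop ∧
      ∀ᶠ H in atTop, ∀ n : ℕ, (n : ℝ) ≤ 2 * g H → X₀ n ≤ H ^ (1 / (24 * g H)) := by
  -- `g H` will be the largest `k ≤ H` with `F k ≤ H`. The range `n ≤ 2 k` covers all sizes `n ≤ (1
  -- + τ) η` with `τ ≤ 1/2`, and the power `24 * k` matches the eventual bound `X ^ η ≥ H ^ (1/24)`.
  let F : ℕ → ℝ := fun k => ∑ j ∈ Finset.range (k + 1),
    (∑ n ∈ Finset.range (2 * j + 1), X₀ n) ^ (24 * j)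
  let g : ℝ → ℕ := fun H => by
    classical exact Nat.findGreatest (fun k => F k ≤ H) ⌊H⌋₊
  have hg : ∀ k : ℕ, ∀ᶠ H in atTop, k ≤ g H := by
    intro k
    filter_upwards [eventually_ge_atTop (F k), eventually_ge_atTop (k : ℝ)] with H h1 h2
    exact Nat.le_findGreatest (Nat.le_floor h2) h1
  refine ⟨fun H => g H, ?_, ?_⟩
  · exact tendsto_natCast_atTop_atTop.comp (tendsto_atTop.mpr hg)
  · filter_upwards [hg 1, eventually_ge_atTop (F 0), eventually_ge_atTop 0] with H h1 h0 hH n hn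
    have hF : F (g H) ≤ H := by
      classical
      exact Nat.findGreatest_spec (P := fun k => F k ≤ H) (Nat.zero_le _) h0
    have hsum : ∀ j, 0 ≤ ∑ n ∈ Finset.range (2 * j + 1), X₀ n := fun j =>
      Finset.sum_nonneg fun n _ => by linarith [hX₀ n]
    set k := g H with hk
    have hn' : n ≤ 2 * k := by exact_mod_cast hn
    have h2 : X₀ n ≤ ∑ n ∈ Finset.range (2 * k + 1), X₀ n :=
      Finset.single_le_sum (f := X₀) (fun n _ => by linarith [hX₀ n])
        (Finset.mem_range.mpr (by omega))
    have h3 : (∑ n ∈ Finset.range (2 * k + 1), X₀ n) ^ (24 * k) ≤ F k :=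
      Finset.single_le_sum (f := fun j => (∑ n ∈ Finset.range (2 * j + 1), X₀ n) ^ (24 * j))
        (fun j _ => pow_nonneg (hsum j) _) (Finset.mem_range.mpr (Nat.lt_succ_self k))
    have h4 : X₀ n ^ (24 * k) ≤ H :=
      (pow_le_pow_left₀ (by linarith [hX₀ n]) h2 _).trans (h3.trans hF)
    have hk0 : ((24 * k : ℕ) : ℝ) ≠ 0 := by
      have : 24 * k ≠ 0 := by omega
      exact_mod_cast this
    calc X₀ n = (X₀ n ^ (24 * k)) ^ (1 / ((24 * k : ℕ) : ℝ)) := by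
          rw [← Real.rpow_natCast, ← Real.rpow_mul (by linarith [hX₀ n]),
            mul_one_div_cancel hk0, Real.rpow_one]
      _ ≤ H ^ (1 / ((24 * k : ℕ) : ℝ)) :=
          Real.rpow_le_rpow (pow_nonneg (by linarith [hX₀ n]) _) h4 (by positivity)
      _ = _ := by push_cast; rfl

/-- The asymptotics of the law of the pseudo-rank. -/
structure RankLawAsymptotics (X : ℝ → ℝ≥0) (ν : ℝ → PMF ℕ) : Prop where
  upper : ∀ r : ℕ, 1 ≤ r → ∀ δ : ℝ, 0 < δ → ∀ᶠ H in atTop,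
    (modelLaw (ν H) (X H)).toMeasure.real {M | r ≤ M.kerRank} ≤ H ^ (-((r : ℝ) - 1) / 24 + δ)
  lower : ∀ r : ℕ, 1 ≤ r → ∀ δ : ℝ, 0 < δ → ∀ᶠ H in atTop,
    H ^ (-((r : ℝ) - 1) / 24 - δ) ≤ (modelLaw (ν H) (X H)).toMeasure.real {M | r ≤ M.kerRank}
  half : ∀ e : ℕ, e ≤ 1 → ∀ᶠ H in atTop,
    1 / 4 ≤ (modelLaw (ν H) (X H)).toMeasure.real {M | M.kerRank = e}

theorem exists_rankLawAsymptotics :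
    ∃ g : ℝ → ℝ, Tendsto g atTop atTop ∧
      ∀ (η : ℝ → ℝ) (X : ℝ → ℝ≥0) (ν : ℝ → PMF ℕ),
        Tendsto η atTop atTop → (∀ᶠ H in atTop, η H ≤ g H) →
        IsPowO1 (fun H => (X H : ℝ) ^ η H) (1 / 12) → IsSizeLaw η ν → RankLawAsymptotics X ν := by
  choose X₀ hX₀ hbd using exists_corankBounds
  obtain ⟨g, hg, hgX⟩ := exists_slow_function X₀ hX₀
  refine ⟨g, hg, fun η X ν hη hηg ⟨ε, hε, hXη⟩ ⟨heven, hsupp⟩ => ?_⟩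
  have hbase : ∀ τ : ℝ, 0 < τ → τ ≤ 1 / 2 → ∀ᶠ H in atTop, 1 < H ∧ 1 ≤ (X H : ℝ) ∧
      (∀ s : ℝ, (X H : ℝ) ^ (s * η H) = H ^ ((1 / 12 + ε H) * s)) ∧
      ∀ n ∈ (ν H).support, CorankBounds n (X H) ∧ (1 - τ) * η H ≤ n ∧ (n : ℝ) ≤ (1 + τ) * η H := by
    intro τ hτ hτ2
    filter_upwards [eventually_gt_atTop 1, hη.eventually_ge_atTop 1, hηg, hXη, hgX,
      hsupp τ hτ, hε.eventually (lt_mem_nhds (show (-1 / 24 : ℝ) < 0 by norm_num))]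
      with H h1 h2 h3 h4 h5 h6 h7
    have hH0 : (0 : ℝ) < H := by linarith
    have hη0 : 0 < η H := by linarith
    -- Eventually `1/12 + ε H ≥ 1/24`, so `X ≥ H ^ (1 / (24 η))`, and `η ≤ g` puts `X` above all the
    -- relevant thresholds.
    have hXge : H ^ (1 / (24 * g H)) ≤ (X H : ℝ) := by
      have e1 : (X H : ℝ) = ((X H : ℝ) ^ η H) ^ (1 / η H) := by
        rw [← Real.rpow_mul (X H).coe_nonneg, mul_one_div_cancel hη0.ne', Real.rpow_one]
      rw [e1, h4, ← Real.rpow_mul hH0.le]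
      refine Real.rpow_le_rpow_of_exponent_le h1.le ?_
      calc 1 / (24 * g H) ≤ 1 / (24 * η H) :=
            one_div_le_one_div_of_le (by positivity) (by linarith)
        _ = (1 / 24) * (1 / η H) := by field_simp
        _ ≤ _ := mul_le_mul_of_nonneg_right (by linarith) (by positivity)
    have hb : ∀ n ∈ (ν H).support, X₀ n ≤ (X H : ℝ) ∧ (1 - τ) * η H ≤ n ∧
        (n : ℝ) ≤ (1 + τ) * η H := by
      intro n hn
      have h8 := abs_le.mp (h6 n hn)
      refine ⟨(h5 n ?_).trans hXge, by linarith [h8.1], by linarith [h8.2]⟩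
      nlinarith [h8.2]
    refine ⟨h1, ?_, fun s => ?_, fun n hn => ⟨hbd n _ (hb n hn).1, (hb n hn).2⟩⟩
    · refine le_trans ?_ hXge
      exact Real.one_le_rpow h1.le (by have : 0 < g H := by linarith
                                       positivity)
    · rw [mul_comm s, Real.rpow_mul (X H).coe_nonneg, h4, ← Real.rpow_mul hH0.le]
  -- Replacing `n` by `(1 ± τ) η` perturbs the exponent of `H` by `τ (r - 1) / 24`, which is to be
  -- less than `δ`.
  have hτ : ∀ (r : ℕ) (δ : ℝ), 1 ≤ r → 0 < δ → ∃ τ : ℝ, 0 < τ ∧ τ ≤ 1 / 2 ∧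
      τ * ((r : ℝ) - 1) / 24 < δ := by
    intro r δ hr hδ
    have hr' : (1 : ℝ) ≤ r := by exact_mod_cast hr
    refine ⟨min (1 / 2) (δ / r), by positivity, min_le_left _ _, ?_⟩
    have h1 : min (1 / 2) (δ / r) * ((r : ℝ) - 1) ≤ δ / r * (r - 1) :=
      mul_le_mul_of_nonneg_right (min_le_right _ _) (by linarith)
    have h2 : δ / r * ((r : ℝ) - 1) ≤ δ := by
      rw [div_mul_eq_mul_div, div_le_iff₀ (by linarith)]
      nlinarith
    linarith
  -- The losses `X ^ (±1)` become `H ^ (±(1/12 + o(1)) / η)`, negligible since `η → ∞`.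
  have hinv : Tendsto (fun H => 1 / η H) atTop (𝓝 0) := by
    exact (tendsto_inv_atTop_zero.comp hη).congr fun H => (one_div _).symm
  refine ⟨fun r hr δ hδ => ?_, fun r hr δ hδ => ?_, fun e he => ?_⟩
  · obtain ⟨τ, hτ0, hτ2, hτδ⟩ := hτ r δ hr hδ
    have hr' : (1 : ℝ) ≤ r := by exact_mod_cast hr
    have hlim : Tendsto (fun H => (1 / 12 + ε H) * (1 / η H - (1 - τ) * ((r : ℝ) - 1) / 2)) atTop
        (𝓝 ((1 / 12 + 0) * (0 - (1 - τ) * ((r : ℝ) - 1) / 2))) :=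
      (hε.const_add _).mul (hinv.sub_const _)
    have hev := hlim.eventually (gt_mem_nhds
      (show (1 / 12 + 0) * (0 - (1 - τ) * ((r : ℝ) - 1) / 2) < -((r : ℝ) - 1) / 24 + δ by linarith))
    filter_upwards [hbase τ hτ0 hτ2, hev, hη.eventually_gt_atTop 0] with H ⟨h1, h2, h3, h4⟩ h5 h6
    refine modelLaw_real_le (P := fun k => r ≤ k) (by positivity) fun n hn => ?_
    refine ((h4 n hn).1.upper r).trans (mul_le_mul_of_nonneg_right ?_ (by positivity))
    calc (X H : ℝ) ^ (1 - (n : ℝ) * (r - 1) / 2)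
        ≤ (X H : ℝ) ^ ((1 / η H - (1 - τ) * ((r : ℝ) - 1) / 2) * η H) := by
          refine Real.rpow_le_rpow_of_exponent_le h2 ?_
          rw [sub_mul, one_div_mul_cancel h6.ne']
          have := mul_le_mul_of_nonneg_right (h4 n hn).2.1 (show 0 ≤ ((r : ℝ) - 1) / 2 by linarith)
          linarith
      _ = H ^ ((1 / 12 + ε H) * (1 / η H - (1 - τ) * ((r : ℝ) - 1) / 2)) := h3 _
      _ ≤ _ := Real.rpow_le_rpow_of_exponent_le h1.le h5.le
  · obtain ⟨τ, hτ0, hτ2, hτδ⟩ := hτ r (δ / 2) hr (by linarith)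
    have hr' : (1 : ℝ) ≤ r := by exact_mod_cast hr
    have hlim : Tendsto (fun H => (1 / 12 + ε H) * (-(1 / η H) - (1 + τ) * ((r : ℝ) - 1) / 2)) atTop
        (𝓝 ((1 / 12 + 0) * (-0 - (1 + τ) * ((r : ℝ) - 1) / 2))) :=
      (hε.const_add _).mul (hinv.neg.sub_const _)
    have hev := hlim.eventually (lt_mem_nhds
      (show -((r : ℝ) - 1) / 24 - δ / 2 < (1 / 12 + 0) * (-0 - (1 + τ) * ((r : ℝ) - 1) / 2) by
        linarith))
    -- This spare power of `H` pays for the factor `1/2` lost to parity.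
    have hhalf : ∀ᶠ H : ℝ in atTop, H ^ (-(δ / 2)) ≤ 1 / 2 :=
      (tendsto_rpow_neg_atTop (by linarith : 0 < δ / 2)).eventually_le_const (by norm_num)
    filter_upwards [hbase τ hτ0 hτ2, hev, hη.eventually_ge_atTop (2 * (r + 2)), hhalf]
      with H ⟨h1, h2, h3, h4⟩ h5 h6 h7
    have hH0 : (0 : ℝ) < H := by linarith
    have hη0 : 0 < η H := by linarith
    have key := le_modelLaw_real (P := fun k => r ≤ k) (X := X H)
      (b := H ^ (-((r : ℝ) - 1) / 24 - δ / 2)) (by positivity) (toMeasure_even_add (heven H) r) (by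
        intro n hn hpar
        have hn2 : r + 2 ≤ n := by
          have h8 := (h4 n hn).2.1
          have : ((r + 2 : ℕ) : ℝ) ≤ n := by
            push_cast
            nlinarith
          exact_mod_cast this
        refine le_trans (mul_le_mul_of_nonneg_right ?_ (by positivity))
          ((h4 n hn).1.lower r hr hn2 hpar)
        calc _ ≤ H ^ ((1 / 12 + ε H) * (-(1 / η H) - (1 + τ) * ((r : ℝ) - 1) / 2)) :=
              Real.rpow_le_rpow_of_exponent_le h1.le h5.le
          _ = (X H : ℝ) ^ ((-(1 / η H) - (1 + τ) * ((r : ℝ) - 1) / 2) * η H) := (h3 _).symm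
          _ ≤ _ := by
            refine Real.rpow_le_rpow_of_exponent_le h2 ?_
            rw [sub_mul, neg_mul, one_div_mul_cancel hη0.ne']
            have := mul_le_mul_of_nonneg_right (h4 n hn).2.2
              (show 0 ≤ ((r : ℝ) - 1) / 2 by linarith)
            linarith)
    refine le_trans ?_ key
    calc H ^ (-((r : ℝ) - 1) / 24 - δ)
        = H ^ (-((r : ℝ) - 1) / 24 - δ / 2) * H ^ (-(δ / 2)) := by
          rw [← Real.rpow_add hH0]; congr 1; ring
      _ ≤ H ^ (-((r : ℝ) - 1) / 24 - δ / 2) * (1 / 2) :=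
          mul_le_mul_of_nonneg_left h7 (by positivity)
      _ = _ := by ring
  · filter_upwards [hbase (1 / 2) (by norm_num) le_rfl, hη.eventually_ge_atTop 6]
      with H ⟨h1, h2, h3, h4⟩ h6
    have key := le_modelLaw_real (P := fun k => k = e) (X := X H)
      (b := 1 / 2) (by norm_num) (toMeasure_even_add (heven H) e) (by
        intro n hn hpar
        refine (h4 n hn).1.half e he ?_ hpar
        have h8 := (h4 n hn).2.1
        have : ((3 : ℕ) : ℝ) ≤ n := by
          push_cast
          linarith
        exact_mod_cast this)
    linarith

/-! ### Counting elliptic curves by height -/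

namespace EllCurve

lemma prod_injective : Function.Injective fun E : EllCurve => (E.A, E.B) := fun _ _ h =>
  EllCurve.ext (congrArg Prod.fst h) (congrArg Prod.snd h)

instance : Countable EllCurve := prod_injective.countable

lemma A_ne_zero_or_B_ne_zero (E : EllCurve) : E.A ≠ 0 ∨ E.B ≠ 0 := by
  by_contra! h
  exact E.smooth (by rw [h.1, h.2]; norm_num)

lemma four_mul_le_height (E : EllCurve) : 4 * |E.A| ^ 3 ≤ E.height := by
  refine le_trans (le_of_eq ?_) (le_max_left _ _)
  rw [abs_mul, abs_pow]
  norm_num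

lemma mul_sq_le_height (E : EllCurve) : 27 * |E.B| ^ 2 ≤ E.height := by
  refine le_trans (le_of_eq ?_) (le_max_right _ _)
  rw [abs_mul, abs_pow]
  norm_num

lemma one_le_height (E : EllCurve) : 1 ≤ E.height := by
  rcases E.A_ne_zero_or_B_ne_zero with h | h
  · have h1 : 1 ≤ |E.A| ^ 3 := one_le_pow₀ (Int.one_le_abs h)
    linarith [E.four_mul_le_height]
  · have h1 : 1 ≤ |E.B| ^ 2 := one_le_pow₀ (Int.one_le_abs h)
    linarith [E.mul_sq_le_height]

lemma one_le_height_real (E : EllCurve) : (1 : ℝ) ≤ E.height := by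
  exact_mod_cast E.one_le_height

lemma abs_A_cube_le (E : EllCurve) : (1 + |E.A|) ^ 3 ≤ 8 * E.height := by
  rcases eq_or_ne E.A 0 with h | h
  · rw [h]; simp; linarith [E.one_le_height]
  · have h1 : 1 ≤ |E.A| := Int.one_le_abs h
    have h2 : (1 + |E.A|) ^ 3 ≤ (2 * |E.A|) ^ 3 := pow_le_pow_left₀ (by linarith) (by linarith) 3
    have h3 : (0 : ℤ) ≤ |E.A| ^ 3 := by positivity
    nlinarith [E.four_mul_le_height]

lemma abs_B_sq_le (E : EllCurve) : (1 + |E.B|) ^ 2 ≤ 8 * E.height := by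
  rcases eq_or_ne E.B 0 with h | h
  · rw [h]; simp; linarith [E.one_le_height]
  · have h1 : 1 ≤ |E.B| := Int.one_le_abs h
    have h2 : (1 + |E.B|) ^ 2 ≤ (2 * |E.B|) ^ 2 := pow_le_pow_left₀ (by linarith) (by linarith) 2
    have h3 : (0 : ℤ) ≤ |E.B| ^ 2 := by positivity
    nlinarith [E.mul_sq_le_height]

lemma finite_height_le (H : ℝ) : {E : EllCurve | (E.height : ℝ) ≤ H}.Finite := by
  have hfin : (Set.Icc (-⌊8 * H⌋) ⌊8 * H⌋ ×ˢ Set.Icc (-⌊8 * H⌋) ⌊8 * H⌋).Finite :=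
    (Set.finite_Icc _ _).prod (Set.finite_Icc _ _)
  refine Set.Finite.of_finite_image (f := fun E : EllCurve => (E.A, E.B)) (hfin.subset ?_)
    prod_injective.injOn
  rintro _ ⟨E, hE, rfl⟩
  have hE' : 8 * E.height ≤ ⌊8 * H⌋ := Int.le_floor.mpr (by
    push_cast
    have : (E.height : ℝ) ≤ H := hE
    linarith)
  have hA : |E.A| ≤ 8 * E.height := by
    refine le_trans ?_ E.abs_A_cube_le
    have h0 := abs_nonneg E.A
    nlinarith [pow_le_pow_right₀ (show 1 ≤ 1 + |E.A| by linarith) (show 1 ≤ 3 by norm_num)]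
  have hB : |E.B| ≤ 8 * E.height := by
    refine le_trans ?_ E.abs_B_sq_le
    have h0 := abs_nonneg E.B
    nlinarith [pow_le_pow_right₀ (show 1 ≤ 1 + |E.B| by linarith) (show 1 ≤ 2 by norm_num)]
  exact ⟨abs_le.mp (hA.trans hE'), abs_le.mp (hB.trans hE')⟩

end EllCurve

lemma summable_int_one_add_abs_rpow {s : ℝ} (hs : 1 < s) :
    Summable fun a : ℤ => (1 + |(a : ℝ)|) ^ (-s) := by
  have h : Summable fun n : ℕ => (1 + (n : ℝ)) ^ (-s) := by
    have := (summable_nat_add_iff 1).mpr (Real.summable_nat_rpow.mpr (neg_lt_neg hs))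
    refine this.congr fun n => ?_
    push_cast
    rw [add_comm]
  refine Summable.of_nat_of_neg ?_ ?_ <;> simpa using h

/-- The height zeta function of elliptic curves converges beyond `5 / 6`. -/
theorem summable_height_rpow {t : ℝ} (ht : 5 / 6 < t) :
    Summable fun E : EllCurve => (E.height : ℝ) ^ (-t) := by
  have ht0 : 0 < t := by linarith
  -- The height dominates a weighted geometric mean of `|A| ^ 3` and `|B| ^ 2`. Convergence in both
  -- variables needs `3 θ t > 1` and `2 (1 - θ) t > 1`; the interval of such `θ` is nonempty exactly
  -- when `t > 5/6`, and its midpoint is taken.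
  set θ : ℝ := (1 / (3 * t) + (1 - 1 / (2 * t))) / 2 with hθ
  have hlt : 1 / (3 * t) < 1 - 1 / (2 * t) := by
    rw [lt_sub_iff_add_lt]
    have : 1 / (3 * t) + 1 / (2 * t) = 5 / 6 / t := by field_simp; norm_num
    rw [this, div_lt_one ht0]
    exact ht
  have hθ1 : 1 / (3 * t) < θ := by linarith
  have hθ2 : θ < 1 - 1 / (2 * t) := by linarith
  have h1 : 1 < 3 * θ * t := by
    rw [div_lt_iff₀ (by positivity)] at hθ1
    linarith
  have h2 : 1 < 2 * (1 - θ) * t := by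
    have : 1 / (2 * t) < 1 - θ := by linarith
    rw [div_lt_iff₀ (by positivity)] at this
    linarith
  have hθ0 : 0 ≤ θ := (by positivity : (0 : ℝ) ≤ 1 / (3 * t)).trans hθ1.le
  have hθ1' : 0 ≤ 1 - θ := by
    have : 0 ≤ 1 / (2 * t) := by positivity
    linarith
  have hsum : Summable fun p : ℤ × ℤ =>
      (1 + |(p.1 : ℝ)|) ^ (-(3 * θ * t)) * (1 + |(p.2 : ℝ)|) ^ (-(2 * (1 - θ) * t)) :=
    (summable_int_one_add_abs_rpow h1).mul_of_nonneg (summable_int_one_add_abs_rpow h2)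
      (fun _ => by positivity) (fun _ => by positivity)
  have hsum' := ((hsum.comp_injective EllCurve.prod_injective).mul_left ((8 : ℝ) ^ t))
  refine Summable.of_nonneg_of_le (fun E => ?_) (fun E => ?_) hsum'
  · have := E.one_le_height_real
    positivity
  · have hE := E.one_le_height_real
    have hE0 : (0 : ℝ) < E.height := by linarith
    set a : ℝ := 1 + |(E.A : ℝ)| with ha
    set b : ℝ := 1 + |(E.B : ℝ)| with hb
    have ha0 : 0 < a := by positivity
    have hb0 : 0 < b := by positivity
    have hA : a ^ 3 ≤ 8 * E.height := by
      rw [ha, ← Int.cast_abs]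
      exact_mod_cast E.abs_A_cube_le
    have hB : b ^ 2 ≤ 8 * E.height := by
      rw [hb, ← Int.cast_abs]
      exact_mod_cast E.abs_B_sq_le
    have h3 : a ^ (3 * θ) * b ^ (2 * (1 - θ)) ≤ 8 * E.height := by
      calc a ^ (3 * θ) * b ^ (2 * (1 - θ)) = (a ^ 3) ^ θ * (b ^ 2) ^ (1 - θ) := by
            rw [← Real.rpow_natCast, ← Real.rpow_natCast, ← Real.rpow_mul ha0.le,
              ← Real.rpow_mul hb0.le]
            norm_num
        _ ≤ (8 * E.height : ℝ) ^ θ * (8 * E.height : ℝ) ^ (1 - θ) :=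
            mul_le_mul (Real.rpow_le_rpow (by positivity) hA hθ0)
              (Real.rpow_le_rpow (by positivity) hB hθ1') (by positivity) (by positivity)
        _ = 8 * E.height := by
            rw [← Real.rpow_add (by positivity)]
            norm_num
    have h4 := Real.rpow_le_rpow_of_nonpos (by positivity) h3 (show -t ≤ 0 by linarith)
    rw [Real.mul_rpow (by norm_num) hE0.le, Real.mul_rpow (by positivity) (by positivity),
      ← Real.rpow_mul ha0.le, ← Real.rpow_mul hb0.le] at h4
    have h5 : (8 : ℝ) ^ t * (8 : ℝ) ^ (-t) = 1 := by
      rw [← Real.rpow_add (by norm_num), add_neg_cancel, Real.rpow_zero]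
    calc (E.height : ℝ) ^ (-t) = (8 : ℝ) ^ t * ((8 : ℝ) ^ (-t) * (E.height : ℝ) ^ (-t)) := by
          rw [← mul_assoc, h5, one_mul]
      _ ≤ (8 : ℝ) ^ t * (a ^ (3 * θ * -t) * b ^ (2 * (1 - θ) * -t)) :=
          mul_le_mul_of_nonneg_left h4 (by positivity)
      _ = _ := by
          simp only [Function.comp, mul_neg, ha, hb]

lemma card_filter_dvd_le (N d : ℕ) : ((Finset.Ioc 0 N).filter fun x => d ∣ x).card ≤ N / d :=
  (Nat.Ioc_filter_dvd_card_eq_div N d).le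

open Classical in
/-- At least half of the pairs in a rectangle are not divisible by the weighted square of any
prime. -/
lemma half_le_card_minimal (a b : ℕ) (ha : 1 ≤ a) :
    (a : ℝ) * b / 2 ≤ (((Finset.Ioc 0 a ×ˢ Finset.Ioc 0 b).filter fun p : ℕ × ℕ =>
      ∀ q : ℕ, q.Prime → ¬ (q ^ 4 ∣ p.1 ∧ q ^ 6 ∣ p.2)).card : ℝ) := by
  set R := Finset.Ioc 0 a ×ˢ Finset.Ioc 0 b with hR
  set good := R.filter fun p : ℕ × ℕ => ∀ q : ℕ, q.Prime → ¬ (q ^ 4 ∣ p.1 ∧ q ^ 6 ∣ p.2) with hgood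
  -- The union bound runs over all `d ≥ 2`, not only primes. The density `d ^ (-10)` is at most `d ^
  -- (-2) / 2`, and the sum of `d ^ (-2)` over `d ≥ 2` is at most 1.
  set bad : ℕ → Finset (ℕ × ℕ) := fun d =>
    ((Finset.Ioc 0 a).filter fun x => d ^ 4 ∣ x) ×ˢ ((Finset.Ioc 0 b).filter fun x => d ^ 6 ∣ x)
    with hbad
  have hcover : R ⊆ good ∪ (Finset.Ioc 1 a).biUnion bad := by
    intro p hp
    by_cases hg : p ∈ good
    · exact Finset.mem_union_left _ hg
    refine Finset.mem_union_right _ ?_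
    rw [hgood, Finset.mem_filter, not_and] at hg
    have := hg hp
    push Not at this
    obtain ⟨q, hq, h4, h6⟩ := this
    rw [hR, Finset.mem_product] at hp
    rw [Finset.mem_biUnion]
    refine ⟨q, ?_, ?_⟩
    · rw [Finset.mem_Ioc]
      refine ⟨hq.one_lt, ?_⟩
      have h1 := Finset.mem_Ioc.mp hp.1
      exact (Nat.le_self_pow (by norm_num) q).trans ((Nat.le_of_dvd h1.1 h4).trans h1.2)
    · rw [hbad, Finset.mem_product, Finset.mem_filter, Finset.mem_filter]
      exact ⟨⟨hp.1, h4⟩, ⟨hp.2, h6⟩⟩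
  have h1 : R.card ≤ good.card + ∑ d ∈ Finset.Ioc 1 a, (bad d).card :=
    (Finset.card_le_card hcover).trans ((Finset.card_union_le _ _).trans
      (Nat.add_le_add_left Finset.card_biUnion_le _))
  have hRc : R.card = a * b := by rw [hR, Finset.card_product]; simp
  have hbadc : ∀ d ∈ Finset.Ioc 1 a, ((bad d).card : ℝ) ≤ (a : ℝ) * b / 2 * ((d : ℝ) ^ 2)⁻¹ := by
    intro d hd
    have hd2 : (2 : ℝ) ≤ d := by exact_mod_cast (Finset.mem_Ioc.mp hd).1
    have h2 : (bad d).card ≤ (a / d ^ 4) * (b / d ^ 6) := by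
      rw [hbad, Finset.card_product]
      exact Nat.mul_le_mul (card_filter_dvd_le _ _) (card_filter_dvd_le _ _)
    have h3 : ((a / d ^ 4 : ℕ) : ℝ) ≤ a / (d : ℝ) ^ 4 := by exact_mod_cast Nat.cast_div_le
    have h4 : ((b / d ^ 6 : ℕ) : ℝ) ≤ b / (d : ℝ) ^ 6 := by exact_mod_cast Nat.cast_div_le
    calc ((bad d).card : ℝ) ≤ ((a / d ^ 4 : ℕ) : ℝ) * ((b / d ^ 6 : ℕ) : ℝ) := by exact_mod_cast h2
      _ ≤ (a / (d : ℝ) ^ 4) * (b / (d : ℝ) ^ 6) := mul_le_mul h3 h4 (by positivity) (by positivity)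
      _ = (a : ℝ) * b * ((d : ℝ) ^ 2)⁻¹ * ((d : ℝ) ^ 8)⁻¹ := by
          have : (d : ℝ) ≠ 0 := by positivity
          field_simp
      _ ≤ (a : ℝ) * b * ((d : ℝ) ^ 2)⁻¹ * (1 / 2) := by
          refine mul_le_mul_of_nonneg_left ?_ (by positivity)
          rw [one_div]
          refine inv_anti₀ (by norm_num) (hd2.trans ?_)
          exact le_self_pow₀ (by linarith) (by norm_num)
      _ = _ := by ring
  have hsq : ∑ d ∈ Finset.Ioc 1 a, ((d : ℝ) ^ 2)⁻¹ ≤ 1 := by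
    refine (sum_Ioc_inv_sq_le_sub one_ne_zero ha).trans ?_
    have : (0 : ℝ) ≤ (a : ℝ)⁻¹ := by positivity
    simp
  have h5 : (∑ d ∈ Finset.Ioc 1 a, ((bad d).card : ℝ)) ≤ (a : ℝ) * b / 2 := by
    refine (Finset.sum_le_sum hbadc).trans ?_
    rw [← Finset.mul_sum]
    exact mul_le_of_le_one_right (by positivity) hsq
  have h6 : (a : ℝ) * b ≤ good.card + ∑ d ∈ Finset.Ioc 1 a, ((bad d).card : ℝ) := by
    rw [hRc] at h1
    exact_mod_cast h1
  linarith

lemma half_le_floor {x : ℝ} (hx : 1 ≤ x) : x / 2 ≤ ⌊x⌋₊ := by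
  have h1 := Nat.lt_floor_add_one x
  have h2 : (1 : ℝ) ≤ ⌊x⌋₊ := by exact_mod_cast Nat.one_le_floor_iff x |>.mpr hx
  linarith

/-- There are at least of the order of `H ^ (5 / 6)` elliptic curves of height at most `H`. -/
theorem exists_le_ncard_height_le : ∃ c : ℝ, 0 < c ∧ ∀ H : ℝ, 27 ≤ H →
    c * H ^ (5 / 6 : ℝ) ≤ (({E : EllCurve | (E.height : ℝ) ≤ H}.ncard : ℕ) : ℝ) := by
  classical
  refine ⟨1 / 8 * ((4 : ℝ) ^ (1 / 3 : ℝ))⁻¹ * ((27 : ℝ) ^ (1 / 2 : ℝ))⁻¹, by positivity,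
    fun H hH => ?_⟩
  have hH0 : 0 < H := by linarith
  set x := (H / 4) ^ (1 / 3 : ℝ) with hx
  set y := (H / 27) ^ (1 / 2 : ℝ) with hy
  have hx1 : 1 ≤ x := Real.one_le_rpow (by linarith) (by norm_num)
  have hy1 : 1 ≤ y := Real.one_le_rpow (by linarith) (by norm_num)
  have hx3 : x ^ 3 = H / 4 := by
    rw [hx, ← Real.rpow_natCast, ← Real.rpow_mul (by positivity)]
    norm_num
  have hy2 : y ^ 2 = H / 27 := by
    rw [hy, ← Real.rpow_natCast, ← Real.rpow_mul (by positivity)]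
    norm_num
  set a := ⌊x⌋₊
  set b := ⌊y⌋₊
  have ha1 : 1 ≤ a := (Nat.one_le_floor_iff x).mpr hx1
  have hcard := half_le_card_minimal a b ha1
  set good := (Finset.Ioc 0 a ×ˢ Finset.Ioc 0 b).filter fun p : ℕ × ℕ =>
      ∀ q : ℕ, q.Prime → ¬ (q ^ 4 ∣ p.1 ∧ q ^ 6 ∣ p.2) with hgood
  have hsub : ((good.image fun p : ℕ × ℕ => ((p.1 : ℤ), (p.2 : ℤ))) : Set (ℤ × ℤ)) ⊆
      (fun E : EllCurve => (E.A, E.B)) '' {E : EllCurve | (E.height : ℝ) ≤ H} := by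
    intro z hz
    obtain ⟨⟨u, v⟩, huv, rfl⟩ := Finset.mem_image.mp (Finset.mem_coe.mp hz)
    obtain ⟨h1, h2⟩ := Finset.mem_filter.mp huv
    obtain ⟨h3, h4⟩ := Finset.mem_product.mp h1
    rw [Finset.mem_Ioc] at h3 h4
    simp only at h2 h3 h4
    have hu : (0 : ℤ) < u := by exact_mod_cast h3.1
    have hv : (0 : ℤ) < v := by exact_mod_cast h4.1
    -- Restricting to positive `A` and `B` makes smoothness automatic.
    refine ⟨⟨u, v, by positivity, fun p hp hd => h2 p hp ?_⟩, ?_, rfl⟩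
    · exact ⟨by exact_mod_cast hd.1, by exact_mod_cast hd.2⟩
    · have hux : (u : ℝ) ≤ x := (Nat.cast_le.mpr h3.2).trans (Nat.floor_le (by linarith))
      have hvy : (v : ℝ) ≤ y := (Nat.cast_le.mpr h4.2).trans (Nat.floor_le (by linarith))
      have h5 : (u : ℝ) ^ 3 ≤ H / 4 := by
        rw [← hx3]; exact pow_le_pow_left₀ (by positivity) hux 3
      have h6 : (v : ℝ) ^ 2 ≤ H / 27 := by
        rw [← hy2]; exact pow_le_pow_left₀ (by positivity) hvy 2
      change ((EllCurve.height _ : ℤ) : ℝ) ≤ H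
      simp only [EllCurve.height, Int.cast_max]
      refine max_le ?_ ?_
      · rw [abs_of_pos (by positivity)]
        push_cast
        linarith
      · rw [abs_of_pos (by positivity)]
        push_cast
        linarith
  have hle := Set.ncard_le_ncard hsub ((EllCurve.finite_height_le H).image _)
  rw [Set.ncard_coe_finset, Finset.card_image_of_injective _ (by
    rintro ⟨u, v⟩ ⟨u', v'⟩ h
    simpa using h), Set.ncard_image_of_injective _ EllCurve.prod_injective] at hle
  calc _ = (x / 2) * (y / 2) / 2 := by
        rw [hx, hy, Real.div_rpow hH0.le (by norm_num), Real.div_rpow hH0.le (by norm_num),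
          show (5 / 6 : ℝ) = 1 / 3 + 1 / 2 by norm_num, Real.rpow_add hH0]
        ring
    _ ≤ (a : ℝ) * b / 2 := by
        have := mul_le_mul (half_le_floor hx1) (half_le_floor hy1) (by linarith) (by positivity)
        linarith
    _ ≤ good.card := hcard
    _ ≤ _ := by exact_mod_cast hle

/-! ### Almost sure counts of curves for events of given probability -/

lemma EllCurve.tendsto_height : Tendsto (fun E : EllCurve => (E.height : ℝ)) cofinite atTop := by
  refine tendsto_atTop.mpr fun H => ?_
  rw [eventually_cofinite]
  exact (EllCurve.finite_height_le H).subset fun E hE => (not_le.mp hE).le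

lemma tsum_measure_ne_top_of_summable {ι Ω : Type*} [MeasurableSpace Ω] {μ : Measure Ω}
    [IsFiniteMeasure μ] {s : ι → Set Ω} (h : Summable fun i => μ.real (s i)) :
    ∑' i, μ (s i) ≠ ∞ := by
  have h1 : (fun i => μ (s i)) = fun i => ENNReal.ofReal (μ.real (s i)) := by
    funext i; rw [ofReal_measureReal]
  rw [h1, ← ENNReal.ofReal_tsum_of_nonneg (fun _ => measureReal_nonneg) h]
  exact ENNReal.ofReal_ne_top

section Events

variable {Ω : Type*} [MeasurableSpace Ω] {μ : Measure Ω} {S : EllCurve → Set Ω}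

lemma summable_measureReal_mul_height {u s : ℝ} (hus : 5 / 6 < u + s)
    (hq : ∀ᶠ E : EllCurve in cofinite, μ.real (S E) ≤ (E.height : ℝ) ^ (-u)) :
    Summable fun E : EllCurve => μ.real (S E) * (E.height : ℝ) ^ (-s) := by
  refine (summable_height_rpow hus).of_norm_bounded_eventually (hq.mono fun E hE => ?_)
  have h0 : (0 : ℝ) < E.height := one_pos.trans_le E.one_le_height_real
  rw [Real.norm_of_nonneg (mul_nonneg measureReal_nonneg (by positivity)), neg_add,
    Real.rpow_add h0]
  exact mul_le_mul_of_nonneg_right hE (by positivity)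

/-- The random series summing `height ^ (-s)` over the curves whose event occurs has finite
expectation, so it is almost surely finite. Each occurrence up to height `H` contributes at least `H
^ (-s)`. No independence is needed. -/
lemma ae_exists_ncard_le [IsProbabilityMeasure μ] (hS : ∀ E, NullMeasurableSet (S E) μ) {u s : ℝ} (hs : 0 ≤ s)
    (hus : 5 / 6 < u + s)
    (hq : ∀ᶠ E : EllCurve in cofinite, μ.real (S E) ≤ (E.height : ℝ) ^ (-u)) :
    ∀ᵐ ω ∂μ, ∃ C : ℝ, ∀ H : ℝ, 1 ≤ H →
      ({E : EllCurve | (E.height : ℝ) ≤ H ∧ ω ∈ S E}.ncard : ℝ) ≤ C * H ^ s := by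
  have hsum := summable_measureReal_mul_height hus hq
  set f : EllCurve → Ω → ℝ≥0∞ := fun E =>
    (S E).indicator fun _ => ENNReal.ofReal ((E.height : ℝ) ^ (-s)) with hf
  have hfm : ∀ E, AEMeasurable (f E) μ := fun E => aemeasurable_const.indicator₀ (hS E)
  have hint : ∫⁻ ω, ∑' E, f E ω ∂μ ≠ ∞ := by
    rw [lintegral_tsum hfm]
    have h1 : (fun E => ∫⁻ ω, f E ω ∂μ) =
        fun E => ENNReal.ofReal (μ.real (S E) * (E.height : ℝ) ^ (-s)) := by
      funext E
      rw [hf, lintegral_indicator_const₀ (hS E), ENNReal.ofReal_mul measureReal_nonneg,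
        ofReal_measureReal, mul_comm]
    rw [h1, ← ENNReal.ofReal_tsum_of_nonneg (fun E => mul_nonneg measureReal_nonneg ?_) hsum]
    · exact ENNReal.ofReal_ne_top
    · exact Real.rpow_nonneg (by linarith [E.one_le_height_real]) _
  filter_upwards [ae_lt_top' (AEMeasurable.tsum hfm) hint] with ω hω
  refine ⟨(∑' E, f E ω).toReal, fun H hH => ?_⟩
  have hH0 : 0 < H := by linarith
  have hfin : {E : EllCurve | (E.height : ℝ) ≤ H ∧ ω ∈ S E}.Finite :=
    (EllCurve.finite_height_le H).subset fun E hE => hE.1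
  have h1 : (hfin.toFinset.card : ℝ≥0∞) * ENNReal.ofReal (H ^ (-s)) ≤ ∑' E, f E ω := by
    refine le_trans ?_ (ENNReal.sum_le_tsum hfin.toFinset)
    rw [← nsmul_eq_mul]
    refine Finset.card_nsmul_le_sum _ _ _ fun E hE => ?_
    have hE' := hfin.mem_toFinset.mp hE
    rw [hf]
    simp only [Set.indicator_of_mem hE'.2]
    exact ENNReal.ofReal_le_ofReal (Real.rpow_le_rpow_of_nonpos
      (one_pos.trans_le E.one_le_height_real) hE'.1 (by linarith))
  have h2 := ENNReal.toReal_mono hω.ne h1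
  rw [ENNReal.toReal_mul, ENNReal.toReal_ofReal (by positivity), ENNReal.toReal_natCast,
    Real.rpow_neg hH0.le, ← div_eq_mul_inv, div_le_iff₀ (by positivity)] at h2
  rwa [Set.ncard_eq_toFinset_card _ hfin]

lemma eventually_le_rpow (C : ℝ) {δ : ℝ} (hδ : 0 < δ) : ∀ᶠ H : ℝ in atTop, C ≤ H ^ δ :=
  (tendsto_rpow_atTop hδ).eventually_ge_atTop C

/-- If `S E` has probability at most `height E ^ (-u + o(1))`, then almost surely at most
`H ^ (s + o(1))` curves of height at most `H` satisfy `ω ∈ S E`, where `s = 5 / 6 - u`. -/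
theorem ae_eventually_ncard_le [IsProbabilityMeasure μ] (hS : ∀ E, NullMeasurableSet (S E) μ) {u s : ℝ} (hs : 0 ≤ s)
    (hus : u + s = 5 / 6)
    (hq : ∀ δ : ℝ, 0 < δ → ∀ᶠ E : EllCurve in cofinite, μ.real (S E) ≤ (E.height : ℝ) ^ (-u + δ)) :
    ∀ᵐ ω ∂μ, ∀ δ : ℝ, 0 < δ → ∀ᶠ H : ℝ in atTop,
      ({E : EllCurve | (E.height : ℝ) ≤ H ∧ ω ∈ S E}.ncard : ℝ) ≤ H ^ (s + δ) := by
  have key : ∀ k : ℕ, ∀ᵐ ω ∂μ, ∀ᶠ H : ℝ in atTop,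
      ({E : EllCurve | (E.height : ℝ) ≤ H ∧ ω ∈ S E}.ncard : ℝ) ≤ H ^ (s + 1 / ((k : ℝ) + 1)) := by
    intro k
    set δ : ℝ := 1 / ((k : ℝ) + 1)
    have hδ : 0 < δ := by positivity
    -- The exponents add up to `5/6 + δ/4`, just inside the range of convergence; the unused `δ/2`
    -- of the target absorbs the random constant `C`.
    have h := ae_exists_ncard_le (μ := μ) hS (u := u - δ / 4) (s := s + δ / 2) (by linarith)
      (by linarith) ((hq (δ / 4) (by linarith)).mono fun E hE => by
        rwa [show -(u - δ / 4) = -u + δ / 4 by ring])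
    filter_upwards [h] with ω ⟨C, hC⟩
    filter_upwards [eventually_le_rpow C (half_pos hδ), eventually_ge_atTop 1] with H h1 h2
    have hH0 : 0 < H := by linarith
    refine (hC H h2).trans ?_
    rw [show s + δ = δ / 2 + (s + δ / 2) by ring, Real.rpow_add hH0 (δ / 2)]
    exact mul_le_mul_of_nonneg_right h1 (by positivity)
  -- Null sets can be discarded only countably often, hence the passage through `δ = 1 / (k + 1)`.
  filter_upwards [ae_all_iff.mpr key] with ω hω δ hδ
  obtain ⟨k, hk⟩ := exists_nat_one_div_lt hδ
  filter_upwards [hω k, eventually_ge_atTop 1] with H h1 h2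
  exact h1.trans (Real.rpow_le_rpow_of_exponent_le h2 (by linarith))

theorem ae_finite_setOf_mem_of_measureReal_le [IsProbabilityMeasure μ] {u : ℝ} (hu : 5 / 6 < u)
    (hq : ∀ᶠ E : EllCurve in cofinite, μ.real (S E) ≤ (E.height : ℝ) ^ (-u)) :
    ∀ᵐ ω ∂μ, {E : EllCurve | ω ∈ S E}.Finite := by
  have h := summable_measureReal_mul_height (u := u) (s := 0) (by linarith) hq
  simp only [neg_zero, Real.rpow_zero, mul_one] at h
  exact ae_finite_setOfPred_mem (tsum_measure_ne_top_of_summable h)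

lemma ncard_height_le_eq_sum {α : Type*} (S : EllCurve → Set α) (H : ℝ) (ω : α) :
    ({E : EllCurve | (E.height : ℝ) ≤ H ∧ ω ∈ S E}.ncard : ℝ) =
      ∑ E ∈ (EllCurve.finite_height_le H).toFinset, (S E).indicator (fun _ => (1 : ℝ)) ω := by
  classical
  have h : {E : EllCurve | (E.height : ℝ) ≤ H ∧ ω ∈ S E} =
      ((EllCurve.finite_height_le H).toFinset.filter fun E => ω ∈ S E : Finset EllCurve) := by
    ext E; simp
  rw [h, Set.ncard_coe_finset, Finset.card_filter]
  push_cast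
  rfl

lemma memLp_indicator_one [IsProbabilityMeasure μ] (hS : ∀ E, NullMeasurableSet (S E) μ) (E : EllCurve) :
    MemLp ((S E).indicator fun _ => (1 : ℝ)) 2 μ :=
  MemLp.of_bound ((aemeasurable_const.indicator₀ (hS E)).aestronglyMeasurable) 1
    (Eventually.of_forall fun ω => by
      by_cases h : ω ∈ S E <;> simp [h])

/-- Chebyshev's inequality for the number of pairwise independent events that occur. -/
lemma measureReal_sum_indicator_le [IsProbabilityMeasure μ] (hS : ∀ E, NullMeasurableSet (S E) μ)
    (hind : Pairwise fun E E' => IndepFun ((S E).indicator fun _ => (1 : ℝ))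
      ((S E').indicator fun _ => (1 : ℝ)) μ) (T : Finset EllCurve)
    (hm : 0 < ∑ E ∈ T, μ.real (S E)) :
    μ.real {ω | ∑ E ∈ T, (S E).indicator (fun _ => (1 : ℝ)) ω ≤ (∑ E ∈ T, μ.real (S E)) / 2} ≤
      4 / ∑ E ∈ T, μ.real (S E) := by
  set m := ∑ E ∈ T, μ.real (S E) with hmdef
  set Y : EllCurve → Ω → ℝ := fun E => (S E).indicator fun _ => (1 : ℝ) with hY
  have hL : ∀ E, MemLp (Y E) 2 μ := memLp_indicator_one hS
  have hEY : ∀ E, ∫ ω, Y E ω ∂μ = μ.real (S E) := fun E => by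
    rw [hY, integral_indicator₀ (hS E)]
    simp
  have hmean : ∫ ω, (∑ E ∈ T, Y E) ω ∂μ = m := by
    simp only [Finset.sum_apply]
    rw [integral_finsetSum _ fun E _ => (hL E).integrable (by norm_num)]
    exact Finset.sum_congr rfl fun E _ => hEY E
  -- The variance of an indicator is at most its mean, and pairwise independence makes variances
  -- add.
  have hvar : variance (∑ E ∈ T, Y E) μ ≤ m := by
    rw [IndepFun.variance_sum (fun E _ => hL E) fun E _ E' _ hne => hind hne]
    refine Finset.sum_le_sum fun E _ => ?_
    refine (variance_le_expectation_sq (hL E).1).trans (le_of_eq ?_)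
    rw [← hEY E]
    refine integral_congr_ae (Eventually.of_forall fun ω => ?_)
    by_cases h : ω ∈ S E <;> simp [hY, h]
  have hcheb := meas_ge_le_variance_div_sq (memLp_finsetSum' T fun E _ => hL E) (half_pos hm)
  rw [hmean] at hcheb
  have hsub : {ω | ∑ E ∈ T, Y E ω ≤ m / 2} ⊆ {ω | m / 2 ≤ |(∑ E ∈ T, Y E) ω - m|} := by
    intro ω hω
    have h1 : (∑ E ∈ T, Y E) ω ≤ m / 2 := by rw [Finset.sum_apply]; exact hω
    have h2 := neg_abs_le ((∑ E ∈ T, Y E) ω - m)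
    show m / 2 ≤ _
    linarith
  refine ENNReal.toReal_le_of_le_ofReal (by positivity)
    ((measure_mono hsub).trans (hcheb.trans (ENNReal.ofReal_le_ofReal ?_)))
  calc variance (∑ E ∈ T, Y E) μ / (m / 2) ^ 2 ≤ m / (m / 2) ^ 2 :=
        div_le_div_of_nonneg_right hvar (by positivity)
    _ = 4 / m := by field_simp; norm_num

/-- The expected number of occurrences among the curves of height at most `H`. -/
lemma exists_le_sum_measureReal {u : ℝ} (hu : 0 ≤ u)
    (hq : ∀ᶠ E : EllCurve in cofinite, (E.height : ℝ) ^ (-u) ≤ μ.real (S E)) :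
    ∃ c : ℝ, 0 < c ∧ ∀ᶠ H : ℝ in atTop, c * H ^ (5 / 6 - u) ≤
      ∑ E ∈ (EllCurve.finite_height_le H).toFinset, μ.real (S E) := by
  classical
  obtain ⟨c, hc, hcount⟩ := exists_le_ncard_height_le
  rw [eventually_cofinite] at hq
  -- The finitely many curves violating the probability bound are discarded; for large `H` they are
  -- fewer than half of the guaranteed count.
  set B := hq.toFinset with hB
  refine ⟨c / 2, by positivity, ?_⟩
  filter_upwards [eventually_ge_atTop 27, eventually_le_rpow (2 * B.card / c)
    (show (0 : ℝ) < 5 / 6 by norm_num)] with H hH hH2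
  have hH0 : 0 < H := by linarith
  set T := (EllCurve.finite_height_le H).toFinset with hT
  have h1 := hcount H hH
  rw [Set.ncard_eq_toFinset_card _ (EllCurve.finite_height_le H)] at h1
  rw [div_le_iff₀ hc] at hH2
  have h2 : c / 2 * H ^ (5 / 6 : ℝ) ≤ ((T \ B).card : ℝ) := by
    have h3 : T.card ≤ (T \ B).card + B.card := by
      have := Finset.le_card_sdiff B T
      omega
    have h4 : (T.card : ℝ) ≤ ((T \ B).card : ℝ) + B.card := by exact_mod_cast h3
    linarith
  calc c / 2 * H ^ (5 / 6 - u) = (c / 2 * H ^ (5 / 6 : ℝ)) * H ^ (-u) := by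
        rw [sub_eq_add_neg, Real.rpow_add hH0]; ring
    _ ≤ ((T \ B).card : ℝ) * H ^ (-u) := mul_le_mul_of_nonneg_right h2 (by positivity)
    _ = (T \ B).card • H ^ (-u) := (nsmul_eq_mul _ _).symm
    _ ≤ ∑ E ∈ T \ B, μ.real (S E) := by
        refine Finset.card_nsmul_le_sum _ _ _ fun E hE => ?_
        obtain ⟨hE1, hE2⟩ := Finset.mem_sdiff.mp hE
        have h5 : (E.height : ℝ) ≤ H := (EllCurve.finite_height_le H).mem_toFinset.mp hE1
        have h6 : (E.height : ℝ) ^ (-u) ≤ μ.real (S E) := by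
          by_contra h
          exact hE2 (hq.mem_toFinset.mpr h)
        exact (Real.rpow_le_rpow_of_nonpos (one_pos.trans_le E.one_le_height_real) h5
          (by linarith)).trans h6
    _ ≤ _ := Finset.sum_le_sum_of_subset_of_nonneg Finset.sdiff_subset
        fun _ _ _ => measureReal_nonneg

/-- Along `H = 2 ^ j` the Chebyshev failure probabilities decay geometrically, because the mean
grows like a positive power of `H`; Borel–Cantelli then applies. -/
lemma ae_eventually_le_ncard_two_pow [IsProbabilityMeasure μ] (hS : ∀ E, NullMeasurableSet (S E) μ)
    (hind : Pairwise fun E E' => IndepFun ((S E).indicator fun _ => (1 : ℝ))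
      ((S E').indicator fun _ => (1 : ℝ)) μ) {u : ℝ} (hu : 0 ≤ u) (hu' : u < 5 / 6)
    (hq : ∀ᶠ E : EllCurve in cofinite, (E.height : ℝ) ^ (-u) ≤ μ.real (S E)) :
    ∃ c : ℝ, 0 < c ∧ ∀ᵐ ω ∂μ, ∀ᶠ j : ℕ in atTop, c * ((2 : ℝ) ^ j) ^ (5 / 6 - u) ≤
      ({E : EllCurve | (E.height : ℝ) ≤ 2 ^ j ∧ ω ∈ S E}.ncard : ℝ) := by
  obtain ⟨c, hc, hmean⟩ := exists_le_sum_measureReal hu hq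
  refine ⟨c / 2, by positivity, ?_⟩
  have hpow : Tendsto (fun j : ℕ => (2 : ℝ) ^ j) atTop atTop :=
    tendsto_pow_atTop_atTop_of_one_lt (by norm_num)
  have hgeom : ∀ j : ℕ, ((2 : ℝ) ^ j) ^ (5 / 6 - u) = ((2 : ℝ) ^ (5 / 6 - u)) ^ j := fun j => by
    rw [← Real.rpow_natCast, ← Real.rpow_mul (by norm_num), mul_comm, Real.rpow_mul (by norm_num),
      Real.rpow_natCast]
  have h1 : 1 < (2 : ℝ) ^ (5 / 6 - u) := Real.one_lt_rpow (by norm_num) (by linarith)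
  set A : ℕ → Set Ω := fun j =>
    {ω | ({E : EllCurve | (E.height : ℝ) ≤ 2 ^ j ∧ ω ∈ S E}.ncard : ℝ) <
      c / 2 * ((2 : ℝ) ^ j) ^ (5 / 6 - u)} with hA
  have hsum : Summable fun j => μ.real (A j) := by
    have hg : Summable fun j : ℕ => 4 / c * (((2 : ℝ) ^ (5 / 6 - u))⁻¹) ^ j :=
      (summable_geometric_of_lt_one (by positivity) (inv_lt_one_of_one_lt₀ h1)).mul_left _
    refine hg.of_norm_bounded_eventually_nat ?_
    filter_upwards [hpow.eventually hmean] with j hj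
    rw [Real.norm_of_nonneg measureReal_nonneg]
    have hpos : 0 < c * ((2 : ℝ) ^ j) ^ (5 / 6 - u) := by positivity
    refine le_trans (measureReal_mono ?_ (measure_ne_top _ _))
      ((measureReal_sum_indicator_le hS hind _ (hpos.trans_le hj)).trans ?_)
    · intro ω hω
      have hω' : ({E : EllCurve | (E.height : ℝ) ≤ 2 ^ j ∧ ω ∈ S E}.ncard : ℝ) <
        c / 2 * ((2 : ℝ) ^ j) ^ (5 / 6 - u) := hω
      rw [ncard_height_le_eq_sum] at hω'
      rw [Set.mem_ofPred_eq]
      linarith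
    · refine (div_le_div_of_nonneg_left (by norm_num) hpos hj).trans (le_of_eq ?_)
      rw [hgeom, inv_pow]
      field_simp
  filter_upwards [ae_eventually_notMem (tsum_measure_ne_top_of_summable hsum)] with ω hω
  filter_upwards [hω] with j hj
  by_contra hlt
  exact hj (not_le.mp hlt)

/-- If the events `S E` are pairwise independent, of probability at least
`height E ^ (-u + o(1))` with `u < 5 / 6`, then almost surely at least `H ^ (5 / 6 - u + o(1))`
curves of height at most `H` satisfy `ω ∈ S E`. -/
theorem ae_eventually_le_ncard [IsProbabilityMeasure μ] (hS : ∀ E, NullMeasurableSet (S E) μ)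
    (hind : Pairwise fun E E' => IndepFun ((S E).indicator fun _ => (1 : ℝ))
      ((S E').indicator fun _ => (1 : ℝ)) μ) {u s : ℝ} (hu : 0 ≤ u) (hs : 0 < s)
    (hus : u + s = 5 / 6)
    (hq : ∀ δ : ℝ, 0 < δ → ∀ᶠ E : EllCurve in cofinite, (E.height : ℝ) ^ (-u - δ) ≤ μ.real (S E)) :
    ∀ᵐ ω ∂μ, ∀ δ : ℝ, 0 < δ → ∀ᶠ H : ℝ in atTop,
      H ^ (s - δ) ≤ ({E : EllCurve | (E.height : ℝ) ≤ H ∧ ω ∈ S E}.ncard : ℝ) := by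
  have key : ∀ k : ℕ, ∀ᵐ ω ∂μ, ∀ᶠ H : ℝ in atTop, H ^ (s - s / ((k : ℝ) + 1)) ≤
      ({E : EllCurve | (E.height : ℝ) ≤ H ∧ ω ∈ S E}.ncard : ℝ) := by
    intro k
    -- The loss is scaled by `s` so that `δ ≤ s` and `u + δ / 2` stays below `5/6`.
    set δ : ℝ := s / ((k : ℝ) + 1) with hδdef
    have hδ : 0 < δ := by positivity
    have hδs : δ ≤ s := div_le_self hs.le (by linarith [(Nat.cast_nonneg k : (0 : ℝ) ≤ k)])
    obtain ⟨c, hc, h⟩ := ae_eventually_le_ncard_two_pow hS hind (u := u + δ / 2) (by linarith)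
      (by linarith) ((hq (δ / 2) (by linarith)).mono fun E hE => by
        rwa [show -(u + δ / 2) = -u - δ / 2 by ring])
    filter_upwards [h] with ω hω
    obtain ⟨J, hJ⟩ := eventually_atTop.mp hω
    rw [show 5 / 6 - (u + δ / 2) = s - δ / 2 by linarith] at hJ
    filter_upwards [eventually_ge_atTop ((2 : ℝ) ^ J), eventually_ge_atTop 1,
      eventually_le_rpow (2 ^ (s - δ / 2) / c) (half_pos hδ)] with H hHJ hH1 hHc
    have hH0 : 0 < H := by linarith
    obtain ⟨j, hj1, hj2⟩ := exists_nat_pow_near hH1 (show (1 : ℝ) < 2 by norm_num)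
    have hJj : J ≤ j := by
      have : J < j + 1 := (pow_lt_pow_iff_right₀ (show (1 : ℝ) < 2 by norm_num)).mp
        (hHJ.trans_lt hj2)
      omega
    have h1 : ({E : EllCurve | (E.height : ℝ) ≤ 2 ^ j ∧ ω ∈ S E}.ncard : ℝ) ≤
        ({E : EllCurve | (E.height : ℝ) ≤ H ∧ ω ∈ S E}.ncard : ℝ) := by
      have hsub : {E : EllCurve | (E.height : ℝ) ≤ 2 ^ j ∧ ω ∈ S E} ⊆
          {E : EllCurve | (E.height : ℝ) ≤ H ∧ ω ∈ S E} := fun E hE => ⟨hE.1.trans hj1, hE.2⟩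
      exact Nat.cast_le.mpr (Set.ncard_le_ncard hsub
        ((EllCurve.finite_height_le H).subset fun E hE => hE.1))
    refine le_trans ?_ ((hJ j hJj).trans h1)
    -- Counts are monotone in `H`, so rounding down to a power of 2 costs a bounded factor, absorbed
    -- together with `c` by `H ^ (δ / 2)`.
    have h2 : H ^ (s - δ / 2) ≤ 2 ^ (s - δ / 2) * ((2 : ℝ) ^ j) ^ (s - δ / 2) := by
      rw [← Real.mul_rpow (by norm_num) (by positivity), ← pow_succ']
      exact Real.rpow_le_rpow hH0.le hj2.le (by linarith)
    rw [div_le_iff₀ hc] at hHc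
    have h3 : H ^ (s - δ / 2) = H ^ (s - δ) * H ^ (δ / 2) := by
      rw [← Real.rpow_add hH0]; congr 1; ring
    have h4 : (0 : ℝ) < 2 ^ (s - δ / 2) := by positivity
    have h5 : (0 : ℝ) ≤ H ^ (s - δ) := by positivity
    rw [h3] at h2
    have h6 : H ^ (s - δ) * 2 ^ (s - δ / 2) ≤
        2 ^ (s - δ / 2) * (c * ((2 : ℝ) ^ j) ^ (s - δ / 2)) :=
      calc H ^ (s - δ) * 2 ^ (s - δ / 2) ≤ H ^ (s - δ) * (H ^ (δ / 2) * c) :=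
            mul_le_mul_of_nonneg_left hHc h5
        _ = c * (H ^ (s - δ) * H ^ (δ / 2)) := by ring
        _ ≤ c * (2 ^ (s - δ / 2) * ((2 : ℝ) ^ j) ^ (s - δ / 2)) :=
            mul_le_mul_of_nonneg_left h2 hc.le
        _ = _ := by ring
    rw [mul_comm] at h6
    exact le_of_mul_le_mul_left h6 h4
  filter_upwards [ae_all_iff.mpr key] with ω hω δ hδ
  obtain ⟨k, hk⟩ := exists_nat_one_div_lt (div_pos hδ hs)
  filter_upwards [hω k, eventually_ge_atTop 1] with H h1 h2
  refine le_trans (Real.rpow_le_rpow_of_exponent_le h2 ?_) h1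
  rw [lt_div_iff₀ hs] at hk
  have : s / ((k : ℝ) + 1) = 1 / ((k : ℝ) + 1) * s := by ring
  linarith

end Events

/-! ### From bounds for every `δ` to exponents with an `o(1)` term -/

lemma isPowO1_of_eventually {f : ℝ → ℝ} {a : ℝ}
    (hl : ∀ δ : ℝ, 0 < δ → ∀ᶠ H in atTop, H ^ (a - δ) ≤ f H)
    (hu : ∀ δ : ℝ, 0 < δ → ∀ᶠ H in atTop, f H ≤ H ^ (a + δ)) : IsPowO1 f a := by
  refine ⟨fun H => Real.log (f H) / Real.log H - a, ?_, ?_⟩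
  · rw [Metric.tendsto_nhds]
    intro δ hδ
    filter_upwards [hl (δ / 2) (by linarith), hu (δ / 2) (by linarith), eventually_gt_atTop 1]
      with H h1 h2 h3
    have hlog : 0 < Real.log H := Real.log_pos h3
    have hH0 : 0 < H := by linarith
    have hf : 0 < f H := lt_of_lt_of_le (by positivity) h1
    have h4 : Real.log (f H) ≤ (a + δ / 2) * Real.log H := by
      rw [← Real.log_rpow hH0]
      exact Real.log_le_log hf h2
    have h5 : (a - δ / 2) * Real.log H ≤ Real.log (f H) := by
      rw [← Real.log_rpow hH0]
      exact Real.log_le_log (by positivity) h1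
    have h6 := (div_le_iff₀ hlog).mpr h4
    have h7 := (le_div_iff₀ hlog).mpr h5
    rw [Real.dist_eq, sub_zero, abs_lt]
    constructor <;> linarith
  · filter_upwards [hl 1 one_pos, eventually_gt_atTop 1] with H h1 h3
    have hlog : 0 < Real.log H := Real.log_pos h3
    have hH0 : 0 < H := by linarith
    have hf : 0 < f H := lt_of_lt_of_le (by positivity) h1
    rw [add_sub_cancel, Real.rpow_def_of_pos hH0, mul_div_cancel₀ _ hlog.ne', Real.exp_log hf]

lemma lePowO1_of_eventually {f : ℝ → ℝ} {a : ℝ}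
    (h : ∀ δ : ℝ, 0 < δ → ∀ᶠ H in atTop, f H ≤ H ^ (a + δ)) : LePowO1 f a := by
  -- The function may vanish, where its logarithm carries no information; the maximum with `H ^ a`
  -- is positive and obeys the same upper bounds.
  have hmax : IsPowO1 (fun H => max (f H) (H ^ a)) a := by
    refine isPowO1_of_eventually (fun δ hδ => ?_) fun δ hδ => ?_
    · filter_upwards [eventually_ge_atTop 1] with H hH
      exact (Real.rpow_le_rpow_of_exponent_le hH (by linarith)).trans (le_max_right _ _)
    · filter_upwards [h δ hδ, eventually_ge_atTop 1] with H h1 hH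
      exact max_le h1 (Real.rpow_le_rpow_of_exponent_le hH (by linarith))
  obtain ⟨ε, hε, h1⟩ := hmax
  exact ⟨ε, hε, h1.mono fun H hH => (le_max_left _ _).trans hH.le⟩

/-! ### Application to the random model -/

namespace IsRankModel

variable {X : ℝ → ℝ≥0} {ν : ℝ → PMF ℕ} {Ω : Type*} [MeasurableSpace Ω] {μ : Measure Ω}
  {M : EllCurve → Ω → SqMatrix}

lemma nullMeasurableSet (h : IsRankModel X ν μ M) (P : ℕ → Prop) (E : EllCurve) :
    NullMeasurableSet {ω | P (M E ω).kerRank} μ := by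
  have hs : MeasurableSet {A : SqMatrix | P A.kerRank} := trivial
  exact (h.law E).aemeasurable.nullMeasurableSet_preimage hs

lemma measureReal_eq (h : IsRankModel X ν μ M) (P : ℕ → Prop) (E : EllCurve) :
    μ.real {ω | P (M E ω).kerRank} =
      (modelLaw (ν E.height) (X E.height)).toMeasure.real {A : SqMatrix | P A.kerRank} := by
  have hs : MeasurableSet {A : SqMatrix | P A.kerRank} := trivial
  exact (h.law E).measureReal_eq hs

lemma pairwise_indepFun (h : IsRankModel X ν μ M) (P : ℕ → Prop) :
    Pairwise fun E E' => IndepFun ({ω | P (M E ω).kerRank}.indicator fun _ => (1 : ℝ))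
      ({ω | P (M E' ω).kerRank}.indicator fun _ => (1 : ℝ)) μ := by
  intro E E' hne
  set φ : SqMatrix → ℝ := {A : SqMatrix | P A.kerRank}.indicator fun _ => (1 : ℝ)
  have hφ : Measurable φ := fun _ _ => trivial
  exact (h.indep.indepFun hne).comp hφ hφ

variable [IsProbabilityMeasure μ]

/-- Probabilities `H ^ (-u + o(1))` give counts of size at most `H ^ (5 / 6 - u + o(1))`. -/
lemma ae_countRank_le (h : IsRankModel X ν μ M) (P : ℕ → Prop) {u s : ℝ} (hs : 0 ≤ s)
    (hus : u + s = 5 / 6)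
    (hq : ∀ δ : ℝ, 0 < δ → ∀ᶠ H : ℝ in atTop,
      (modelLaw (ν H) (X H)).toMeasure.real {A : SqMatrix | P A.kerRank} ≤ H ^ (-u + δ)) :
    ∀ᵐ ω ∂μ, ∀ δ : ℝ, 0 < δ → ∀ᶠ H : ℝ in atTop,
      countRank (fun E => (M E ω).kerRank) P H ≤ H ^ (s + δ) := by
  refine ae_eventually_ncard_le (S := fun E => {ω | P (M E ω).kerRank}) (h.nullMeasurableSet P)
    hs hus fun δ hδ => ?_
  filter_upwards [EllCurve.tendsto_height.eventually (hq δ hδ)] with E hE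
  exact (h.measureReal_eq P E).trans_le hE

lemma ae_le_countRank (h : IsRankModel X ν μ M) (P : ℕ → Prop) {u s : ℝ} (hu : 0 ≤ u)
    (hs : 0 < s) (hus : u + s = 5 / 6)
    (hq : ∀ δ : ℝ, 0 < δ → ∀ᶠ H : ℝ in atTop, H ^ (-u - δ) ≤
      (modelLaw (ν H) (X H)).toMeasure.real {A : SqMatrix | P A.kerRank}) :
    ∀ᵐ ω ∂μ, ∀ δ : ℝ, 0 < δ → ∀ᶠ H : ℝ in atTop,
      H ^ (s - δ) ≤ countRank (fun E => (M E ω).kerRank) P H := by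
  refine ae_eventually_le_ncard (S := fun E => {ω | P (M E ω).kerRank}) (h.nullMeasurableSet P)
    (h.pairwise_indepFun P) hu hs hus fun δ hδ => ?_
  filter_upwards [EllCurve.tendsto_height.eventually (hq δ hδ)] with E hE
  exact hE.trans_eq (h.measureReal_eq P E).symm

lemma ae_finite (h : IsRankModel X ν μ M) (P : ℕ → Prop) {u : ℝ} (hu : 5 / 6 < u)
    (hq : ∀ᶠ H : ℝ in atTop,
      (modelLaw (ν H) (X H)).toMeasure.real {A : SqMatrix | P A.kerRank} ≤ H ^ (-u)) :
    ∀ᵐ ω ∂μ, {E : EllCurve | P (M E ω).kerRank}.Finite := by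
  refine ae_finite_setOf_mem_of_measureReal_le (S := fun E => {ω | P (M E ω).kerRank}) hu ?_
  filter_upwards [EllCurve.tendsto_height.eventually hq] with E hE
  exact (h.measureReal_eq P E).trans_le hE

lemma ae_isPowO1_kerRank_eq (h : IsRankModel X ν μ M) (hlaw : RankLawAsymptotics X ν) {e : ℕ}
    (he : e ≤ 1) :
    ∀ᵐ ω ∂μ, IsPowO1 (countRank (fun E => (M E ω).kerRank) (fun k => k = e)) (20 / 24) := by
  have hu := h.ae_countRank_le (fun k => k = e) (u := 0) (s := 20 / 24) (by norm_num)
    (by norm_num) fun δ hδ => by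
      filter_upwards [eventually_ge_atTop 1] with H hH
      refine measureReal_le_one.trans (Real.one_le_rpow hH (by linarith))
  have hl := h.ae_le_countRank (fun k => k = e) (u := 0) (s := 20 / 24) le_rfl (by norm_num)
    (by norm_num) fun δ hδ => by
      filter_upwards [hlaw.half e he, eventually_le_rpow 4 hδ, eventually_ge_atTop 1]
        with H h1 h2 hH
      refine le_trans ?_ h1
      rw [show (-0 - δ : ℝ) = -δ by ring, Real.rpow_neg (by linarith), one_div]
      exact inv_anti₀ (by norm_num) h2
  filter_upwards [hu, hl] with ω h1 h2 using isPowO1_of_eventually h2 h1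

/-- Rank 21 is included: there the exponent is 0 and only the upper bound survives. -/
lemma ae_countRank_ge_le (h : IsRankModel X ν μ M) (hlaw : RankLawAsymptotics X ν) {r : ℕ}
    (hr : 1 ≤ r) (hr' : r ≤ 21) :
    ∀ᵐ ω ∂μ, ∀ δ : ℝ, 0 < δ → ∀ᶠ H : ℝ in atTop,
      countRank (fun E => (M E ω).kerRank) (fun k => r ≤ k) H ≤ H ^ ((21 - (r : ℝ)) / 24 + δ) := by
  have hr21 : (r : ℝ) ≤ 21 := by exact_mod_cast hr'
  refine h.ae_countRank_le (fun k => r ≤ k) (u := ((r : ℝ) - 1) / 24) (by linarith) (by ring)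
    fun δ hδ => ?_
  rw [← neg_div]
  exact hlaw.upper r hr δ hδ

lemma ae_isPowO1_le_kerRank (h : IsRankModel X ν μ M) (hlaw : RankLawAsymptotics X ν) {r : ℕ}
    (hr : 1 ≤ r) (hr' : r ≤ 20) :
    ∀ᵐ ω ∂μ, IsPowO1 (countRank (fun E => (M E ω).kerRank) (fun k => r ≤ k))
      ((21 - (r : ℝ)) / 24) := by
  have hr1 : (1 : ℝ) ≤ r := by exact_mod_cast hr
  have hr20 : (r : ℝ) ≤ 20 := by exact_mod_cast hr'
  have hl := h.ae_le_countRank (fun k => r ≤ k) (u := ((r : ℝ) - 1) / 24)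
    (s := (21 - (r : ℝ)) / 24) (by linarith) (by linarith) (by ring) fun δ hδ => by
      rw [← neg_div]
      exact hlaw.lower r hr δ hδ
  filter_upwards [h.ae_countRank_ge_le hlaw hr (by omega), hl] with ω h1 h2
    using isPowO1_of_eventually h2 h1

lemma ae_finite_lt_kerRank (h : IsRankModel X ν μ M) (hlaw : RankLawAsymptotics X ν) :
    ∀ᵐ ω ∂μ, {E : EllCurve | 21 < (M E ω).kerRank}.Finite := by
  -- Rank at least 22 has probability `H ^ (-42/48 + o(1))`, and `41/48` lies strictly between `5/6
  -- = 40/48` and `42/48`.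
  refine h.ae_finite (fun k => 21 < k) (u := 41 / 48) (by norm_num) ?_
  have h1 := hlaw.upper 22 (by norm_num) (1 / 48) (by norm_num)
  rw [show -(((22 : ℕ) : ℝ) - 1) / 24 + 1 / 48 = -(41 / 48) by norm_num] at h1
  exact h1

end IsRankModel

theorem theoremT :
    ∃ g : ℝ → ℝ, Tendsto g atTop atTop ∧
      ∀ (η : ℝ → ℝ) (X : ℝ → ℝ≥0) (ν : ℝ → PMF ℕ),
        Tendsto η atTop atTop →
        (∀ᶠ H in atTop, η H ≤ g H) →
        IsPowO1 (fun H => (X H : ℝ) ^ η H) (1 / 12) →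
        IsSizeLaw η ν →
        ∀ (Ω : Type*) [MeasurableSpace Ω] (μ : Measure Ω) [IsProbabilityMeasure μ]
          (M : EllCurve → Ω → SqMatrix), IsRankModel X ν μ M →
          ∀ᵐ ω ∂μ,
            IsPowO1 (countRank (fun E => (M E ω).kerRank) (fun k => k = 0)) (20 / 24) ∧
            IsPowO1 (countRank (fun E => (M E ω).kerRank) (fun k => k = 1)) (20 / 24) ∧
            (∀ r : ℕ, 2 ≤ r → r ≤ 20 →
              IsPowO1 (countRank (fun E => (M E ω).kerRank) (fun k => r ≤ k))
                ((21 - (r : ℝ)) / 24)) ∧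
            LePowO1 (countRank (fun E => (M E ω).kerRank) (fun k => 21 ≤ k)) 0 ∧
            {E : EllCurve | 21 < (M E ω).kerRank}.Finite := by
  obtain ⟨g, hg, hlaw⟩ := exists_rankLawAsymptotics
  refine ⟨g, hg, fun η X ν hη hηg hX hν Ω _ μ _ M hM => ?_⟩
  have h := hlaw η X ν hη hηg hX hν
  have hmid : ∀ᵐ ω ∂μ, ∀ r : ℕ, 2 ≤ r → r ≤ 20 →
      IsPowO1 (countRank (fun E => (M E ω).kerRank) (fun k => r ≤ k)) ((21 - (r : ℝ)) / 24) :=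
    ae_all_iff.mpr fun r => by
      rw [eventually_imp_distrib_left]
      intro h2
      rw [eventually_imp_distrib_left]
      intro h20
      exact hM.ae_isPowO1_le_kerRank h (by omega) h20
  filter_upwards [hM.ae_isPowO1_kerRank_eq h zero_le_one, hM.ae_isPowO1_kerRank_eq h le_rfl, hmid,
    hM.ae_countRank_ge_le h (r := 21) (by norm_num) le_rfl, hM.ae_finite_lt_kerRank h]
    with ω h0 h1 h2 h21 hfin
  refine ⟨h0, h1, h2, lePowO1_of_eventually fun δ hδ => ?_, hfin⟩
  have h3 := h21 δ hδ
  norm_num at h3 ⊢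
  exact h3
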